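/- Let $M$ be a smooth second countable Hausdorff manifold of dimension $n$. Let $\mathcal M$ be the space of smooth Riemannian metrics on $M$, with tangent space at each point the space $\mathcal D$ of smooth symmetric $\binom02$-tensor fields with compact support (so a smooth map into $\mathcal M$ is a jointly smooth family of metrics which, locally in the parameter, varies only inside a compact subset of $M$). View $\binom02$-tensors as maps $TM\to T^*M$, so that $g^{-1}h$ is an endomorphism of $TM$, and equip $\mathcal M$ with the Riemannian metric $G_g(h,k)=\int_M\operatorname{tr}(g^{-1}hg^{-1}k)\operatorname{Vol}(g)$. Put $$\Gamma_g(h,k)=\tfrac12hg^{-1}k+\tfrac12kg^{-1}h+\tfrac14\operatorname{tr}(g^{-1}hg^{-1}k)\,g-\tfrac14\operatorname{tr}(g^{-1}h)\,k-\tfrac14\operatorname{tr}(g^{-1}k)\,h .$$ This is the Christoffel symbol of the Levi-Civita connection of $G$, i.e. $\nabla_{\partial_t}V=\partial_tV-\Gamma_{g}(g',V)$ for a vector field $V$ along a curve $g(t)$. A geodesic segment is a smooth curve $g:[0,a]\to\mathcal M$, $a>0$, with $\nabla_{\partial_t}g'=0$. A Jacobi field along it is a field $J(t)=\partial_s|_{s=0}\,\alpha(t,s)$,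 where $\alpha:[0,a]\times(-\varepsilon,\varepsilon)\to\mathcal M$ is smooth, each $\alpha(\cdot,s)$ is a geodesic, and $\alpha(\cdot,0)=g$. Let $g:[0,a]\to\mathcal M$ be a geodesic segment with $g(0)=g^0$ and $g'(0)=h\in\mathcal D$, and let $k,\ell\in\mathcal D$. Write $H=(g^0)^{-1}h$, $K=(g^0)^{-1}k$, $L=(g^0)^{-1}\ell$, and $$\hat L=-KH+L+(g^0)^{-1}\Gamma_{g^0}(k,h).$$ For an endomorphism $A$ put $A_0=A-\frac{\operatorname{tr}A}{n}\operatorname{Id}$ and $\operatorname{ad}(A)B=AB-BA$. Put $P(t)=g(t)^{-1}g'(t)$, $$a(t)=\tfrac2n\log\Big(\big(1+\tfrac t4\operatorname{tr}H\big)^2+\tfrac n{16}\operatorname{tr}(H_0^2)\,t^2\Big),$$ $$b(t)=\begin{cases}\dfrac{4}{\sqrt{n\operatorname{tr}(H_0^2)}}\arctan\left(\dfrac{\sqrt{n\operatorname{tr}(H_0^2)}\;t}{4+t\operatorname{tr}H}\right)&\text{where }\operatorname{tr}(H_0^2)\ne0,\\[3mm]\dfrac{t}{1+\frac t4\operatorname{tr}H}&\text{where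 }\operatorname{tr}(H_0^2)=0.\end{cases}$$ Here $\arctan$ has values in $(-\frac\pi2,\frac\pi2)$ where $\operatorname{tr}H\ge0$. Where $\operatorname{tr}H<0$ it is taken in $[0,\frac\pi2)$ for $0\le t<-4/\operatorname{tr}H$, equal to $\frac\pi2$ at $t=-4/\operatorname{tr}H$, and in $(\frac\pi2,\pi)$ for $t>-4/\operatorname{tr}H$. At points where $H_0\neq0$ let $P(t)^\perp$ be the unique endomorphism in the plane spanned by $\operatorname{Id}$ and $H_0$ that has trace $e^{-\frac12na(t)}$ and satisfies $\operatorname{tr}(P(t)P(t)^\perp)=0$, and put $(g'(t))^\perp=g(t)P(t)^\perp$. Then there is a Jacobi field $J$ along $g$ with $J(0)=k$ and $(\nabla_{\partial_t}J)(0)=\ell$, and every such $J$ is given, for all $t\in[0,a]$, at the points of $M$ where $H_0\ne0$ by $$\begin{aligned}J(t)={}&\frac{\operatorname{tr}(H\hat L)}{\operatorname{tr}(H^2)}\,t\,g'(t)+\frac{\operatorname{tr}(\hat L)\operatorname{tr}(H^2)-\operatorname{tr}(\hat LH)\operatorname{tr}(H)}{\operatorname{tr}(H^2)}\,t\,(g'(t))^\perp\\&+b(t)\,g(t)\left(-\frac{\operatorname{tr}(H_0\hat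 L_0)}{\operatorname{tr}(H_0^2)}H_0+\hat L_0\right)\\&+g(t)\sum_{m=1}^\infty\frac{(-\operatorname{ad}(b(t)H))^m}{(m+1)!}\big(b(t)\hat L\big)+k\,(g^0)^{-1}g(t),\end{aligned}$$ where the series converges, and at the points where $H_0=0$ by $$J(t)=b(t)\,g(t)\hat L+k\,(g^0)^{-1}g(t).$$ -/

import Mathlib

open Set Filter Topology MeasureTheory Bundle
open scoped Manifold ContDiff

noncomputable section

/-! ### Tensor fields on a manifold

A `(0,2)`-tensor at `x` is a linear map from the tangent space to its dual, an endomorphism of the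
tangent space is a `(1,1)`-tensor; products such as `h g⁻¹ k` are compositions of linear maps. -/

/-- The fibre at `x` of the bundle `L(TM, T*M)` of `(0,2)`-tensors. -/
abbrev Form02 (n : ℕ) {M : Type*} [TopologicalSpace M] [ChartedSpace (EuclideanSpace ℝ (Fin n)) M]
    (x : M) : Type :=
  TangentSpace (𝓡 n) x →L[ℝ] TangentSpace (𝓡 n) x →L[ℝ] ℝ

/-- The fibre at `x` of the bundle `L(TM, TM)` of `(1,1)`-tensors. -/
abbrev Endo (n : ℕ) {M : Type*} [TopologicalSpace M] [ChartedSpace (EuclideanSpace ℝ (Fin n)) M]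
    (x : M) : Type :=
  TangentSpace (𝓡 n) x →L[ℝ] TangentSpace (𝓡 n) x

/-- Arbitrary (not necessarily smooth) fields of `(0,2)`-tensors. -/
abbrev Field02 (n : ℕ) (M : Type*) [TopologicalSpace M]
    [ChartedSpace (EuclideanSpace ℝ (Fin n)) M] : Type _ :=
  (x : M) → Form02 n x

section Pointwise

variable {n : ℕ} {M : Type*} [TopologicalSpace M] [ChartedSpace (EuclideanSpace ℝ (Fin n)) M]
  {x : M}

/-- The `(1,1)`-tensor `g⁻¹ h`. -/
def raise (g h : Form02 n x) : Endo n x :=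
  (ContinuousLinearMap.inverse g).comp h

/-- Trace of a `(1,1)`-tensor. -/
def tr (A : Endo n x) : ℝ :=
  LinearMap.trace ℝ (TangentSpace (𝓡 n) x) A.toLinearMap

/-- The traceless part `A₀ = A - (tr A / n) Id`. -/
def traceless (A : Endo n x) : Endo n x :=
  A - (tr A / n) • ContinuousLinearMap.id ℝ (TangentSpace (𝓡 n) x)

/-- The Christoffel symbol
`Γ_g(h,k) = ½ h g⁻¹ k + ½ k g⁻¹ h + ¼ tr(g⁻¹ h g⁻¹ k) g - ¼ tr(g⁻¹ h) k - ¼ tr(g⁻¹ k) h`. -/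
def christoffelAt (g h k : Form02 n x) : Form02 n x :=
  (1 / 2 : ℝ) • h.comp (raise g k) + (1 / 2 : ℝ) • k.comp (raise g h)
    + (1 / 4 * tr ((raise g h).comp (raise g k))) • g
    - (1 / 4 * tr (raise g h)) • k - (1 / 4 * tr (raise g k)) • h

/-- `a(t)` for the initial direction `H = (g⁰)⁻¹ h`. -/
def aFun (H : Endo n x) (t : ℝ) : ℝ :=
  2 / n * Real.log ((1 + t / 4 * tr H) ^ 2
    + n / 16 * tr ((traceless H).comp (traceless H)) * t ^ 2)

/-- The branch of `arctan (u t / (4 + t τ))` used in `b(t)`, for `t ≥ 0`: the principal one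
if `τ ≥ 0`, and the one that is continuous with values in `[0, π)` if `τ < 0`. -/
def arctanBranch (u τ t : ℝ) : ℝ :=
  if 0 ≤ τ ∨ t < -4 / τ then Real.arctan (u * t / (4 + t * τ))
  else if t = -4 / τ then Real.pi / 2
  else Real.arctan (u * t / (4 + t * τ)) + Real.pi

/-- `b(t)` for the initial direction `H = (g⁰)⁻¹ h`. -/
def bFun (H : Endo n x) (t : ℝ) : ℝ :=
  let q := tr ((traceless H).comp (traceless H))
  if q ≠ 0 then 4 / √(n * q) * arctanBranch (√(n * q)) (tr H) t
  else t / (1 + t / 4 * tr H)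

/-- `N` is the endomorphism `P^⊥`: it lies in the plane spanned by `Id` and `H₀`, has trace
`e^{-n a(t)/2}`, and is orthogonal to `P` for the inner product `tr(A B)`. -/
structure IsPerp (H P : Endo n x) (t : ℝ) (N : Endo n x) : Prop where
  mem_plane : N ∈ Submodule.span ℝ
    {ContinuousLinearMap.id ℝ (TangentSpace (𝓡 n) x), traceless H}
  trace_eq : tr N = Real.exp (-(1 / 2) * n * aFun H t)
  orthogonal : tr (P.comp N) = 0

/-- `ad(A) B = A B - B A`. -/
def adAction (A B : Endo n x) : Endo n x :=
  A.comp B - B.comp A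

/-- The term `(-ad(A))^m / (m+1)!` applied to `B`. -/
def adTerm (A B : Endo n x) (m : ℕ) : Endo n x :=
  ((Nat.factorial (m + 1) : ℝ)⁻¹) • (fun X ↦ -adAction A X)^[m] B

end Pointwise

/-! ### The manifold of Riemannian metrics -/

section Global

variable {n : ℕ} {M : Type*} [TopologicalSpace M] [ChartedSpace (EuclideanSpace ℝ (Fin n)) M]
  [IsManifold (𝓡 n) ∞ M]

/-- A family `α p` of `(0,2)`-tensor fields, with parameter `p` in a subset `S` of a normed space,
is jointly smooth in `(p, x) ∈ S × M`. -/
def IsJointlySmoothOn {P : Type*} [NormedAddCommGroup P] [NormedSpace ℝ P] (S : Set P)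
    (α : P → Field02 n M) : Prop :=
  ContMDiffOn (𝓘(ℝ, P).prod (𝓡 n))
    ((𝓡 n).prod 𝓘(ℝ, EuclideanSpace ℝ (Fin n) →L[ℝ] EuclideanSpace ℝ (Fin n) →L[ℝ] ℝ)) ∞
    (fun p : P × M ↦ TotalSpace.mk'
      (EuclideanSpace ℝ (Fin n) →L[ℝ] EuclideanSpace ℝ (Fin n) →L[ℝ] ℝ)
      (E := fun x : M ↦ TangentSpace (𝓡 n) x →L[ℝ] TangentSpace (𝓡 n) x →L[ℝ] ℝ)
      p.2 (α p.1 p.2))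
    (S ×ˢ univ)

/-- Smooth sections of `L(TM, T*M)`. -/
def IsSmoothField (h : Field02 n M) : Prop :=
  ContMDiff (𝓡 n)
    ((𝓡 n).prod 𝓘(ℝ, EuclideanSpace ℝ (Fin n) →L[ℝ] EuclideanSpace ℝ (Fin n) →L[ℝ] ℝ)) ∞
    (fun x : M ↦ TotalSpace.mk'
      (EuclideanSpace ℝ (Fin n) →L[ℝ] EuclideanSpace ℝ (Fin n) →L[ℝ] ℝ)
      (E := fun x : M ↦ TangentSpace (𝓡 n) x →L[ℝ] TangentSpace (𝓡 n) x →L[ℝ] ℝ)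
      x (h x))

/-- The points of the manifold of metrics: smooth Riemannian metrics on `M`. -/
structure IsMetric (g : Field02 n M) : Prop where
  smooth : IsSmoothField g
  symm : ∀ x v w, g x v w = g x w v
  pos : ∀ x v, v ≠ 0 → 0 < g x v v

/-- The tangent vectors to the manifold of metrics: smooth symmetric `(0,2)`-tensor fields with
compact support. -/
structure IsTangent (h : Field02 n M) : Prop where
  smooth : IsSmoothField h
  symm : ∀ x v w, h x v w = h x w v
  compact_support : IsCompact (closure {x | h x ≠ 0})

/-- Smooth maps from `S` to the manifold of metrics, whose model space is the inductive limit of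
the spaces of tensor fields supported in a given compact set: the family is jointly smooth, consists
of metrics, and locally in the parameter varies only in a compact subset of `M`. -/
structure IsSmoothFamilyOfMetrics {P : Type*} [NormedAddCommGroup P] [NormedSpace ℝ P] (S : Set P)
    (α : P → Field02 n M) : Prop where
  metric : ∀ p ∈ S, IsMetric (α p)
  smooth : IsJointlySmoothOn S α
  locally_compact_variation : ∀ p ∈ S, ∃ C : Set M, IsCompact C ∧
    ∀ᶠ q in 𝓝[S] p, ∀ x ∉ C, α q x = α p x

/-! ### The canonical Riemannian metric on the manifold of metrics -/

/-- The density `√det g_{ij}` of `Vol(g)` at `x` in the chart around `p`. -/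
def volDensity (g : Field02 n M) (p x : M) : ℝ :=
  let e := trivializationAt (EuclideanSpace ℝ (Fin n)) (TangentSpace (𝓡 n) (M := M)) p
  √(Matrix.det (Matrix.of fun i j : Fin n ↦
    g x (e.symm x (EuclideanSpace.basisFun (Fin n) ℝ i))
      (e.symm x (EuclideanSpace.basisFun (Fin n) ℝ j))))

/-- A smooth partition of unity subordinate to the charts. -/
def chartPartition (n : ℕ) (M : Type*) [TopologicalSpace M] [T2Space M] [SecondCountableTopology M]
    [ChartedSpace (EuclideanSpace ℝ (Fin n)) M] [IsManifold (𝓡 n) ∞ M] :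
    SmoothPartitionOfUnity M (𝓡 n) M univ :=
  haveI : LocallyCompactSpace M := Manifold.locallyCompact_of_finiteDimensional (𝓡 n)
  (SmoothPartitionOfUnity.exists_isSubordinate_chartAt_source (𝓡 n) M).choose

/-- `∫_M f Vol(g)` for continuous functions `f` with compact support, computed in charts with a
partition of unity. -/
def integralVol [T2Space M] [SecondCountableTopology M] (g : Field02 n M) (f : M → ℝ) : ℝ :=
  ∑ᶠ p : M, ∫ y in (extChartAt (𝓡 n) p).target,
    chartPartition n M p ((extChartAt (𝓡 n) p).symm y) * f ((extChartAt (𝓡 n) p).symm y)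
      * volDensity g p ((extChartAt (𝓡 n) p).symm y)

/-- The canonical Riemannian metric `G_g(h,k) = ∫_M tr(g⁻¹ h g⁻¹ k) Vol(g)`. -/
def canonicalMetric [T2Space M] [SecondCountableTopology M] (g h k : Field02 n M) : ℝ :=
  integralVol g fun x ↦ tr ((raise (g x) (h x)).comp (raise (g x) (k x)))

/-- The Christoffel symbol `Γ_g(h,k)` of tensor fields. -/
def christoffel (g h k : Field02 n M) : Field02 n M :=
  fun x ↦ christoffelAt (g x) (h x) (k x)

/-- `Γ` is the Christoffel symbol of the Levi-Civita connection of the canonical metric, for the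
sign convention in which `∇_h k = dk(h) - Γ(h,k)`: it is symmetric and metric. The metric condition
is written for constant vector fields `k, l` on the manifold of metrics, which have
`∇_h k = -Γ(h,k)`. -/
structure IsLeviCivita [T2Space M] [SecondCountableTopology M]
    (Γ : Field02 n M → Field02 n M → Field02 n M → Field02 n M) : Prop where
  tangent : ∀ g h k, IsMetric g → IsTangent h → IsTangent k → IsTangent (Γ g h k)
  torsion_free : ∀ g h k, IsMetric g → IsTangent h → IsTangent k → Γ g h k = Γ g k h
  metric : ∀ g h k l, IsMetric g → IsTangent h → IsTangent k → IsTangent l →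
    HasDerivAt (fun s : ℝ ↦ canonicalMetric (g + s • h) k l)
      (canonicalMetric g (-Γ g h k) l + canonicalMetric g k (-Γ g h l)) 0

/-! ### Geodesics and Jacobi fields -/

/-- The derivative in `t ∈ [0,a]` of a curve of tensor fields (one-sided at the end points). -/
def timeDeriv (a : ℝ) (V : ℝ → Field02 n M) (t : ℝ) : Field02 n M :=
  fun x ↦ derivWithin (fun τ ↦ V τ x) (Icc 0 a) t

/-- The covariant derivative `∇_{∂t} V = V_t - Γ_g(g_t, V)` of a vector field `V` along a curve
`g` on `[0,a]`. -/
def covDeriv (a : ℝ) (g V : ℝ → Field02 n M) (t : ℝ) : Field02 n M :=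
  timeDeriv a V t - christoffel (g t) (timeDeriv a g t) (V t)

/-- Geodesic segments `g : [0,a] → 𝓜`. -/
structure IsGeodesic (a : ℝ) (g : ℝ → Field02 n M) : Prop where
  smooth : IsSmoothFamilyOfMetrics (Icc 0 a) g
  geodesic : ∀ t ∈ Icc 0 a, covDeriv a g (timeDeriv a g) t = 0

/-- Smooth variations `α : [0,a] × (-ε,ε) → 𝓜` of `g` through geodesics. -/
structure IsGeodesicVariation (a ε : ℝ) (g : ℝ → Field02 n M) (α : ℝ × ℝ → Field02 n M) :
    Prop where
  smooth : IsSmoothFamilyOfMetrics (Icc 0 a ×ˢ Ioo (-ε) ε) α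
  geodesic : ∀ s ∈ Ioo (-ε) ε, IsGeodesic a fun t ↦ α (t, s)
  base : ∀ t ∈ Icc 0 a, α (t, 0) = g t

/-- Jacobi fields along the geodesic segment `g` on `[0,a]`: infinitesimal geodesic variations. -/
def IsJacobiField (a : ℝ) (g J : ℝ → Field02 n M) : Prop :=
  ∃ ε > 0, ∃ α : ℝ × ℝ → Field02 n M, IsGeodesicVariation a ε g α ∧
    ∀ t ∈ Icc 0 a, ∀ x, HasDerivAt (fun s ↦ α (t, s) x) (J t x) 0

end Global

end

/-! The metric G contains no derivatives along M, so the geodesic equation is an ordinary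
differential equation in each fibre. In terms of P = g⁻¹g' it reads P' = ¼ tr(P²) Id − ½ tr(P) P.
Let D be the solution of D' = ½ tr(P) D with D(0) = 1, the ratio of the volume densities. Then D·P₀
is constant, hence D'' is constant as well, and D is the polynomial v(t) = (1 + tτ/4)² + yt²/16 with
τ = tr H and y = n tr(H₀²). This determines P, and g(t) = g⁰ e^{a Id + b H₀} with a = (2/n) log v
and b' = 1/v. No general theorem on differential equations is used (`volRatio_pos_and_velocity_eq`,
`geodesic_eq_closedForm`).

Consequently a variation through geodesics is the closed formula applied to its initial data, and
J(t) is the derivative of that formula with respect to the data. Along the variation g⁻¹h has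
derivative (g⁰)⁻¹(J'(0) − kH), which is L̂ because J'(0) = ℓ + Γ(h,k) (`sharp_initial_eq`). The
derivative of the exponential is e^X ∑ (−ad X)^m X'/(m+1)!. Its terms with m ≥ 1 are the commutator
series; the term m = 0 together with the derivatives of a and b gives the terms along g', along its
orthogonal and along the traceless part (`hasDerivAt_closedForm_of_devSq_pos`,
`hasDerivAt_closedForm_of_dev_eq_zero`).

For existence, the closed formula is applied to the data g⁰ + sk and h + s(ℓ + Γ(h,k)). Two points
need care. The function b has to be smooth across y = 0; it is, since arctan √z / √z is a power
series in z (`contDiffAt_angleFun`). The formula has to be valid for all t in [0,a] and all points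
of M with one bound on s; this follows from compactness of the supports
(`exists_pos_and_angleDomain`).

That Γ belongs to the Levi-Civita connection is a pointwise trace identity
(`tracePairing_modelChristoffel`), combined with differentiation under the integral sign in finitely
many charts (`hasDerivAt_canonicalMetric`). -/

noncomputable section

/-! ### The scalar functions in the closed formula for geodesics -/

/-- The coefficients of the power series of `arctan √z / √z`. -/
def arctanSqrtCoeff (k : ℕ) : ℝ := (-1) ^ k / (2 * k + 1)

/-- The power series of `arctan √z / √z`. -/
def arctanSqrt (z : ℝ) : ℝ := FormalMultilinearSeries.ofScalarsSum arctanSqrtCoeff z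

theorem arctanSqrt_zero : arctanSqrt 0 = 1 := by
  simp [arctanSqrt, FormalMultilinearSeries.ofScalarsSum_zero, arctanSqrtCoeff]

/-- The coefficients are bounded by 1, so the series converges on the unit disc. Smoothness at z = 0
from both sides is what makes b smooth where y = 0, although √y is not. -/
theorem contDiffAt_arctanSqrt {z : ℝ} (hz : |z| < 1) : ContDiffAt ℝ ∞ arctanSqrt z := by
  set p := FormalMultilinearSeries.ofScalars ℝ arctanSqrtCoeff
  have hr : ((1 : NNReal) : ENNReal) ≤ p.radius := by
    refine p.le_radius_of_bound 1 fun m ↦ ?_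
    have : (0 : ℝ) < 2 * m + 1 := by positivity
    simp only [p, FormalMultilinearSeries.ofScalars_norm, arctanSqrtCoeff, NNReal.coe_one, one_pow,
      mul_one, norm_div, norm_pow, norm_neg, norm_one, Real.norm_eq_abs, abs_of_pos this]
    rw [div_le_one this]
    linarith [(Nat.cast_nonneg m : (0 : ℝ) ≤ m)]
  have hp : HasFPowerSeriesOnBall arctanSqrt p 0 p.radius :=
    p.hasFPowerSeriesOnBall (lt_of_lt_of_le (by simp) hr)
  refine (hp.analyticAt_of_mem (y := z) ?_).contDiffAt
  refine Metric.eball_subset_eball hr ?_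
  simpa [Metric.mem_eball, edist_dist] using hz

theorem arctanSqrt_sq_mul {x : ℝ} (hx : |x| < 1) : arctanSqrt (x ^ 2) * x = Real.arctan x := by
  rw [← (Real.hasSum_arctan (x := x) (by simpa using hx)).tsum_eq, arctanSqrt,
    FormalMultilinearSeries.ofScalarsSum_eq_tsum, ← tsum_mul_right]
  refine tsum_congr fun k ↦ ?_
  simp only [arctanSqrtCoeff, smul_eq_mul]
  push_cast
  ring

theorem arg_eq_arctan {x y : ℝ} (hx : 0 < x) : Complex.arg ⟨x, y⟩ = Real.arctan (y / x) := by
  rw [Complex.arg_of_re_nonneg (by simpa using hx.le), Real.arctan_eq_arcsin]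
  congr 1
  have h1 : ‖(⟨x, y⟩ : ℂ)‖ = x * √(1 + (y / x) ^ 2) := by
    rw [Complex.norm_def, Complex.normSq_mk]
    have : x * x + y * y = x ^ 2 * (1 + (y / x) ^ 2) := by field_simp
    rw [this, Real.sqrt_mul (sq_nonneg x), Real.sqrt_sq hx.le]
  rw [h1]
  field_simp

theorem arg_eq_arctan_add_pi {x y : ℝ} (hx : x < 0) (hy : 0 ≤ y) :
    Complex.arg ⟨x, y⟩ = Real.arctan (y / x) + Real.pi := by
  rw [Complex.arg_of_re_neg_of_im_nonneg (by simpa using hx) (by simpa using hy)]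
  have h := arg_eq_arctan (y := -y) (neg_pos.2 hx)
  rw [Complex.arg_of_re_nonneg (by simpa using hx.le)] at h
  rw [neg_div_neg_eq] at h
  rw [← h]
  congr 3
  simp [Complex.norm_def, Complex.normSq_mk]

/-- The factor of the volume density along a geodesic; `τ = tr H`, `y = n tr(H₀²)`. -/
def volRatio (τ y t : ℝ) : ℝ := (1 + t / 4 * τ) ^ 2 + y * t ^ 2 / 16

/-- The function `b(t)`, with `τ = tr H` and `y = n tr(H₀²)`, extended smoothly to small
negative values of `y`. -/
def angleFun (τ y t : ℝ) : ℝ :=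
  if 0 < 4 + t * τ ∧ |y * t ^ 2 / (4 + t * τ) ^ 2| < 1 then
    4 * t / (4 + t * τ) * arctanSqrt (y * t ^ 2 / (4 + t * τ) ^ 2)
  else 4 / √y * (Complex.log ⟨4 + t * τ, √y * t⟩).im

/-- On the overlap both expressions equal (4/√y) arctan(√y t/(4 + tτ)), so the power series matters
only for y ≤ 0. -/
theorem angleFun_of_pos {τ y t : ℝ} (hy : 0 < y) :
    angleFun τ y t = 4 / √y * (Complex.log ⟨4 + t * τ, √y * t⟩).im := by
  unfold angleFun
  split_ifs with h
  · have hs := Real.sqrt_pos.2 hy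
    have h2 : y * t ^ 2 / (4 + t * τ) ^ 2 = (√y * t / (4 + t * τ)) ^ 2 := by
      rw [div_pow, mul_pow, Real.sq_sqrt hy.le]
    rw [Complex.log_im, arg_eq_arctan h.1, ← arctanSqrt_sq_mul, h2]
    · have := h.1.ne'
      field_simp
    · rw [h2] at h
      rw [← sq_lt_one_iff_abs_lt_one]
      rw [abs_of_nonneg (sq_nonneg _)] at h
      exact h.2
  · rfl

theorem angleFun_of_zero {τ t : ℝ} (ht : 0 < 4 + t * τ) : angleFun τ 0 t = 4 * t / (4 + t * τ) := by
  simp [angleFun, ht, arctanSqrt_zero]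

theorem angleFun_zero_right (τ y : ℝ) : angleFun τ y 0 = 0 := by simp [angleFun]

theorem mem_slitPlane_of_pos {τ u t : ℝ} (hu : 0 < u) :
    (⟨4 + t * τ, u * t⟩ : ℂ) ∈ Complex.slitPlane := by
  rw [Complex.mem_slitPlane_iff]
  by_cases h : t = 0
  · left; simp [h]
  · right; simp [h, hu.ne']

theorem contDiffAt_complex_mk {E : Type*} [NormedAddCommGroup E] [NormedSpace ℝ E] {f g : E → ℝ}
    {x : E} (hf : ContDiffAt ℝ ∞ f x) (hg : ContDiffAt ℝ ∞ g x) :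
    ContDiffAt ℝ ∞ (fun z ↦ (⟨f z, g z⟩ : ℂ)) x := by
  have : (fun z ↦ (⟨f z, g z⟩ : ℂ)) = fun z ↦ Complex.equivRealProdCLM.symm (f z, g z) := rfl
  rw [this]
  exact Complex.equivRealProdCLM.symm.contDiff.contDiffAt.comp x (hf.prodMk hg)

/-- The parameters at which the geodesic with initial invariants `τ`, `y` is defined. -/
def AngleDomain (τ y t : ℝ) : Prop := 0 < y ∨ y = 0 ∧ 0 < 4 + t * τ

/-- For y > 0 the logarithm is smooth at 4 + tτ + i√y t: the imaginary part vanishes only at t = 0,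
where the real part is 4. At y = 0 the power series is in force on a whole neighbourhood, negative y
included. -/
theorem contDiffAt_angleFun {τ y t : ℝ} (h : AngleDomain τ y t) :
    ContDiffAt ℝ ∞ (fun p : ℝ × ℝ × ℝ ↦ angleFun p.1 p.2.1 p.2.2) (τ, y, t) := by
  have d1 : ContDiffAt ℝ ∞ (fun p : ℝ × ℝ × ℝ ↦ 4 + p.2.2 * p.1) (τ, y, t) := by fun_prop
  rcases h with hy | ⟨rfl, hc⟩
  · have hs := Real.sqrt_pos.2 hy
    have d2 : ContDiffAt ℝ ∞ (fun p : ℝ × ℝ × ℝ ↦ √p.2.1) (τ, y, t) :=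
      ContDiffAt.sqrt (by fun_prop) hy.ne'
    have : (fun p : ℝ × ℝ × ℝ ↦ angleFun p.1 p.2.1 p.2.2) =ᶠ[𝓝 (τ, y, t)] fun p ↦
        4 / √p.2.1 * (Complex.log ⟨4 + p.2.2 * p.1, √p.2.1 * p.2.2⟩).im := by
      have : ∀ᶠ p : ℝ × ℝ × ℝ in 𝓝 (τ, y, t), 0 < p.2.1 :=
        Tendsto.eventually_const_lt hy (continuous_fst.comp continuous_snd).continuousAt
      filter_upwards [this] with p hp using angleFun_of_pos hp
    refine ContDiffAt.congr_of_eventuallyEq ?_ this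
    refine (contDiffAt_const.div d2 hs.ne').mul ?_
    have h3 : ContDiffAt ℝ ∞ (fun p : ℝ × ℝ × ℝ ↦
        Complex.log ⟨4 + p.2.2 * p.1, √p.2.1 * p.2.2⟩) (τ, y, t) := by
      refine ContDiffAt.comp (τ, y, t) (g := Complex.log)
        ((Complex.contDiffAt_log (mem_slitPlane_of_pos hs)).restrict_scalars ℝ)
        (contDiffAt_complex_mk d1 (d2.mul (by fun_prop)))
    exact Complex.imCLM.contDiff.contDiffAt.comp _ h3
  · have d3 : ContDiffAt ℝ ∞ (fun p : ℝ × ℝ × ℝ ↦ p.2.1 * p.2.2 ^ 2 / (4 + p.2.2 * p.1) ^ 2)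
        (τ, 0, t) := ContDiffAt.div (by fun_prop) (by fun_prop) (by positivity)
    have : (fun p : ℝ × ℝ × ℝ ↦ angleFun p.1 p.2.1 p.2.2) =ᶠ[𝓝 (τ, 0, t)] fun p ↦
        4 * p.2.2 / (4 + p.2.2 * p.1) *
          arctanSqrt (p.2.1 * p.2.2 ^ 2 / (4 + p.2.2 * p.1) ^ 2) := by
      have h1 : ∀ᶠ p : ℝ × ℝ × ℝ in 𝓝 (τ, 0, t), 0 < 4 + p.2.2 * p.1 :=
        Tendsto.eventually_const_lt hc d1.continuousAt
      have h2 : ∀ᶠ p : ℝ × ℝ × ℝ in 𝓝 (τ, 0, t),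
          |p.2.1 * p.2.2 ^ 2 / (4 + p.2.2 * p.1) ^ 2| < 1 :=
        Tendsto.eventually_lt_const (by simp) d3.continuousAt.abs
      filter_upwards [h1, h2] with p hp hp2
      rw [angleFun, if_pos ⟨hp, hp2⟩]
    refine ContDiffAt.congr_of_eventuallyEq ?_ this
    refine (ContDiffAt.div (by fun_prop) d1 hc.ne').mul ?_
    exact ContDiffAt.comp (τ, (0 : ℝ), t) (g := arctanSqrt) (contDiffAt_arctanSqrt (by simp)) d3

theorem sixteen_mul_volRatio (τ y t : ℝ) :
    16 * volRatio τ y t = (4 + t * τ) ^ 2 + y * t ^ 2 := by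
  unfold volRatio; ring

theorem volRatio_pos {τ y t : ℝ} (h : AngleDomain τ y t) : 0 < volRatio τ y t := by
  have h16 := sixteen_mul_volRatio τ y t
  have : 0 < (4 + t * τ) ^ 2 + y * t ^ 2 := by
    rcases h with hy | ⟨rfl, hc⟩
    · by_cases ht : t = 0
      · subst ht; norm_num
      · have : 0 < t ^ 2 := by positivity
        positivity
    · positivity
  linarith

theorem contDiff_volRatio : ContDiff ℝ ∞ (fun p : ℝ × ℝ × ℝ ↦ volRatio p.1 p.2.1 p.2.2) := by
  unfold volRatio
  fun_prop

/-- The derivative of `angleFun` along a curve of parameters with `y > 0`. -/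
theorem hasDerivAt_angleFun_of_pos {τ y t : ℝ → ℝ} {τ' y' t' s : ℝ} (hτ : HasDerivAt τ τ' s)
    (hy : HasDerivAt y y' s) (ht : HasDerivAt t t' s) (h0 : 0 < y s) :
    HasDerivAt (fun r ↦ angleFun (τ r) (y r) (t r))
      ((4 * (4 + t s * τ s) * (t' + t s * y' / (2 * y s)) - 4 * t s * (t' * τ s + t s * τ'))
        / (16 * volRatio (τ s) (y s) (t s)) - angleFun (τ s) (y s) (t s) * y' / (2 * y s)) s := by
  have hs := Real.sqrt_pos.2 h0
  have hev : (fun r ↦ angleFun (τ r) (y r) (t r)) =ᶠ[𝓝 s] fun r ↦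
      4 / √(y r) * (Complex.log ⟨4 + t r * τ r, √(y r) * t r⟩).im := by
    filter_upwards [Tendsto.eventually_const_lt h0 hy.continuousAt] with r hr using angleFun_of_pos
        hr
  refine HasDerivAt.congr_of_eventuallyEq ?_ hev
  have d2 := hy.sqrt h0.ne'
  have dc : HasDerivAt (fun r ↦ 4 + t r * τ r) (t' * τ s + t s * τ') s := (ht.mul hτ).const_add 4
  have di := d2.mul ht
  have dw : HasDerivAt (fun r ↦ (⟨4 + t r * τ r, √(y r) * t r⟩ : ℂ))
      (⟨t' * τ s + t s * τ', y' / (2 * √(y s)) * t s + √(y s) * t'⟩ : ℂ) s :=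
    Complex.equivRealProdCLM.symm.hasFDerivAt.comp_hasDerivAt s (dc.prodMk di)
  have dl := dw.clog_real (mem_slitPlane_of_pos hs)
  have dim := Complex.imCLM.hasFDerivAt.comp_hasDerivAt s dl
  have dd := ((hasDerivAt_const s (4 : ℝ)).div d2 hs.ne').mul dim
  refine dd.congr_deriv ?_
  rw [angleFun_of_pos h0, sixteen_mul_volRatio]
  have hv := volRatio_pos (τ := τ s) (t := t s) (Or.inl h0)
  have h16 := sixteen_mul_volRatio (τ s) (y s) (t s)
  simp only [Complex.imCLM_apply, Complex.div_im, Complex.normSq_mk, Function.comp, Pi.div_apply]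
  generalize (Complex.log _).im = l
  -- The squared modulus of the complex number is 16 times the volume ratio.
  have hne : (4 + t s * τ s) * (4 + t s * τ s) + √(y s) * t s * (√(y s) * t s) =
      (4 + t s * τ s) ^ 2 + y s * t s ^ 2 := by
    have := Real.sq_sqrt h0.le
    linear_combination (t s ^ 2) * this
  have hne' : (4 + t s * τ s) ^ 2 + y s * t s ^ 2 ≠ 0 := by linarith
  rw [hne]
  set N := (4 + t s * τ s) ^ 2 + y s * t s ^ 2
  have hyy : y s = √(y s) ^ 2 := (Real.sq_sqrt h0.le).symm
  generalize √(y s) = u at *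
  rw [hyy]
  field_simp
  ring

/-- The traceless part of the velocity is H₀/v, and b H₀ is its time integral; hence b' = 1/v. -/
theorem hasDerivAt_angleFun {τ y t : ℝ} (h : AngleDomain τ y t) :
    HasDerivAt (angleFun τ y) (volRatio τ y t)⁻¹ t := by
  have hv := volRatio_pos h
  have h16 := sixteen_mul_volRatio τ y t
  rcases h with hy | ⟨rfl, hc⟩
  · refine (hasDerivAt_angleFun_of_pos (hasDerivAt_const t τ) (hasDerivAt_const t y)
      (hasDerivAt_id t) hy).congr_deriv ?_
    simp only [id]
    field_simp
    ring
  · have hev : angleFun τ 0 =ᶠ[𝓝 t] fun t ↦ 4 * t / (4 + t * τ) := by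
      have : ContinuousAt (fun t ↦ 4 + t * τ) t := by fun_prop
      filter_upwards [Tendsto.eventually_const_lt hc this] with r hr using angleFun_of_zero hr
    refine HasDerivAt.congr_of_eventuallyEq ?_ hev
    have d1 : HasDerivAt (fun t ↦ 4 + t * τ) τ t := by
      simpa using ((hasDerivAt_id t).mul_const τ).const_add 4
    have d2 : HasDerivAt (fun t : ℝ ↦ 4 * t) 4 t := by simpa using (hasDerivAt_id t).const_mul 4
    refine (d2.div d1 hc.ne').congr_deriv ?_
    have : volRatio τ 0 t = (4 + t * τ) ^ 2 / 16 := by unfold volRatio; ring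
    rw [this]
    field_simp
    ring

theorem hasDerivAt_volRatio (τ y t : ℝ) :
    HasDerivAt (volRatio τ y) (τ / 2 + t * (τ ^ 2 + y) / 8) t := by
  have : volRatio τ y = fun t ↦ 1 + t * (τ / 2) + t ^ 2 * ((τ ^ 2 + y) / 16) := by
    funext t; unfold volRatio; ring
  rw [this]
  have := (((hasDerivAt_id t).mul_const (τ / 2)).const_add 1).add
    (((hasDerivAt_id t).pow 2).mul_const ((τ ^ 2 + y) / 16))
  refine this.congr_deriv ?_
  simp
  ring

theorem volRatio_zero (τ y : ℝ) : volRatio τ y 0 = 1 := by simp [volRatio]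

/-- The three cases of the branch are the argument in the right half plane, on the positive
imaginary axis and in the left half plane. As t ≥ 0, the point stays in the closed upper half plane.
-/
theorem arctanBranch_eq_arg {u τ t : ℝ} (hu : 0 < u) (ht : 0 ≤ t) :
    arctanBranch u τ t = Complex.arg ⟨4 + t * τ, u * t⟩ := by
  unfold arctanBranch
  by_cases hτ : 0 ≤ τ
  · rw [if_pos (Or.inl hτ), arg_eq_arctan (by positivity)]
  · push Not at hτ
    have key : t < -4 / τ ↔ 0 < 4 + t * τ := by
      rw [lt_div_iff_of_neg hτ]
      constructor <;> intro h <;> linarith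
    split_ifs with h1 h2
    · rw [arg_eq_arctan]
      exact key.1 (h1.resolve_left (not_le.2 hτ))
    · have h3 : 4 + t * τ = 0 := by rw [h2, div_mul_cancel₀ _ hτ.ne]; norm_num
      rw [h3]
      have : 0 < t := lt_of_le_of_ne ht (by rintro rfl; norm_num at h3)
      exact (Complex.arg_eq_pi_div_two_iff.2 ⟨rfl, by positivity⟩).symm
    · rw [arg_eq_arctan_add_pi _ (by positivity)]
      have h3 : ¬ 0 < 4 + t * τ := fun h ↦ h1 (Or.inr (key.2 h))
      refine lt_of_le_of_ne (not_lt.1 h3) fun h4 ↦ h2 ?_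
      rw [eq_div_iff hτ.ne]
      linarith

end

noncomputable section

/-! ### The derivative of the exponential in a Banach algebra -/

section BanachAlgebra

variable {A : Type*} [NormedRing A] [NormedAlgebra ℝ A]

/-- The operator `-ad X`. -/
def negAd (X : A) : A →L[ℝ] A :=
  (ContinuousLinearMap.mul ℝ A).flip X - ContinuousLinearMap.mul ℝ A X

theorem negAd_apply (X Y : A) : negAd X Y = Y * X - X * Y := rfl

theorem smul_pow_apply (T : A →L[ℝ] A) (V : A) (r : ℝ) (m : ℕ) :
    ((r • T) ^ m) V = r ^ m • (T ^ m) V := by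
  induction m with
  | zero => simp
  | succ m ih =>
    rw [pow_succ', pow_succ' T]
    change (r • T) (((r • T) ^ m) V) = r ^ (m + 1) • T ((T ^ m) V)
    rw [ih]
    change r • T (r ^ m • (T ^ m) V) = _
    rw [map_smul, smul_smul, pow_succ']

theorem summable_norm_exp_apply (T : A →L[ℝ] A) (V : A) :
    Summable (fun m : ℕ ↦ (Nat.factorial m : ℝ)⁻¹ * ‖(T ^ m) V‖) := by
  refine Summable.of_nonneg_of_le (fun m ↦ by positivity) (fun m ↦ ?_)
    ((NormedSpace.norm_expSeries_summable' (𝕂 := ℝ) T).mul_right ‖V‖)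
  rw [norm_smul, norm_inv, Real.norm_natCast, mul_assoc]
  gcongr
  exact (T ^ m).le_opNorm V

variable [CompleteSpace A]

theorem exp_neg_mul_exp (X : A) : NormedSpace.exp (-X) * NormedSpace.exp X = 1 := by
  let := NormedAlgebra.restrictScalars ℚ ℝ A
  rw [← NormedSpace.exp_add_of_commute (Commute.refl X).neg_left, neg_add_cancel,
    NormedSpace.exp_zero]

theorem exp_mul_exp_neg (X : A) : NormedSpace.exp X * NormedSpace.exp (-X) = 1 := by
  simpa using exp_neg_mul_exp (-X)

theorem contDiff_normedSpace_exp : ContDiff ℝ ∞ (NormedSpace.exp : A → A) :=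
  contDiff_iff_contDiffAt.2 fun x ↦ (NormedSpace.exp_analytic (𝕂 := ℝ) x).contDiffAt

theorem continuous_normedSpace_exp : Continuous (NormedSpace.exp : A → A) :=
  contDiff_normedSpace_exp.continuous

theorem hasDerivAt_exp_smul_neg (X : A) (r : ℝ) :
    HasDerivAt (fun u : ℝ ↦ NormedSpace.exp (-(u • X))) (-(NormedSpace.exp (-(r • X)) * X)) r := by
  have := hasDerivAt_exp_smul_const (𝕂 := ℝ) (-X) r
  simpa only [smul_neg, mul_neg] using this

/-- The left side w solves w' = Tw with T = −ad X, so e^{−rT} w(r) is constant and equal to its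
value V at r = 0. -/
theorem exp_conj_eq (X V : A) (r : ℝ) :
    NormedSpace.exp (-(r • X)) * V * NormedSpace.exp (r • X) =
      NormedSpace.exp (r • negAd X) V := by
  set T := negAd X
  set w : ℝ → A := fun r ↦ NormedSpace.exp (-(r • X)) * V * NormedSpace.exp (r • X)
  have dw (r : ℝ) : HasDerivAt w (T (w r)) r := by
    have h1 := ((hasDerivAt_exp_smul_neg X r).mul_const V).mul
      (hasDerivAt_exp_smul_const (𝕂 := ℝ) X r)
    refine h1.congr_deriv ?_
    have hc : Commute X (NormedSpace.exp (-(r • X))) :=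
      (((Commute.refl X).smul_right r).neg_right).exp_right
    simp only [T, w, negAd_apply, neg_mul]
    rw [← mul_assoc X, ← mul_assoc X, hc.eq]
    simp only [mul_assoc]
    abel
  have dz (r : ℝ) : HasDerivAt (fun r ↦ NormedSpace.exp (-(r • T)) (w r)) 0 r := by
    refine ((hasDerivAt_exp_smul_neg T r).clm_apply (dw r)).congr_deriv ?_
    simp
  have hconst := is_const_of_deriv_eq_zero (fun r ↦ (dz r).differentiableAt)
    (fun r ↦ (dz r).deriv) r 0
  have h0 : NormedSpace.exp (-(r • T)) (w r) = V := by
    have hT : NormedSpace.exp (-((0 : ℝ) • T)) = 1 := by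
      rw [zero_smul ℝ T, neg_zero, NormedSpace.exp_zero]
    rw [hconst, hT]
    simp [w]
  calc w r = (NormedSpace.exp (r • T) * NormedSpace.exp (-(r • T))) (w r) := by
        rw [exp_mul_exp_neg]; rfl
    _ = NormedSpace.exp (r • T) V := by
        rw [← h0]; rfl

theorem hasSum_exp_apply (T : A →L[ℝ] A) (V : A) :
    HasSum (fun m : ℕ ↦ (Nat.factorial m : ℝ)⁻¹ • (T ^ m) V) (NormedSpace.exp T V) :=
  (NormedSpace.exp_series_hasSum_exp' (𝕂 := ℝ) T).mapL (ContinuousLinearMap.apply ℝ A V)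

/-- `∫₀¹ e^{rT} V dr = ∑ T^m V / (m+1)!`. -/
theorem hasSum_integral_exp_apply (T : A →L[ℝ] A) (V : A) :
    HasSum (fun m : ℕ ↦ (Nat.factorial (m + 1) : ℝ)⁻¹ • (T ^ m) V)
      (∫ r in (0 : ℝ)..1, NormedSpace.exp (r • T) V) := by
  let f : ℕ → C(ℝ, A) := fun m ↦
    ⟨fun r ↦ r ^ m • ((Nat.factorial m : ℝ)⁻¹ • (T ^ m) V), by fun_prop⟩
  have hf : Summable fun m ↦ ‖(f m).restrict
      (⟨uIcc 0 1, isCompact_uIcc⟩ : TopologicalSpace.Compacts ℝ)‖ := by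
    refine Summable.of_nonneg_of_le (fun m ↦ norm_nonneg _) (fun m ↦ ?_)
      (summable_norm_exp_apply T V)
    rw [ContinuousMap.norm_le _ (by positivity)]
    rintro ⟨r, hr⟩
    have hr' : r ∈ Icc (0 : ℝ) 1 := by simpa using hr
    simp only [f, ContinuousMap.restrict_apply, ContinuousMap.coe_mk, norm_smul, norm_pow, norm_inv,
      Real.norm_natCast]
    rw [Real.norm_of_nonneg hr'.1]
    exact mul_le_of_le_one_left (by positivity) (pow_le_one₀ hr'.1 hr'.2)
  have := intervalIntegral.hasSum_intervalIntegral_of_summable_norm hf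
  have e1 : (fun m : ℕ ↦ ∫ r in (0 : ℝ)..1, f m r) =
      fun m ↦ (Nat.factorial (m + 1) : ℝ)⁻¹ • (T ^ m) V := by
    funext m
    simp only [f, ContinuousMap.coe_mk, intervalIntegral.integral_smul_const,
      smul_smul]
    congr 1
    simp [Nat.factorial_succ, mul_comm]
  have e2 : ∫ r in (0 : ℝ)..1, ∑' m, f m r = ∫ r in (0 : ℝ)..1, NormedSpace.exp (r • T) V := by
    refine intervalIntegral.integral_congr fun r _ ↦ ?_
    rw [← (hasSum_exp_apply (r • T) V).tsum_eq]
    refine tsum_congr fun m ↦ ?_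
    rw [smul_pow_apply]
    exact smul_comm _ _ _
  rwa [e1, e2] at this

/-- Duhamel's formula. -/
theorem exp_eq_duhamel (X V : A) (s : ℝ) :
    NormedSpace.exp (X + s • V) = NormedSpace.exp X * (1 + s • ∫ r in (0 : ℝ)..1,
      NormedSpace.exp (-(r • X)) * V * NormedSpace.exp (r • (X + s • V))) := by
  set Y := X + s • V with hY
  -- The derivative is e^{−rX}(Y − X)e^{rY} and Y − X = sV; integration over [0,1] gives the
  -- formula.
  have hd (r : ℝ) : HasDerivAt (fun r : ℝ ↦ NormedSpace.exp (-(r • X)) * NormedSpace.exp (r • Y))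
      (s • (NormedSpace.exp (-(r • X)) * V * NormedSpace.exp (r • Y))) r := by
    refine ((hasDerivAt_exp_smul_neg X r).mul
      (hasDerivAt_exp_smul_const' (𝕂 := ℝ) Y r)).congr_deriv ?_
    have : s • V = Y - X := by rw [hY]; abel
    rw [← smul_mul_assoc, ← mul_smul_comm, this, mul_sub, sub_mul]
    simp only [neg_mul, mul_assoc]
    abel
  have hcont : Continuous fun r : ℝ ↦
      s • (NormedSpace.exp (-(r • X)) * V * NormedSpace.exp (r • Y)) := by
    have h1 := continuous_normedSpace_exp (A := A)
    fun_prop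
  have hint := intervalIntegral.integral_eq_sub_of_hasDerivAt (fun r _ ↦ hd r)
    (hcont.intervalIntegrable 0 1)
  rw [intervalIntegral.integral_smul] at hint
  rw [hint]
  simp only [one_smul, zero_smul, neg_zero, NormedSpace.exp_zero, mul_one, add_sub_cancel]
  rw [← mul_assoc, exp_mul_exp_neg, one_mul]

/-- Duhamel's formula has the form e^X(1 + sφ(s)) with φ continuous, so the derivative at s = 0 is
e^X φ(0). -/
theorem hasDerivAt_exp_add_smul (X V : A) :
    HasDerivAt (fun s : ℝ ↦ NormedSpace.exp (X + s • V))
      (NormedSpace.exp X * ∫ r in (0 : ℝ)..1, NormedSpace.exp (r • negAd X) V) 0 := by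
  set φ : ℝ → A := fun s ↦ ∫ r in (0 : ℝ)..1,
      NormedSpace.exp (-(r • X)) * V * NormedSpace.exp (r • (X + s • V))
  have hφ : Continuous φ := by
    refine intervalIntegral.continuous_parametric_intervalIntegral_of_continuous' ?_ 0 1
    have h1 := continuous_normedSpace_exp (A := A)
    simp only [Function.uncurry_def]
    fun_prop
  have h1 : HasDerivAt (fun s : ℝ ↦ s • φ s) (φ 0) 0 := by
    rw [hasDerivAt_iff_tendsto_slope]
    refine (hφ.tendsto 0).mono_left nhdsWithin_le_nhds |>.congr' ?_
    filter_upwards [self_mem_nhdsWithin] with s hs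
    simp [slope_def_module, smul_smul, inv_mul_cancel₀ hs]
  have h2 := (h1.const_add 1).const_mul (NormedSpace.exp X)
  have hφ0 : φ 0 = ∫ r in (0 : ℝ)..1, NormedSpace.exp (r • negAd X) V := by
    refine intervalIntegral.integral_congr fun r _ ↦ ?_
    simp only [zero_smul, add_zero]
    exact exp_conj_eq X V r
  rw [← hφ0]
  refine h2.congr_of_eventuallyEq (Eventually.of_forall fun s ↦ exp_eq_duhamel X V s)

/-- The series `∑ (-ad X)^m B / (m+1)!`. -/
def dexpSeries (X B : A) : A := ∑' m : ℕ, (Nat.factorial (m + 1) : ℝ)⁻¹ • (negAd X ^ m) B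

/-- The derivative of the exponential along a curve. -/
theorem HasDerivAt.normedSpace_exp {X : ℝ → A} {X' : A} {s : ℝ} (h : HasDerivAt X X' s) :
    HasDerivAt (fun r ↦ NormedSpace.exp (X r))
      (NormedSpace.exp (X s) * dexpSeries (X s) X') s := by
  have hd : DifferentiableAt ℝ (NormedSpace.exp : A → A) (X s) :=
    contDiff_normedSpace_exp.differentiable (by simp) _
  have h1 := hd.hasFDerivAt.comp_hasDerivAt s h
  -- The total derivative in the direction X' is read off from the straight line through X(s).
  have h2 : HasDerivAt (fun r : ℝ ↦ X s + r • X') X' 0 := by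
    simpa using ((hasDerivAt_id (0 : ℝ)).smul_const X').const_add (X s)
  have hd' : HasFDerivAt (NormedSpace.exp : A → A) (fderiv ℝ NormedSpace.exp (X s))
      (X s + (0 : ℝ) • X') := by simpa using hd.hasFDerivAt
  have h3 := hd'.comp_hasDerivAt (0 : ℝ) h2
  have h4 := h3.unique (hasDerivAt_exp_add_smul (X s) X')
  rw [dexpSeries, (hasSum_integral_exp_apply (negAd (X s)) X').tsum_eq, ← h4]
  exact h1

theorem summable_negAd (X V : A) :
    Summable fun m : ℕ ↦ (Nat.factorial (m + 1) : ℝ)⁻¹ • (negAd X ^ m) V :=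
  (hasSum_integral_exp_apply (negAd X) V).summable

/-- The part of `dexpSeries` that involves commutators. -/
def commSeries (X B : A) : A := ∑' m : ℕ, (Nat.factorial (m + 1 + 1) : ℝ)⁻¹ • (negAd X ^ (m + 1)) B

theorem dexpSeries_eq_add (X B : A) : dexpSeries X B = B + commSeries X B := by
  rw [dexpSeries, (summable_negAd X B).tsum_eq_zero_add, commSeries]
  congr 1
  simp

end BanachAlgebra

end

noncomputable section

/-! ### Forms and endomorphisms on the model space -/

/-- Endomorphisms of the model space `V`. -/
abbrev ModelEndo (V : Type*) [NormedAddCommGroup V] [NormedSpace ℝ V] : Type _ :=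
  V →L[ℝ] V

set_option linter.unusedSectionVars false

section Model

variable {V : Type*} [NormedAddCommGroup V] [NormedSpace ℝ V] [FiniteDimensional ℝ V]
  {W : Type*} [NormedAddCommGroup W] [NormedSpace ℝ W]

/-- `g⁻¹ h` on the model space. -/
def sharp (g h : V →L[ℝ] W) : ModelEndo V := (ContinuousLinearMap.inverse g).comp h

variable (V) in
/-- The trace on the model space, as a continuous linear form. -/
def trCLM : ModelEndo V →L[ℝ] ℝ :=
  LinearMap.toContinuousLinearMap
    ((LinearMap.trace ℝ V) ∘ₗ ContinuousLinearMap.coeLM ℝ)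

theorem trCLM_apply (A : ModelEndo V) :
    trCLM V A = LinearMap.trace ℝ V A.toLinearMap := rfl

theorem trCLM_mul_comm (A B : ModelEndo V) : trCLM V (A * B) = trCLM V (B * A) :=
  LinearMap.trace_mul_comm ℝ A.toLinearMap B.toLinearMap

theorem trCLM_one : trCLM V (1 : ModelEndo V) = Module.finrank ℝ V := by
  rw [trCLM_apply]
  change LinearMap.trace ℝ V LinearMap.id = Module.finrank ℝ V
  rw [LinearMap.trace_id]

variable (V) in
/-- The traceless part, as a continuous linear map. -/
def devCLM : ModelEndo V →L[ℝ] ModelEndo V :=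
  ContinuousLinearMap.id ℝ _ - ((Module.finrank ℝ V : ℝ)⁻¹ • trCLM V).smulRight 1

theorem devCLM_apply (A : ModelEndo V) : devCLM V A = A - (trCLM V A / Module.finrank ℝ V) •
    (1 : ModelEndo V) := by
  simp [devCLM, div_eq_inv_mul]

theorem eq_dev_add (A : ModelEndo V) : A = devCLM V A + (trCLM V A / Module.finrank ℝ V) •
    (1 : ModelEndo V) := by
  rw [devCLM_apply, sub_add_cancel]

theorem subsingleton_of_finrank_eq_zero (hn : Module.finrank ℝ V = 0) :
    Subsingleton (ModelEndo V) := by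
  have := Module.finrank_zero_iff.1 hn
  infer_instance

theorem trCLM_dev (A : ModelEndo V) : trCLM V (devCLM V A) = 0 := by
  rw [devCLM_apply, map_sub, map_smul, trCLM_one, smul_eq_mul]
  -- In dimension 0 the quotient by the dimension is 0 by convention; all endomorphisms vanish
  -- there.
  rcases eq_or_ne (Module.finrank ℝ V) 0 with hn | hn
  · have := subsingleton_of_finrank_eq_zero hn
    have : A = 0 := Subsingleton.elim _ _
    simp [this]
  · have : (Module.finrank ℝ V : ℝ) ≠ 0 := by exact_mod_cast hn
    field_simp
    ring

theorem devCLM_one : devCLM V 1 = 0 := by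
  rcases eq_or_ne (Module.finrank ℝ V) 0 with hn | hn
  · have := subsingleton_of_finrank_eq_zero hn
    exact Subsingleton.elim _ _
  · have : (Module.finrank ℝ V : ℝ) ≠ 0 := by exact_mod_cast hn
    rw [devCLM_apply, trCLM_one, div_self this, one_smul, sub_self]

/-- The invariant `n tr(H₀²)`. -/
def devSq (H : ModelEndo V) : ℝ := Module.finrank ℝ V * trCLM V (devCLM V H * devCLM V H)

theorem trCLM_sq (A : ModelEndo V) :
    trCLM V (A * A) = trCLM V (devCLM V A * devCLM V A) + trCLM V A ^ 2 / Module.finrank ℝ V := by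
  rcases eq_or_ne (Module.finrank ℝ V) 0 with hn | hn
  · have := subsingleton_of_finrank_eq_zero hn
    have : A = 0 := Subsingleton.elim _ _
    simp [this]
  have hn' : (Module.finrank ℝ V : ℝ) ≠ 0 := by exact_mod_cast hn
  conv_lhs => rw [eq_dev_add A]
  simp only [mul_add, add_mul, map_add, smul_mul_assoc, mul_smul_comm, one_mul, mul_one, map_smul,
    trCLM_dev, trCLM_one, smul_eq_mul]
  field_simp
  ring

theorem isInvertible_eventually {g : V →L[ℝ] W} (hg : g.IsInvertible) :
    ∀ᶠ g' in 𝓝 g, g'.IsInvertible := by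
  obtain ⟨e, rfl⟩ := hg
  exact ContinuousLinearEquiv.nhds e

theorem comp_sharp {g : V →L[ℝ] W} (hg : g.IsInvertible) (h : V →L[ℝ] W) :
    g.comp (sharp g h) = h := by
  obtain ⟨e, rfl⟩ := hg
  ext v
  simp [sharp]

theorem sharp_comp {g : V →L[ℝ] W} (hg : g.IsInvertible) (A : ModelEndo V) :
    sharp g (g.comp A) = A := by
  obtain ⟨e, rfl⟩ := hg
  ext v
  simp [sharp]

theorem contDiffAt_sharp {g : V →L[ℝ] W} (hg : g.IsInvertible) (h : V →L[ℝ] W) :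
    ContDiffAt ℝ ∞ (fun p : (V →L[ℝ] W) × (V →L[ℝ] W) ↦ sharp p.1 p.2) (g, h) := by
  obtain ⟨e, rfl⟩ := hg
  have h1 : ContDiffAt ℝ ∞ (fun p : (V →L[ℝ] W) × (V →L[ℝ] W) ↦ ContinuousLinearMap.inverse p.1)
      ((e : V →L[ℝ] W), h) :=
    ContDiffAt.comp ((e : V →L[ℝ] W), h) (contDiffAt_map_inverse e) contDiffAt_fst
  exact h1.clm_comp contDiffAt_snd

/-- The identity g(g⁻¹h) = h holds for all forms near an invertible one. Differentiating it
determines the derivative of g⁻¹h without a formula for that of the inverse. -/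
theorem hasFDerivAt_sharp {g : V →L[ℝ] W} (hg : g.IsInvertible) (h : V →L[ℝ] W) :
    ∃ D : (V →L[ℝ] W) × (V →L[ℝ] W) →L[ℝ] ModelEndo V,
      HasFDerivAt (fun p : (V →L[ℝ] W) × (V →L[ℝ] W) ↦ sharp p.1 p.2) D (g, h) ∧
      ∀ g' h', D (g', h') = sharp g (h' - g'.comp (sharp g h)) := by
  have hd := ((contDiffAt_sharp hg h).differentiableAt (by simp)).hasFDerivAt
  refine ⟨_, hd, fun g' h' ↦ ?_⟩
  have h1 := (hasFDerivAt_fst (𝕜 := ℝ) (p := (g, h))).clm_comp hd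
  have h2 : (fun p : (V →L[ℝ] W) × (V →L[ℝ] W) ↦ p.1.comp (sharp p.1 p.2)) =ᶠ[𝓝 (g, h)]
      fun p ↦ p.2 := by
    filter_upwards [continuousAt_fst.eventually (isInvertible_eventually hg)] with p hp
    exact comp_sharp hp _
  have h3 := (h1.congr_of_eventuallyEq h2.symm).unique hasFDerivAt_snd
  have h4 := DFunLike.congr_fun h3 (g', h')
  have h5 : g.comp ((fderiv ℝ (fun p : (V →L[ℝ] W) × (V →L[ℝ] W) ↦ sharp p.1 p.2) (g, h)) (g', h'))
      = h' - g'.comp (sharp g h) := by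
    rw [eq_sub_iff_add_eq]
    simpa using h4
  rw [← h5, sharp_comp hg]

theorem hasDerivWithinAt_sharp {g h : ℝ → (V →L[ℝ] W)} {g' h' : V →L[ℝ] W} {s : ℝ} {S : Set ℝ}
    (hg : HasDerivWithinAt g g' S s) (hh : HasDerivWithinAt h h' S s) (hi : (g s).IsInvertible) :
    HasDerivWithinAt (fun r ↦ sharp (g r) (h r))
      (sharp (g s) (h' - g'.comp (sharp (g s) (h s)))) S s := by
  obtain ⟨D, hD, hD'⟩ := hasFDerivAt_sharp hi (h s)
  rw [← hD']
  have h1 : HasDerivWithinAt (fun r ↦ (g r, h r)) (g', h') S s := hg.prodMk hh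
  exact hD.comp_hasDerivWithinAt s h1

theorem hasDerivAt_sharp {g h : ℝ → (V →L[ℝ] W)} {g' h' : V →L[ℝ] W} {s : ℝ}
    (hg : HasDerivAt g g' s) (hh : HasDerivAt h h' s) (hi : (g s).IsInvertible) :
    HasDerivAt (fun r ↦ sharp (g r) (h r))
      (sharp (g s) (h' - g'.comp (sharp (g s) (h s)))) s := by
  obtain ⟨D, hD, hD'⟩ := hasFDerivAt_sharp hi (h s)
  rw [← hD']
  have h1 : HasDerivAt (fun r ↦ (g r, h r)) (g', h') s := hg.prodMk hh
  exact hD.comp_hasDerivAt s h1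

/-- The Christoffel symbol on the model space. -/
def modelChristoffel (g h k : V →L[ℝ] W) : V →L[ℝ] W :=
  (1 / 2 : ℝ) • h.comp (sharp g k) + (1 / 2 : ℝ) • k.comp (sharp g h)
    + (1 / 4 * trCLM V (sharp g h * sharp g k)) • g
    - (1 / 4 * trCLM V (sharp g h)) • k - (1 / 4 * trCLM V (sharp g k)) • h

theorem modelChristoffel_comm (g h k : V →L[ℝ] W) :
    modelChristoffel g h k = modelChristoffel g k h := by
  unfold modelChristoffel
  rw [trCLM_mul_comm]
  abel

theorem sharp_add (g h k : V →L[ℝ] W) : sharp g (h + k) = sharp g h + sharp g k :=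
  ContinuousLinearMap.comp_add _ _ _

theorem sharp_sub (g h k : V →L[ℝ] W) : sharp g (h - k) = sharp g h - sharp g k :=
  ContinuousLinearMap.comp_sub _ _ _

theorem sharp_smul (g h : V →L[ℝ] W) (c : ℝ) : sharp g (c • h) = c • sharp g h :=
  ContinuousLinearMap.comp_smul _ _ _

theorem sharp_zero (g : V →L[ℝ] W) : sharp g 0 = 0 := ContinuousLinearMap.comp_zero _

theorem sharp_neg (g h : V →L[ℝ] W) : sharp g (-h) = -sharp g h :=
  ContinuousLinearMap.comp_neg _ _

theorem sharp_self {g : V →L[ℝ] W} (hg : g.IsInvertible) : sharp g g = 1 := sharp_comp hg 1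

theorem sharp_comp_mul {g : V →L[ℝ] W} (h : V →L[ℝ] W) (A : ModelEndo V) :
    sharp g (h.comp A) = sharp g h * A := rfl

theorem sharp_modelChristoffel {g : V →L[ℝ] W} (hg : g.IsInvertible) (h k : V →L[ℝ] W) :
    sharp g (modelChristoffel g h k) =
      (1 / 2 : ℝ) • (sharp g h * sharp g k) + (1 / 2 : ℝ) • (sharp g k * sharp g h)
      + (1 / 4 * trCLM V (sharp g h * sharp g k)) • (1 : ModelEndo V)
      - (1 / 4 * trCLM V (sharp g h)) • sharp g k - (1 / 4 * trCLM V (sharp g k)) • sharp g h := by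
  unfold modelChristoffel
  simp only [sharp_add, sharp_sub, sharp_smul, sharp_self hg, sharp_comp_mul]

/-! ### The closed formula -/

/-- The endomorphism `e^{a(t) Id + b(t) H₀}`. -/
def flowEndo (H : ModelEndo V) (t : ℝ) : ModelEndo V :=
  Real.exp (2 / Module.finrank ℝ V * Real.log (volRatio (trCLM V H) (devSq H) t)) •
    NormedSpace.exp (angleFun (trCLM V H) (devSq H) t • devCLM V H)

/-- The inverse of `flowEndo`. -/
def flowEndoInv (H : ModelEndo V) (t : ℝ) : ModelEndo V :=
  Real.exp (-(2 / Module.finrank ℝ V * Real.log (volRatio (trCLM V H) (devSq H) t))) •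
    NormedSpace.exp (-(angleFun (trCLM V H) (devSq H) t • devCLM V H))

/-- The velocity `P(t) = g(t)⁻¹ g'(t)` of a geodesic with initial velocity `H`. -/
def velocity (H : ModelEndo V) (t : ℝ) : ModelEndo V :=
  (2 / Module.finrank ℝ V * ((trCLM V H / 2 + t * (trCLM V H ^ 2 + devSq H) / 8) /
    volRatio (trCLM V H) (devSq H) t)) • (1 : ModelEndo V)
    + (volRatio (trCLM V H) (devSq H) t)⁻¹ • devCLM V H

theorem flowEndo_mul_inv (H : ModelEndo V) (t : ℝ) : flowEndo H t * flowEndoInv H t = 1 := by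
  unfold flowEndo flowEndoInv
  rw [smul_mul_smul_comm, exp_mul_exp_neg, ← Real.exp_add, add_neg_cancel, Real.exp_zero, one_smul]

theorem flowEndoInv_mul (H : ModelEndo V) (t : ℝ) : flowEndoInv H t * flowEndo H t = 1 := by
  unfold flowEndo flowEndoInv
  rw [smul_mul_smul_comm, exp_neg_mul_exp, ← Real.exp_add, neg_add_cancel, Real.exp_zero, one_smul]

theorem flowEndo_zero (H : ModelEndo V) : flowEndo H 0 = 1 := by
  simp [flowEndo, volRatio_zero, angleFun_zero_right]

theorem flowEndoInv_zero (H : ModelEndo V) : flowEndoInv H 0 = 1 := by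
  simp [flowEndoInv, volRatio_zero, angleFun_zero_right]

theorem flowEndo_of_zero (t : ℝ) : flowEndo (0 : ModelEndo V) t = 1 := by
  simp [flowEndo, volRatio, devSq]

theorem hasDerivAt_logVol {τ y t : ℝ} (h : AngleDomain τ y t) (n : ℕ) :
    HasDerivAt (fun t ↦ 2 / n * Real.log (volRatio τ y t))
      (2 / n * ((τ / 2 + t * (τ ^ 2 + y) / 8) / volRatio τ y t)) t :=
  ((hasDerivAt_volRatio τ y t).log (volRatio_pos h).ne').const_mul _

theorem hasDerivAt_flowEndo {H : ModelEndo V} {t : ℝ}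
    (h : AngleDomain (trCLM V H) (devSq H) t) :
    HasDerivAt (flowEndo H) (flowEndo H t * velocity H t) t := by
  have h1 := (hasDerivAt_logVol h (Module.finrank ℝ V)).exp
  have h2 := (hasDerivAt_exp_smul_const (𝕂 := ℝ) (devCLM V H)
    (angleFun (trCLM V H) (devSq H) t)).scomp t (hasDerivAt_angleFun h)
  refine (h1.smul h2).congr_deriv ?_
  simp only [flowEndo, velocity, mul_add, mul_smul_comm, mul_one, smul_mul_assoc, smul_smul,
    Function.comp]
  module

theorem hasDerivAt_flowEndoInv {H : ModelEndo V} {t : ℝ}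
    (h : AngleDomain (trCLM V H) (devSq H) t) :
    HasDerivAt (flowEndoInv H) (-(velocity H t * flowEndoInv H t)) t := by
  have h1 := (hasDerivAt_logVol h (Module.finrank ℝ V)).neg.exp
  have h2 := (hasDerivAt_exp_smul_const' (𝕂 := ℝ) (-devCLM V H)
    (angleFun (trCLM V H) (devSq H) t)).scomp t (hasDerivAt_angleFun h)
  simp only [smul_neg] at h2
  refine (h1.smul h2).congr_deriv ?_
  simp only [flowEndoInv, velocity, add_mul, mul_smul_comm, one_mul, smul_mul_assoc, smul_smul,
    Function.comp, neg_mul, smul_neg]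
  module

theorem trCLM_velocity (hn : Module.finrank ℝ V ≠ 0) (H : ModelEndo V) (t : ℝ) :
    trCLM V (velocity H t) = 2 * ((trCLM V H / 2 + t * (trCLM V H ^ 2 + devSq H) / 8) /
      volRatio (trCLM V H) (devSq H) t) := by
  have hn' : (Module.finrank ℝ V : ℝ) ≠ 0 := by exact_mod_cast hn
  simp only [velocity, map_add, map_smul, trCLM_one, trCLM_dev, smul_eq_mul]
  field_simp
  ring

theorem devCLM_velocity (H : ModelEndo V) (t : ℝ) :
    devCLM V (velocity H t) = (volRatio (trCLM V H) (devSq H) t)⁻¹ • devCLM V H := by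
  have : devCLM V (devCLM V H) = devCLM V H := by
    rw [devCLM_apply (devCLM V H), trCLM_dev]; simp
  simp [velocity, map_add, map_smul, devCLM_one, this]

theorem velocity_zero (H : ModelEndo V) : velocity H 0 = H := by
  conv_rhs => rw [eq_dev_add H]
  rcases eq_or_ne (Module.finrank ℝ V) 0 with hn | hn
  · have := subsingleton_of_finrank_eq_zero hn
    exact Subsingleton.elim _ _
  simp only [velocity, volRatio_zero]
  have hn' : (Module.finrank ℝ V : ℝ) ≠ 0 := by exact_mod_cast hn
  rw [add_comm]
  congr 1
  · simp
  · congr 1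
    field_simp
    ring

/-- This is the geodesic equation in terms of P. Since tr P = 2v'/v and P₀ = H₀/v, it reduces to
2v''v = v'² + y/4, an identity for the quadratic polynomial v. -/
theorem hasDerivAt_velocity {H : ModelEndo V} {t : ℝ}
    (h : AngleDomain (trCLM V H) (devSq H) t) :
    HasDerivAt (velocity H) ((1 / 4 * trCLM V (velocity H t * velocity H t)) • (1 : ModelEndo V)
      - (1 / 2 * trCLM V (velocity H t)) • velocity H t) t := by
  rcases eq_or_ne (Module.finrank ℝ V) 0 with hn | hn
  · have := subsingleton_of_finrank_eq_zero hn
    have : velocity H = fun _ ↦ 0 := by funext t; exact Subsingleton.elim _ _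
    rw [this]
    exact (hasDerivAt_const t _).congr_deriv (Subsingleton.elim _ _)
  have hn' : (Module.finrank ℝ V : ℝ) ≠ 0 := by exact_mod_cast hn
  have hv := (volRatio_pos h).ne'
  have h1 := hasDerivAt_volRatio (trCLM V H) (devSq H) t
  have h2 : HasDerivAt (fun t ↦ trCLM V H / 2 + t * (trCLM V H ^ 2 + devSq H) / 8)
      ((trCLM V H ^ 2 + devSq H) / 8) t := by
    simpa using (((hasDerivAt_id t).mul_const (trCLM V H ^ 2 + devSq H)).div_const 8).const_add
      (trCLM V H / 2)
  have h3 := (((h2.div h1 hv).const_mul (2 / (Module.finrank ℝ V : ℝ))).smul_const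
      (1 : ModelEndo V)).add
    ((h1.inv hv).smul_const (devCLM V H))
  refine h3.congr_deriv ?_
  rw [trCLM_sq, devCLM_velocity, trCLM_velocity hn]
  simp only [smul_mul_smul_comm, map_smul, smul_eq_mul]
  have hy : trCLM V (devCLM V H * devCLM V H) = devSq H / Module.finrank ℝ V := by
    unfold devSq; field_simp
  rw [hy]
  unfold velocity
  have key : 2 * ((trCLM V H ^ 2 + devSq H) / 8) * volRatio (trCLM V H) (devSq H) t =
      (trCLM V H / 2 + t * (trCLM V H ^ 2 + devSq H) / 8) ^ 2 + devSq H / 4 := by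
    unfold volRatio; ring
  generalize (trCLM V H ^ 2 + devSq H) / 8 = v2 at *
  generalize trCLM V H / 2 + t * (trCLM V H ^ 2 + devSq H) / 8 = v1 at *
  generalize volRatio (trCLM V H) (devSq H) t = v at *
  rw [smul_add, smul_smul, smul_smul]
  match_scalars
  · field_simp
    linear_combination (4 : ℝ) * key
  · field_simp

/-- The geodesic `g e^{a(t) Id + b(t) H₀}` with `H = g⁻¹ h`. -/
def closedForm (t : ℝ) (g h : V →L[ℝ] W) : V →L[ℝ] W := g.comp (flowEndo (sharp g h) t)

theorem closedForm_zero (g h : V →L[ℝ] W) : closedForm 0 g h = g := by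
  rw [closedForm, flowEndo_zero]; rfl

theorem closedForm_of_zero (t : ℝ) (g : V →L[ℝ] W) : closedForm t g 0 = g := by
  rw [closedForm, sharp_zero, flowEndo_of_zero]; rfl

theorem hasDerivAt_comp_const {X : ℝ → ModelEndo V} {X' : ModelEndo V} {t : ℝ}
    (h : HasDerivAt X X' t) (g : V →L[ℝ] W) :
    HasDerivAt (fun t ↦ g.comp (X t)) (g.comp X') t := by
  simpa using (hasDerivAt_const t g).clm_comp h

theorem hasDerivAt_closedForm {g h : V →L[ℝ] W} {t : ℝ}
    (hd : AngleDomain (trCLM V (sharp g h)) (devSq (sharp g h)) t) :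
    HasDerivAt (fun t ↦ closedForm t g h)
      ((closedForm t g h).comp (velocity (sharp g h) t)) t :=
  hasDerivAt_comp_const (hasDerivAt_flowEndo hd) g

theorem isInvertible_closedForm {g : V →L[ℝ] W} (hg : g.IsInvertible) (h : V →L[ℝ] W) (t : ℝ) :
    (closedForm t g h).IsInvertible := by
  exact hg.comp (ContinuousLinearMap.IsInvertible.of_inverse (flowEndo_mul_inv _ _)
    (flowEndoInv_mul _ _))

theorem hasDerivAt_closedForm_velocity {g h : V →L[ℝ] W} {t : ℝ} (hg : g.IsInvertible)
    (hd : AngleDomain (trCLM V (sharp g h)) (devSq (sharp g h)) t) :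
    HasDerivAt (fun t ↦ (closedForm t g h).comp (velocity (sharp g h) t))
      (modelChristoffel (closedForm t g h) ((closedForm t g h).comp (velocity (sharp g h) t))
        ((closedForm t g h).comp (velocity (sharp g h) t))) t := by
  have hi := isInvertible_closedForm hg h t
  refine ((hasDerivAt_closedForm hd).clm_comp (hasDerivAt_velocity hd)).congr_deriv ?_
  simp only [modelChristoffel, sharp_comp hi]
  generalize closedForm t g h = γ
  generalize velocity (sharp g h) t = P
  rw [ContinuousLinearMap.comp_sub, ContinuousLinearMap.comp_smul, ContinuousLinearMap.comp_smul]
  change _ + ((1 / 4 * trCLM V (P * P)) • γ - _) = _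
  module

theorem isInvertible_of_pos {g : V →L[ℝ] V →L[ℝ] ℝ} (hg : ∀ v, v ≠ 0 → 0 < g v v) :
    g.IsInvertible := by
  have hinj : Function.Injective g.toLinearMap := by
    rw [injective_iff_map_eq_zero]
    intro v hv
    by_contra h
    have := hg v h
    have h2 : g v = 0 := hv
    simp [h2] at this
  have hdim : Module.finrank ℝ V =
      Module.finrank ℝ (V →L[ℝ] ℝ) := by
    rw [← (LinearMap.toContinuousLinearMap (𝕜 := ℝ) (E := V)
      (F' := ℝ)).finrank_eq]
    exact (Subspace.dual_finrank_eq).symm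
  refine ⟨(LinearEquiv.ofInjectiveOfFinrankEq g.toLinearMap hinj hdim).toContinuousLinearEquiv, ?_⟩
  ext v w
  rfl

end Model

end

/-! ### Uniqueness for the geodesic equation in a fibre, by conserved quantities -/

noncomputable section

section Uniqueness

variable {V : Type*} [NormedAddCommGroup V] [NormedSpace ℝ V] [FiniteDimensional ℝ V]
  {W : Type*} [NormedAddCommGroup W] [NormedSpace ℝ W]

/-- Turns each conservation law below into an equation; the derivatives are one-sided at the end
points and a = 0 is allowed. -/
theorem eq_of_hasDerivWithinAt_zero {F : Type*} [NormedAddCommGroup F] [NormedSpace ℝ F] {a : ℝ}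
    {f : ℝ → F} (hf : ∀ t ∈ Icc 0 a, HasDerivWithinAt f 0 (Icc 0 a) t) {t : ℝ} (ht : t ∈ Icc 0 a) :
    f t = f 0 := by
  rcases eq_or_lt_of_le (ht.1.trans ht.2) with h | h
  · have : t = 0 := le_antisymm (ht.2.trans_eq h.symm) ht.1
    rw [this]
  refine constant_of_derivWithin_zero (fun t ht ↦ (hf t ht).differentiableWithinAt)
    (fun t ht ↦ ?_) t ht
  have ht' := Ico_subset_Icc_self ht
  exact (hf t ht').derivWithin (uniqueDiffOn_Icc h t ht')

/-- A positive solution of `D' = p D / 2`. -/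
theorem exists_density {a : ℝ} (ha : 0 ≤ a) {p : ℝ → ℝ} (hp : ContinuousOn p (Icc 0 a)) :
    ∃ D : ℝ → ℝ, D 0 = 1 ∧ (∀ t, 0 < D t) ∧
      ∀ t ∈ Icc 0 a, HasDerivWithinAt D (D t * (p t / 2)) (Icc 0 a) t := by
  -- Constant extension of p beyond the interval makes the integrand continuous on the line.
  have hc : Continuous (IccExtend ha ((Icc 0 a).domRestrict p)) :=
    (continuousOn_iff_continuous_domRestrict.1 hp).Icc_extend'
  refine ⟨fun t ↦ Real.exp (∫ r in (0 : ℝ)..t, IccExtend ha ((Icc 0 a).domRestrict p) r / 2),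
    by simp,
    fun t ↦ Real.exp_pos _, fun t ht ↦ ?_⟩
  have h1 := ((hc.div_const 2).integral_hasStrictDerivAt 0 t).hasDerivAt.exp
  have h2 : IccExtend ha ((Icc 0 a).domRestrict p) t = p t := by rw [IccExtend_of_mem _ _ ht]; rfl
  rw [h2] at h1
  exact h1.hasDerivWithinAt

/-- The term g'g⁻¹g' of Γ(g',g') cancels against the derivative of g⁻¹, which leaves an equation for
P alone. -/
theorem hasDerivWithinAt_velocity {γ γ1 : ℝ → (V →L[ℝ] W)} {S : Set ℝ} {t : ℝ}
    (hγ : HasDerivWithinAt γ (γ1 t) S t)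
    (hγ1 : HasDerivWithinAt γ1 (modelChristoffel (γ t) (γ1 t) (γ1 t)) S t)
    (hi : (γ t).IsInvertible) :
    HasDerivWithinAt (fun t ↦ sharp (γ t) (γ1 t))
      ((1 / 4 * trCLM V (sharp (γ t) (γ1 t) * sharp (γ t) (γ1 t))) • (1 : ModelEndo V)
        - (1 / 2 * trCLM V (sharp (γ t) (γ1 t))) • sharp (γ t) (γ1 t)) S t := by
  refine (hasDerivWithinAt_sharp hγ hγ1 hi).congr_deriv ?_
  rw [sharp_sub, sharp_modelChristoffel hi, sharp_comp_mul]
  module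

/-- The volume density and the velocity along a solution of the geodesic equation. -/
theorem volRatio_pos_and_velocity_eq (hn : Module.finrank ℝ V ≠ 0) {a : ℝ} (ha : 0 ≤ a)
    {P : ℝ → ModelEndo V}
    (hP : ∀ t ∈ Icc 0 a, HasDerivWithinAt P ((1 / 4 * trCLM V (P t * P t)) • (1 : ModelEndo V)
        - (1 / 2 * trCLM V (P t)) • P t) (Icc 0 a) t) {t : ℝ} (ht : t ∈ Icc 0 a) :
    0 < volRatio (trCLM V (P 0)) (devSq (P 0)) t ∧ P t = velocity (P 0) t := by
  have hn' : (Module.finrank ℝ V : ℝ) ≠ 0 := by exact_mod_cast hn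
  have hp (t) (ht : t ∈ Icc 0 a) := (trCLM V).hasFDerivAt.comp_hasDerivWithinAt t (hP t ht)
  have hP0 (t) (ht : t ∈ Icc 0 a) := (devCLM V).hasFDerivAt.comp_hasDerivWithinAt t (hP t ht)
  simp only [map_sub, map_smul, trCLM_one, devCLM_one, smul_zero, zero_sub, smul_eq_mul] at hp hP0
  obtain ⟨D, hD0, hDpos, hD⟩ := exists_density ha
    (p := fun t ↦ trCLM V (P t)) (fun t ht ↦ (hp t ht).continuousWithinAt)
  set τ := trCLM V (P 0) with hτ
  set y := devSq (P 0) with hy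
  -- Conserved because P₀' = −½ tr(P) P₀ and D' = ½ tr(P) D.
  have hR (t) (ht : t ∈ Icc 0 a) : D t • devCLM V (P t) = devCLM V (P 0) := by
    have := eq_of_hasDerivWithinAt_zero (f := fun t ↦ D t • devCLM V (P t)) (fun t ht ↦ ?_) ht
    · rw [this, hD0, one_smul]
    · refine ((hD t ht).smul (hP0 t ht)).congr_deriv ?_
      simp only [Function.comp]
      module
  have hdev (t) (ht : t ∈ Icc 0 a) : devCLM V (P t) = (D t)⁻¹ • devCLM V (P 0) := by
    rw [← hR t ht, smul_smul, inv_mul_cancel₀ (hDpos t).ne', one_smul]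
  have hq (t) (ht : t ∈ Icc 0 a) : trCLM V (P t * P t) =
      (y / D t ^ 2 + trCLM V (P t) ^ 2) / Module.finrank ℝ V := by
    have := (hDpos t).ne'
    rw [trCLM_sq, hdev t ht, smul_mul_smul_comm, map_smul, smul_eq_mul, hy, devSq]
    field_simp
  -- The function differentiated here is D', so the right side is D''.
  have hE (t) (ht : t ∈ Icc 0 a) : HasDerivWithinAt (fun t ↦ D t * (trCLM V (P t) / 2))
      ((y + 4 * (D t * (trCLM V (P t) / 2)) ^ 2) / (8 * D t)) (Icc 0 a) t := by
    refine ((hD t ht).mul ((hp t ht).div_const 2)).congr_deriv ?_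
    have := (hDpos t).ne'
    rw [hq t ht]
    simp only [Function.comp]
    field_simp
    ring
  -- D'' is conserved too. Thus D is the quadratic polynomial with D(0) = 1, D'(0) = τ/2 and D'' =
  -- (τ² + y)/8, which is v; positivity of v is inherited from D.
  have hF (t) (ht : t ∈ Icc 0 a) :
      (y + 4 * (D t * (trCLM V (P t) / 2)) ^ 2) / (8 * D t) = (y + τ ^ 2) / 8 := by
    have := eq_of_hasDerivWithinAt_zero
      (f := fun t ↦ (y + 4 * (D t * (trCLM V (P t) / 2)) ^ 2) / (8 * D t)) (fun t ht ↦ ?_) ht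
    · rw [this, hD0, ← hτ]; ring
    · have := (hDpos t).ne'
      refine ((((hE t ht).pow 2).const_mul 4 |>.const_add y).div ((hD t ht).const_mul 8)
        (by positivity)).congr_deriv ?_
      simp only [Pi.pow_apply]
      field_simp
      ring
  have hE' (t) (ht : t ∈ Icc 0 a) :
      D t * (trCLM V (P t) / 2) = τ / 2 + t * (τ ^ 2 + y) / 8 := by
    have := eq_of_hasDerivWithinAt_zero
      (f := fun t ↦ D t * (trCLM V (P t) / 2) - t * ((y + τ ^ 2) / 8)) (fun t ht ↦ ?_) ht
    · simp only [hD0, ← hτ] at this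
      linear_combination this
    · refine ((hE t ht).sub ((hasDerivWithinAt_id t _).mul_const ((y + τ ^ 2) / 8))).congr_deriv ?_
      rw [hF t ht]
      ring
  have hDv (t) (ht : t ∈ Icc 0 a) : D t = volRatio τ y t := by
    have := eq_of_hasDerivWithinAt_zero (f := fun t ↦ D t - volRatio τ y t) (fun t ht ↦ ?_) ht
    · simp only [hD0, volRatio_zero] at this
      linarith
    · refine ((hD t ht).sub (hasDerivAt_volRatio τ y t).hasDerivWithinAt).congr_deriv ?_
      rw [hE' t ht]
      ring
  have hv : 0 < volRatio τ y t := hDv t ht ▸ hDpos t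
  refine ⟨hv, ?_⟩
  rw [eq_dev_add (P t), hdev t ht, add_comm, velocity, ← hE' t ht, ← hτ, ← hy, ← hDv t ht]
  congr 2
  have := (hDpos t).ne'
  field_simp

/-- If y = 0 and 4 + tτ ≤ 0, then v(r) = (1 + rτ/4)² vanishes at r = −4/τ, which lies in [0,t]. -/
theorem angleDomain_of_volRatio_pos {τ y t : ℝ} (hy : 0 ≤ y) (ht : 0 ≤ t)
    (h : ∀ r ∈ Icc 0 t, 0 < volRatio τ y r) : AngleDomain τ y t := by
  rcases hy.lt_or_eq with hy | rfl
  · exact Or.inl hy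
  refine Or.inr ⟨rfl, ?_⟩
  by_contra hc
  push Not at hc
  have hτ : τ < 0 := by
    by_contra h0
    push Not at h0
    have : 0 ≤ t * τ := by positivity
    linarith
  have hm : -4 / τ ∈ Icc 0 t := by
    refine ⟨div_nonneg_of_nonpos (by norm_num) hτ.le, ?_⟩
    rw [div_le_iff_of_neg hτ]
    linarith
  have := h _ hm
  have h16 := sixteen_mul_volRatio τ 0 (-4 / τ)
  rw [div_mul_cancel₀ _ hτ.ne] at h16
  norm_num at h16
  linarith

/-- Every solution of the geodesic equation is given by the closed formula. -/
theorem geodesic_eq_closedForm {a : ℝ} (ha : 0 ≤ a) {γ γ1 : ℝ → (V →L[ℝ] W)}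
    (hγ : ∀ t ∈ Icc 0 a, HasDerivWithinAt γ (γ1 t) (Icc 0 a) t)
    (hγ1 : ∀ t ∈ Icc 0 a,
      HasDerivWithinAt γ1 (modelChristoffel (γ t) (γ1 t) (γ1 t)) (Icc 0 a) t)
    (hi : ∀ t ∈ Icc 0 a, (γ t).IsInvertible) (hy : 0 ≤ devSq (sharp (γ 0) (γ1 0)))
    {t : ℝ} (ht : t ∈ Icc 0 a) :
    AngleDomain (trCLM V (sharp (γ 0) (γ1 0))) (devSq (sharp (γ 0) (γ1 0))) t ∧
      γ t = closedForm t (γ 0) (γ1 0) ∧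
      γ1 t = (γ t).comp (velocity (sharp (γ 0) (γ1 0)) t) := by
  set H := sharp (γ 0) (γ1 0) with hH
  rcases eq_or_ne (Module.finrank ℝ V) 0 with hn | hn
  · have := Module.finrank_zero_iff.1 hn
    have hs : Subsingleton (V →L[ℝ] W) := inferInstance
    refine ⟨Or.inr ⟨?_, ?_⟩, Subsingleton.elim _ _, Subsingleton.elim _ _⟩
    · simp [devSq, hn]
    · have : H = 0 := Subsingleton.elim _ _
      simp [this]
  have key (t) (ht : t ∈ Icc 0 a) := volRatio_pos_and_velocity_eq hn ha
    (P := fun t ↦ sharp (γ t) (γ1 t))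
    (fun t ht ↦ hasDerivWithinAt_velocity (hγ t ht) (hγ1 t ht) (hi t ht)) ht
  have hdom (t) (ht : t ∈ Icc 0 a) : AngleDomain (trCLM V H) (devSq H) t :=
    angleDomain_of_volRatio_pos hy ht.1 fun r hr ↦ (key r ⟨hr.1, hr.2.trans ht.2⟩).1
  have hvel (t) (ht : t ∈ Icc 0 a) : γ1 t = (γ t).comp (velocity H t) := by
    rw [← (key t ht).2, comp_sharp (hi t ht)]
  refine ⟨hdom t ht, ?_, hvel t ht⟩
  -- With F the flow endomorphism, γF⁻¹ has derivative γPF⁻¹ − γPF⁻¹ = 0.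
  have hconst := eq_of_hasDerivWithinAt_zero (f := fun t ↦ (γ t).comp (flowEndoInv H t))
    (fun t ht ↦ ?_) ht
  · simp only [flowEndoInv_zero] at hconst
    calc γ t = (γ t).comp (flowEndoInv H t * flowEndo H t) := by rw [flowEndoInv_mul]; rfl
      _ = ((γ t).comp (flowEndoInv H t)).comp (flowEndo H t) := rfl
      _ = closedForm t (γ 0) (γ1 0) := by rw [hconst]; rfl
  · refine ((hγ t ht).clm_comp (hasDerivAt_flowEndoInv (hdom t ht)).hasDerivWithinAt).congr_deriv ?_
    rw [hvel t ht, ContinuousLinearMap.comp_neg]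
    exact add_neg_cancel _

end Uniqueness

end

noncomputable section

set_option linter.unusedSectionVars false

/-! ### Smooth dependence of the closed formula on time and initial data -/

section Smoothness

variable {V : Type*} [NormedAddCommGroup V] [NormedSpace ℝ V] [FiniteDimensional ℝ V]
  {W : Type*} [NormedAddCommGroup W] [NormedSpace ℝ W]

theorem contDiff_devSq : ContDiff ℝ ∞ (devSq : ModelEndo V → ℝ) := by
  have h1 : ContDiff ℝ ∞ (fun H : ModelEndo V ↦ devCLM V H * devCLM V H) :=
    (devCLM V).contDiff.mul (devCLM V).contDiff
  exact contDiff_const.mul ((trCLM V).contDiff.comp h1)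

theorem contDiffAt_flowEndo {H : ModelEndo V} {t : ℝ} (h : AngleDomain (trCLM V H) (devSq H) t) :
    ContDiffAt ℝ ∞ (fun p : ℝ × ModelEndo V ↦ flowEndo p.2 p.1) (t, H) := by
  have h1 : ContDiffAt ℝ ∞ (fun p : ℝ × ModelEndo V ↦ (trCLM V p.2, devSq p.2, p.1)) (t, H) :=
    ((trCLM V).contDiff.comp contDiff_snd).contDiffAt.prodMk
      ((contDiff_devSq.comp contDiff_snd).contDiffAt.prodMk contDiffAt_fst)
  have h2 : ContDiffAt ℝ ∞ (fun p : ℝ × ModelEndo V ↦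
      angleFun (trCLM V p.2) (devSq p.2) p.1) (t, H) :=
    ContDiffAt.comp (t, H) (g := fun p : ℝ × ℝ × ℝ ↦ angleFun p.1 p.2.1 p.2.2)
      (contDiffAt_angleFun h) h1
  have h3 : ContDiffAt ℝ ∞ (fun p : ℝ × ModelEndo V ↦
      volRatio (trCLM V p.2) (devSq p.2) p.1) (t, H) :=
    contDiff_volRatio.contDiffAt.comp (t, H) h1
  have h4 := (contDiffAt_const (c := (2 : ℝ) / Module.finrank ℝ V)).mul
    (h3.log (volRatio_pos h).ne')
  have h5 : ContDiffAt ℝ ∞ (fun p : ℝ × ModelEndo V ↦ devCLM V p.2) (t, H) :=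
    ((devCLM V).contDiff.comp contDiff_snd).contDiffAt
  exact h4.exp.smul (contDiff_normedSpace_exp.contDiffAt.comp (t, H) (h2.smul h5))

theorem contDiffAt_closedForm {t : ℝ} {g h : V →L[ℝ] W} (hg : g.IsInvertible)
    (hd : AngleDomain (trCLM V (sharp g h)) (devSq (sharp g h)) t) :
    ContDiffAt ℝ ∞ (fun p : ℝ × (V →L[ℝ] W) × (V →L[ℝ] W) ↦ closedForm p.1 p.2.1 p.2.2)
      (t, g, h) := by
  have e1 : ContDiffAt ℝ ∞ (fun p : ℝ × (V →L[ℝ] W) × (V →L[ℝ] W) ↦ p.1) (t, g, h) :=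
    contDiffAt_fst
  have e2 : ContDiffAt ℝ ∞ (fun p : ℝ × (V →L[ℝ] W) × (V →L[ℝ] W) ↦ p.2) (t, g, h) :=
    contDiffAt_snd
  have e3 : ContDiffAt ℝ ∞ (fun p : ℝ × (V →L[ℝ] W) × (V →L[ℝ] W) ↦ p.2.1) (t, g, h) := e2.fst
  have h1 : ContDiffAt ℝ ∞ (fun p : ℝ × (V →L[ℝ] W) × (V →L[ℝ] W) ↦ sharp p.2.1 p.2.2) (t, g, h) :=
    ContDiffAt.comp (t, g, h) (g := fun p : (V →L[ℝ] W) × (V →L[ℝ] W) ↦ sharp p.1 p.2)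
      (contDiffAt_sharp hg h) e2
  have h2 : ContDiffAt ℝ ∞ (fun p : ℝ × (V →L[ℝ] W) × (V →L[ℝ] W) ↦
      flowEndo (sharp p.2.1 p.2.2) p.1) (t, g, h) :=
    ContDiffAt.comp (t, g, h) (g := fun p : ℝ × ModelEndo V ↦ flowEndo p.2 p.1)
      (f := fun p : ℝ × (V →L[ℝ] W) × (V →L[ℝ] W) ↦ (p.1, sharp p.2.1 p.2.2))
      (contDiffAt_flowEndo hd) (e1.prodMk h1)
  exact e3.clm_comp h2

theorem contDiffAt_modelChristoffel {g : V →L[ℝ] W} (hg : g.IsInvertible) (h k : V →L[ℝ] W) :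
    ContDiffAt ℝ ∞ (fun p : (V →L[ℝ] W) × (V →L[ℝ] W) × (V →L[ℝ] W) ↦
      modelChristoffel p.1 p.2.1 p.2.2) (g, h, k) := by
  have e1 : ContDiffAt ℝ ∞ (fun p : (V →L[ℝ] W) × (V →L[ℝ] W) × (V →L[ℝ] W) ↦ p.1) (g, h, k) :=
    contDiffAt_fst
  have e2 : ContDiffAt ℝ ∞ (fun p : (V →L[ℝ] W) × (V →L[ℝ] W) × (V →L[ℝ] W) ↦ p.2.1) (g, h, k) :=
    (contDiff_fst.comp contDiff_snd).contDiffAt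
  have e3 : ContDiffAt ℝ ∞ (fun p : (V →L[ℝ] W) × (V →L[ℝ] W) × (V →L[ℝ] W) ↦ p.2.2) (g, h, k) :=
    (contDiff_snd.comp contDiff_snd).contDiffAt
  have h1 : ContDiffAt ℝ ∞ (fun p : (V →L[ℝ] W) × (V →L[ℝ] W) × (V →L[ℝ] W) ↦ sharp p.1 p.2.1)
      (g, h, k) :=
    ContDiffAt.comp (g, h, k) (g := fun p : (V →L[ℝ] W) × (V →L[ℝ] W) ↦ sharp p.1 p.2)
      (contDiffAt_sharp hg h) (e1.prodMk e2)
  have h2 : ContDiffAt ℝ ∞ (fun p : (V →L[ℝ] W) × (V →L[ℝ] W) × (V →L[ℝ] W) ↦ sharp p.1 p.2.2)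
      (g, h, k) :=
    ContDiffAt.comp (g, h, k) (g := fun p : (V →L[ℝ] W) × (V →L[ℝ] W) ↦ sharp p.1 p.2)
      (contDiffAt_sharp hg k) (e1.prodMk e3)
  have t1 := (trCLM V).contDiff.contDiffAt.comp _ h1
  have t2 := (trCLM V).contDiff.contDiffAt.comp _ h2
  have t12 := (trCLM V).contDiff.contDiffAt.comp _ (h1.mul h2)
  exact (((((e2.clm_comp h2).const_smul (1 / 2 : ℝ)).add ((e3.clm_comp h1).const_smul _)).add
    ((contDiffAt_const.mul t12).smul e1)).sub ((contDiffAt_const.mul t1).smul e3)).sub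
    ((contDiffAt_const.mul t2).smul e2)

end Smoothness

/-! ### Naturality under changes of frame -/

section Naturality

variable {V : Type*} [NormedAddCommGroup V] [NormedSpace ℝ V] [FiniteDimensional ℝ V]
  {W : Type*} [NormedAddCommGroup W] [NormedSpace ℝ W]

theorem trCLM_conj (u : (ModelEndo V)ˣ) (A : ModelEndo V) :
    trCLM V (↑u⁻¹ * A * ↑u) = trCLM V A := by
  rw [trCLM_mul_comm, ← mul_assoc, Units.mul_inv, one_mul]

theorem devCLM_conj (u : (ModelEndo V)ˣ) (A : ModelEndo V) :
    devCLM V (↑u⁻¹ * A * ↑u) = ↑u⁻¹ * devCLM V A * ↑u := by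
  rw [devCLM_apply, devCLM_apply, trCLM_conj, mul_sub, sub_mul, mul_smul_comm, smul_mul_assoc,
    mul_one, Units.inv_mul]

theorem conj_mul_conj (u : (ModelEndo V)ˣ) (A B : ModelEndo V) :
    (↑u⁻¹ * A * ↑u) * (↑u⁻¹ * B * ↑u) = ↑u⁻¹ * (A * B) * (u : ModelEndo V) := by
  simp only [mul_assoc, Units.mul_inv_cancel_left]

theorem devSq_conj (u : (ModelEndo V)ˣ) (A : ModelEndo V) :
    devSq (↑u⁻¹ * A * ↑u : ModelEndo V) = devSq A := by
  rw [devSq, devCLM_conj, conj_mul_conj, trCLM_conj, devSq]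

theorem flowEndo_conj (u : (ModelEndo V)ˣ) (A : ModelEndo V) (t : ℝ) :
    flowEndo (↑u⁻¹ * A * ↑u : ModelEndo V) t = (↑u⁻¹ * flowEndo A t * ↑u : ModelEndo V) := by
  let := NormedAlgebra.restrictScalars ℚ ℝ (ModelEndo V)
  rw [flowEndo, devCLM_conj, devSq_conj, trCLM_conj, ← smul_mul_assoc, ← mul_smul_comm,
    NormedSpace.exp_units_conj', ← smul_mul_assoc, ← mul_smul_comm, flowEndo]

theorem isInvertible_frame (ψ : W ≃L[ℝ] W) (u : (ModelEndo V)ˣ) {g : V →L[ℝ] W}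
    (hg : g.IsInvertible) : ((ψ : W →L[ℝ] W).comp (g.comp (u : ModelEndo V))).IsInvertible := by
  have hu : (u : ModelEndo V).IsInvertible :=
    ContinuousLinearMap.IsInvertible.of_inverse (g := ↑u⁻¹) u.mul_inv u.inv_mul
  exact ContinuousLinearMap.IsInvertible.comp ⟨ψ, rfl⟩ (hg.comp hu)

/-- The isomorphism ψ of the target cancels in g⁻¹h, and u acts by conjugation; traces, and hence a
and b, are therefore independent of the frame. -/
theorem sharp_frame (ψ : W ≃L[ℝ] W) (u : (ModelEndo V)ˣ) {g : V →L[ℝ] W}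
    (hg : g.IsInvertible) (h : V →L[ℝ] W) :
    sharp ((ψ : W →L[ℝ] W).comp (g.comp (u : ModelEndo V)))
      ((ψ : W →L[ℝ] W).comp (h.comp (u : ModelEndo V))) =
        (↑u⁻¹ * sharp g h * ↑u : ModelEndo V) := by
  have h1 : (ψ : W →L[ℝ] W).comp (h.comp (u : ModelEndo V)) =
      ((ψ : W →L[ℝ] W).comp (g.comp (u : ModelEndo V))).comp
        (↑u⁻¹ * sharp g h * ↑u : ModelEndo V) := by
    conv_lhs => rw [← comp_sharp hg h]
    ext v
    have : (u : ModelEndo V) ((↑u⁻¹ : ModelEndo V) (sharp g h (u.1 v))) = sharp g h (u.1 v) :=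
      DFunLike.congr_fun u.mul_inv _
    change ψ (g (sharp g h (u.1 v))) = ψ (g (u.1 ((↑u⁻¹ : ModelEndo V) (sharp g h (u.1 v)))))
    rw [this]
  rw [h1, sharp_comp (isInvertible_frame ψ u hg)]

theorem closedForm_frame (ψ : W ≃L[ℝ] W) (u : (ModelEndo V)ˣ) {g : V →L[ℝ] W}
    (hg : g.IsInvertible) (h : V →L[ℝ] W) (t : ℝ) :
    closedForm t ((ψ : W →L[ℝ] W).comp (g.comp (u : ModelEndo V)))
      ((ψ : W →L[ℝ] W).comp (h.comp (u : ModelEndo V))) =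
      (ψ : W →L[ℝ] W).comp ((closedForm t g h).comp (u : ModelEndo V)) := by
  rw [closedForm, sharp_frame ψ u hg, flowEndo_conj]
  ext v
  have : (u : ModelEndo V) ((↑u⁻¹ : ModelEndo V) (flowEndo (sharp g h) t (u.1 v))) =
      flowEndo (sharp g h) t (u.1 v) := DFunLike.congr_fun u.mul_inv _
  change ψ (g (u.1 ((↑u⁻¹ : ModelEndo V) (flowEndo (sharp g h) t (u.1 v))))) =
    ψ (g (flowEndo (sharp g h) t (u.1 v)))
  rw [this]

theorem modelChristoffel_frame (ψ : W ≃L[ℝ] W) (u : (ModelEndo V)ˣ) {g : V →L[ℝ] W}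
    (hg : g.IsInvertible) (h k : V →L[ℝ] W) :
    modelChristoffel ((ψ : W →L[ℝ] W).comp (g.comp (u : ModelEndo V)))
      ((ψ : W →L[ℝ] W).comp (h.comp (u : ModelEndo V)))
      ((ψ : W →L[ℝ] W).comp (k.comp (u : ModelEndo V))) =
      (ψ : W →L[ℝ] W).comp ((modelChristoffel g h k).comp (u : ModelEndo V)) := by
  have huu (A : ModelEndo V) (v : V) : (u : ModelEndo V) ((↑u⁻¹ * A * ↑u : ModelEndo V) v) =
      A ((u : ModelEndo V) v) := DFunLike.congr_fun u.mul_inv _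
  simp only [modelChristoffel, sharp_frame ψ u hg, conj_mul_conj, trCLM_conj]
  ext v
  simp only [ContinuousLinearMap.comp_apply, ContinuousLinearEquiv.coe_coe, add_apply, sub_apply,
    smul_apply, huu, map_add, map_sub, map_smul]

end Naturality

/-! ### Positivity -/

section Positivity

variable {V : Type*} [NormedAddCommGroup V] [NormedSpace ℝ V] [FiniteDimensional ℝ V]

/-- Self-adjointness of `A` with respect to the bilinear form `g`. -/
def IsSelfAdj (g : V →L[ℝ] V →L[ℝ] ℝ) (A : ModelEndo V) : Prop := ∀ v w, g (A v) w = g v (A w)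

variable {g h : V →L[ℝ] V →L[ℝ] ℝ} {A : ModelEndo V}

theorem IsSelfAdj.smul (hA : IsSelfAdj g A) (c : ℝ) : IsSelfAdj g (c • A) := fun v w ↦ by
  simp [hA v w]

theorem IsSelfAdj.dev (hA : IsSelfAdj g A) : IsSelfAdj g (devCLM V A) := fun v w ↦ by
  simp [devCLM_apply, hA v w]

theorem IsSelfAdj.pow (hA : IsSelfAdj g A) (m : ℕ) : IsSelfAdj g (A ^ m) := by
  induction m with
  | zero => intro v w; rfl
  | succ m ih =>
    intro v w
    conv_lhs => rw [pow_succ]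
    conv_rhs => rw [pow_succ']
    change g ((A ^ m) (A v)) w = g v (A ((A ^ m) w))
    rw [ih, hA]

theorem IsSelfAdj.exp (hA : IsSelfAdj g A) : IsSelfAdj g (NormedSpace.exp A) := fun v w ↦ by
  have h1 := NormedSpace.exp_series_hasSum_exp' (𝕂 := ℝ) A
  have h2 := (h1.mapL (ContinuousLinearMap.apply ℝ V v)).mapL (g.flip w)
  have h3 := (h1.mapL (ContinuousLinearMap.apply ℝ V w)).mapL (g v)
  have e : (fun m : ℕ ↦ g (((Nat.factorial m : ℝ)⁻¹ • A ^ m) v) w) =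
      fun m : ℕ ↦ g v (((Nat.factorial m : ℝ)⁻¹ • A ^ m) w) :=
    funext fun m ↦ ((hA.pow m).smul _) v w
  have h2' : HasSum (fun m : ℕ ↦ g (((Nat.factorial m : ℝ)⁻¹ • A ^ m) v) w)
      (g (NormedSpace.exp A v) w) := h2
  rw [e] at h2'
  exact h2'.unique h3

theorem isSelfAdj_sharp (hg : g.IsInvertible) (gs : ∀ v w, g v w = g w v)
    (hs : ∀ v w, h v w = h w v) : IsSelfAdj g (sharp g h) := fun v w ↦ by
  have h1 (v) : g (sharp g h v) = h v := DFunLike.congr_fun (comp_sharp hg h) v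
  rw [h1, gs v, h1, hs]

/-- In a g-orthogonal basis the i-th diagonal entry of A² is g(b_i, A²b_i)/g(b_i, b_i), and
self-adjointness moves one factor A to the other side. This gives the sign of tr(A²). -/
theorem trCLM_sq_eq_sum (gpos : ∀ v, v ≠ 0 → 0 < g v v) (gs : ∀ v w, g v w = g w v)
    (hA : IsSelfAdj g A) : ∃ b : Module.Basis (Fin (Module.finrank ℝ V)) ℝ V,
      trCLM V (A * A) = ∑ i, g (A (b i)) (A (b i)) / g (b i) (b i) := by
  let B : LinearMap.BilinForm ℝ V := ContinuousLinearMap.coeLM ℝ ∘ₗ g.toLinearMap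
  have hB (v w) : B v w = g v w := rfl
  obtain ⟨b, hb⟩ := LinearMap.BilinForm.exists_orthogonal_basis (B := B)
    (LinearMap.BilinForm.isSymm_def.2 gs |> LinearMap.BilinForm.isSymm_iff.1)
  refine ⟨b, ?_⟩
  have hcoord (i) (v : V) : b.repr v i = g (b i) v / g (b i) (b i) := by
    have hpos := (gpos (b i) (b.ne_zero i)).ne'
    rw [eq_div_iff hpos]
    conv_rhs => rw [← b.sum_repr v]
    rw [map_sum, Finset.sum_eq_single i]
    · simp
    · intro j _ hj
      have : g (b i) (b j) = 0 := hb hj.symm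
      simp [this]
    · simp
  rw [trCLM_apply, LinearMap.trace_eq_matrix_trace ℝ b, Matrix.trace]
  refine Finset.sum_congr rfl fun i _ ↦ ?_
  rw [Matrix.diag_apply, LinearMap.toMatrix_apply, hcoord]
  congr 1
  exact (hA _ _).symm

theorem trCLM_sq_nonneg (gpos : ∀ v, v ≠ 0 → 0 < g v v) (gs : ∀ v w, g v w = g w v)
    (hA : IsSelfAdj g A) : 0 ≤ trCLM V (A * A) := by
  obtain ⟨b, hb⟩ := trCLM_sq_eq_sum gpos gs hA
  have hnn (v : V) : 0 ≤ g v v := by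
    rcases eq_or_ne v 0 with rfl | hv
    · simp
    · exact (gpos v hv).le
  rw [hb]
  exact Finset.sum_nonneg fun i _ ↦ div_nonneg (hnn _) (hnn _)

theorem trCLM_sq_pos (gpos : ∀ v, v ≠ 0 → 0 < g v v) (gs : ∀ v w, g v w = g w v)
    (hA : IsSelfAdj g A) (h0 : A ≠ 0) : 0 < trCLM V (A * A) := by
  refine lt_of_le_of_ne (trCLM_sq_nonneg gpos gs hA) fun h ↦ h0 ?_
  obtain ⟨b, hb⟩ := trCLM_sq_eq_sum gpos gs hA
  have hnn (v : V) : 0 ≤ g v v := by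
    rcases eq_or_ne v 0 with rfl | hv
    · simp
    · exact (gpos v hv).le
  rw [hb, eq_comm, Finset.sum_eq_zero_iff_of_nonneg
    fun i _ ↦ div_nonneg (hnn _) (hnn _)] at h
  have : A.toLinearMap = 0 := b.ext fun i ↦ by
    by_contra hne
    have h1 := h i (Finset.mem_univ i)
    have h2 := gpos _ hne
    have h3 := gpos _ (b.ne_zero i)
    exact (div_pos h2 h3).ne' h1
  ext v
  exact DFunLike.congr_fun this v

theorem devSq_nonneg (gpos : ∀ v, v ≠ 0 → 0 < g v v) (gs : ∀ v w, g v w = g w v)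
    (hA : IsSelfAdj g A) : 0 ≤ devSq A :=
  mul_nonneg (Nat.cast_nonneg _) (trCLM_sq_nonneg gpos gs hA.dev)

theorem closedForm_symm (hg : g.IsInvertible) (gs : ∀ v w, g v w = g w v)
    (hs : ∀ v w, h v w = h w v) (t : ℝ) (v w : V) :
    closedForm t g h v w = closedForm t g h w v := by
  have h1 := ((isSelfAdj_sharp hg gs hs).dev.smul
    (angleFun (trCLM V (sharp g h)) (devSq (sharp g h)) t)).exp.smul
    (Real.exp (2 / Module.finrank ℝ V *
      Real.log (volRatio (trCLM V (sharp g h)) (devSq (sharp g h)) t)))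
  exact (h1 v w).trans (gs _ _)

/-- The exponential e^{bH₀} is the square of the self-adjoint e^{bH₀/2}, so g(e^{bH₀}v, v) =
g(e^{bH₀/2}v, e^{bH₀/2}v), and e^{bH₀/2}v ≠ 0. -/
theorem closedForm_pos (gpos : ∀ v, v ≠ 0 → 0 < g v v) (gs : ∀ v w, g v w = g w v)
    (hs : ∀ v w, h v w = h w v) (t : ℝ) (v : V) (hv : v ≠ 0) : 0 < closedForm t g h v v := by
  have hg := isInvertible_of_pos gpos
  set b := angleFun (trCLM V (sharp g h)) (devSq (sharp g h)) t with hb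
  set c := Real.exp (2 / Module.finrank ℝ V *
      Real.log (volRatio (trCLM V (sharp g h)) (devSq (sharp g h)) t)) with hc
  set Y := (b / 2) • devCLM V (sharp g h) with hY
  have hY' : IsSelfAdj g (NormedSpace.exp Y) := ((isSelfAdj_sharp hg gs hs).dev.smul _).exp
  have hadd : NormedSpace.exp (b • devCLM V (sharp g h)) =
      NormedSpace.exp Y * NormedSpace.exp Y := by
    let := NormedAlgebra.restrictScalars ℚ ℝ (ModelEndo V)
    rw [← NormedSpace.exp_add_of_commute (Commute.refl Y), hY, ← add_smul, add_halves]
  have h1 : closedForm t g h v v = c * g (NormedSpace.exp Y v) (NormedSpace.exp Y v) := by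
    have : closedForm t g h v v = g ((c • NormedSpace.exp (b • devCLM V (sharp g h))) v) v := rfl
    rw [this, hadd]
    change g (c • (NormedSpace.exp Y (NormedSpace.exp Y v))) v = _
    rw [map_smul, smul_apply, smul_eq_mul, hY']
  rw [h1]
  refine mul_pos (Real.exp_pos _) (gpos _ fun h0 ↦ hv ?_)
  have h2 : (NormedSpace.exp (-Y) * NormedSpace.exp Y) v = v := by rw [exp_neg_mul_exp]; rfl
  rw [← h2]
  change NormedSpace.exp (-Y) (NormedSpace.exp Y v) = 0
  rw [h0, map_zero]

end Positivity

end

noncomputable section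

set_option linter.unusedSectionVars false

/-! ### The derivative of the closed formula with respect to the initial data -/

section Jacobi

variable {V : Type*} [NormedAddCommGroup V] [NormedSpace ℝ V] [FiniteDimensional ℝ V]
  {W : Type*} [NormedAddCommGroup W] [NormedSpace ℝ W]

theorem negAd_smul_devCLM (b : ℝ) (H : ModelEndo V) : negAd (b • devCLM V H) = negAd (b • H) := by
  ext1 Y
  simp only [negAd_apply, devCLM_apply, smul_sub, mul_sub, sub_mul, smul_mul_assoc, mul_smul_comm,
    mul_one, one_mul]
  abel

/-- The first commutator with bH removes the multiple of H₀ and the trace part of L. Hence the terms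
of positive order can be written with H and L in place of H₀ and L₀. -/
theorem negAd_pow_succ_apply (b c : ℝ) (H L : ModelEndo V) (m : ℕ) :
    (negAd (b • devCLM V H) ^ (m + 1)) (c • devCLM V H + b • devCLM V L) =
      (negAd (b • H) ^ (m + 1)) (b • L) := by
  rw [negAd_smul_devCLM, pow_succ]
  change (negAd (b • H) ^ m) (negAd (b • H) (c • devCLM V H + b • devCLM V L)) =
    (negAd (b • H) ^ m) (negAd (b • H) (b • L))
  congr 1
  simp only [negAd_apply, devCLM_apply, smul_sub, mul_sub, sub_mul, smul_mul_assoc, mul_smul_comm,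
    mul_one, one_mul, mul_add, add_mul]
  module

theorem dexpSeries_eq (b c : ℝ) (H L : ModelEndo V) :
    dexpSeries (b • devCLM V H) (b • devCLM V L + c • devCLM V H) =
      (c • devCLM V H + b • devCLM V L) + commSeries (b • H) (b • L) := by
  rw [dexpSeries_eq_add, add_comm (b • devCLM V L)]
  congr 1
  exact tsum_congr fun m ↦ by rw [negAd_pow_succ_apply]

theorem commSeries_of_dev_eq_zero {H : ModelEndo V} (hH : devCLM V H = 0) (b : ℝ)
    (B : ModelEndo V) : commSeries (b • H) B = 0 := by
  have h0 : negAd (b • H) = 0 := by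
    rw [← negAd_smul_devCLM, hH, smul_zero]
    ext1 Y
    simp [negAd_apply]
  have : (fun m : ℕ ↦ (Nat.factorial (m + 1 + 1) : ℝ)⁻¹ • (negAd (b • H) ^ (m + 1)) B) = 0 := by
    funext m
    rw [h0, zero_pow (Nat.succ_ne_zero m)]
    simp
  rw [commSeries, this]
  exact tsum_zero

theorem hasDerivAt_devSq {H : ℝ → ModelEndo V} {L : ModelEndo V} {s : ℝ} (hH : HasDerivAt H L s) :
    HasDerivAt (fun r ↦ devSq (H r))
      (2 * Module.finrank ℝ V * trCLM V (devCLM V (H s) * devCLM V L)) s := by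
  have h1 := (devCLM V).hasFDerivAt.comp_hasDerivAt s hH
  have h2 := ((trCLM V).hasFDerivAt.comp_hasDerivAt s (h1.mul h1)).const_mul
    (Module.finrank ℝ V : ℝ)
  refine h2.congr_deriv ?_
  simp only [map_add, Function.comp]
  rw [trCLM_mul_comm (devCLM V L)]
  ring

/-- The derivative of `e^{a Id + b H₀}` with respect to `H`. -/
theorem hasDerivAt_flowEndo_param {H : ℝ → ModelEndo V} {L : ModelEndo V} {s t b' : ℝ}
    (hH : HasDerivAt H L s) (hd : AngleDomain (trCLM V (H s)) (devSq (H s)) t)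
    (hb : HasDerivAt (fun r ↦ angleFun (trCLM V (H r)) (devSq (H r)) t) b' s) :
    HasDerivAt (fun r ↦ flowEndo (H r) t)
      (flowEndo (H s) t * ((2 / Module.finrank ℝ V * (((1 + t / 4 * trCLM V (H s)) * (t / 2)
          * trCLM V L + 2 * Module.finrank ℝ V * trCLM V (devCLM V (H s) * devCLM V L) * t ^ 2 / 16)
            / volRatio (trCLM V (H s)) (devSq (H s)) t)) • (1 : ModelEndo V)
        + (b' • devCLM V (H s)
          + angleFun (trCLM V (H s)) (devSq (H s)) t • devCLM V L)
        + commSeries (angleFun (trCLM V (H s)) (devSq (H s)) t • H s)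
          (angleFun (trCLM V (H s)) (devSq (H s)) t • L))) s := by
  have hτ := (trCLM V).hasFDerivAt.comp_hasDerivAt s hH
  have hv : HasDerivAt (fun r ↦ volRatio (trCLM V (H r)) (devSq (H r)) t)
      ((1 + t / 4 * trCLM V (H s)) * (t / 2) * trCLM V L
        + 2 * Module.finrank ℝ V * trCLM V (devCLM V (H s) * devCLM V L) * t ^ 2 / 16) s := by
    refine ((((hτ.const_mul (t / 4)).const_add 1).pow 2).add
      (((hasDerivAt_devSq hH).mul_const (t ^ 2)).div_const 16)).congr_deriv ?_
    simp only [Function.comp]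
    ring
  have ha := ((hv.log (volRatio_pos hd).ne').const_mul (2 / (Module.finrank ℝ V : ℝ))).exp
  have hX0 : HasDerivAt (fun r ↦ angleFun (trCLM V (H r)) (devSq (H r)) t • devCLM V (H r))
      (angleFun (trCLM V (H s)) (devSq (H s)) t • devCLM V L + b' • devCLM V (H s)) s :=
    hb.smul ((devCLM V).hasFDerivAt.comp_hasDerivAt s hH)
  have hX := hX0.normedSpace_exp
  refine (ha.smul hX).congr_deriv ?_
  set b := angleFun (trCLM V (H s)) (devSq (H s)) t
  rw [dexpSeries_eq, flowEndo]
  generalize commSeries (b • H s) (b • L) = S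
  generalize b' • devCLM V (H s) + b • devCLM V L = X
  generalize NormedSpace.exp (b • devCLM V (H s)) = E
  simp only [mul_add, mul_smul_comm, mul_one, smul_mul_assoc]
  module

/-- The derivative b' of the angle is left unspecified: its explicit form requires y > 0, while at
H₀ = 0 it is multiplied by H₀ and drops out. -/
theorem hasDerivAt_closedForm_param {g h : ℝ → (V →L[ℝ] W)} {g' h' : V →L[ℝ] W} {s t b' : ℝ}
    (hg : HasDerivAt g g' s) (hh : HasDerivAt h h' s) (hi : (g s).IsInvertible)
    {H L : ModelEndo V} (hH : H = sharp (g s) (h s)) (hL : L = sharp (g s) (h' - g'.comp H))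
    (hd : AngleDomain (trCLM V H) (devSq H) t)
    (hb : HasDerivAt (fun r ↦ angleFun (trCLM V (sharp (g r) (h r)))
      (devSq (sharp (g r) (h r))) t) b' s) :
    HasDerivAt (fun r ↦ closedForm t (g r) (h r))
      (g'.comp (flowEndo H t) + (closedForm t (g s) (h s)).comp
        ((2 / Module.finrank ℝ V * (((1 + t / 4 * trCLM V H) * (t / 2)
          * trCLM V L + 2 * Module.finrank ℝ V * trCLM V (devCLM V H * devCLM V L) * t ^ 2 / 16)
            / volRatio (trCLM V H) (devSq H) t)) • (1 : ModelEndo V)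
        + (b' • devCLM V H + angleFun (trCLM V H) (devSq H) t • devCLM V L)
        + commSeries (angleFun (trCLM V H) (devSq H) t • H)
          (angleFun (trCLM V H) (devSq H) t • L))) s := by
  subst hH hL
  exact hg.clm_comp (hasDerivAt_flowEndo_param (hasDerivAt_sharp hg hh hi) hd hb)

theorem exists_hasDerivAt_angleFun {g h : ℝ → (V →L[ℝ] W)} {g' h' : V →L[ℝ] W} {s t : ℝ}
    (hg : HasDerivAt g g' s) (hh : HasDerivAt h h' s) (hi : (g s).IsInvertible)
    (hd : AngleDomain (trCLM V (sharp (g s) (h s))) (devSq (sharp (g s) (h s))) t) :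
    ∃ b', HasDerivAt (fun r ↦ angleFun (trCLM V (sharp (g r) (h r)))
      (devSq (sharp (g r) (h r))) t) b' s := by
  have hH := hasDerivAt_sharp hg hh hi
  have hτ := (trCLM V).hasFDerivAt.comp_hasDerivAt s hH
  have h1 := hτ.prodMk ((hasDerivAt_devSq hH).prodMk (hasDerivAt_const s t))
  have h2 := ((contDiffAt_angleFun hd).differentiableAt (by simp)).hasFDerivAt
  exact ⟨_, HasFDerivAt.comp_hasDerivAt s (l := fun p : ℝ × ℝ × ℝ ↦ angleFun p.1 p.2.1 p.2.2)
    h2 h1⟩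

/-- The Jacobi field with initial data `k`, `Lhat` at the points where `H₀ = 0`. -/
theorem hasDerivAt_closedForm_of_dev_eq_zero {g h : ℝ → (V →L[ℝ] W)} {g' h' : V →L[ℝ] W} {s t : ℝ}
    (hg : HasDerivAt g g' s) (hh : HasDerivAt h h' s) (hi : (g s).IsInvertible)
    {H L : ModelEndo V} (hH : H = sharp (g s) (h s)) (hL : L = sharp (g s) (h' - g'.comp H))
    (hd : AngleDomain (trCLM V H) (devSq H) t) (h0 : devCLM V H = 0) :
    HasDerivAt (fun r ↦ closedForm t (g r) (h r))
      (angleFun (trCLM V H) (devSq H) t • (closedForm t (g s) (h s)).comp L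
        + g'.comp (flowEndo H t)) s := by
  obtain ⟨b', hb⟩ := exists_hasDerivAt_angleFun hg hh hi (t := t) (by rwa [hH] at hd)
  refine (hasDerivAt_closedForm_param hg hh hi hH hL hd hb).congr_deriv ?_
  rw [add_comm, ← ContinuousLinearMap.comp_smul]
  congr 2
  rw [commSeries_of_dev_eq_zero h0, h0, add_zero, smul_zero, zero_add, zero_mul, map_zero]
  rcases eq_or_ne (Module.finrank ℝ V) 0 with hn | hn
  · have := subsingleton_of_finrank_eq_zero hn
    exact Subsingleton.elim _ _
  have hn' : (Module.finrank ℝ V : ℝ) ≠ 0 := by exact_mod_cast hn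
  have hy : devSq H = 0 := by simp [devSq, h0]
  rw [hy] at hd ⊢
  have hc : 0 < 4 + t * trCLM V H := by
    rcases hd with h | h
    · exact absurd h (lt_irrefl _)
    · exact h.2
  -- For y = 0 both v and b are powers of 1 + tτ/4 up to the factor t, and the trace term becomes
  -- (b/n) tr(L) Id, which completes bL₀ to bL.
  have hv : volRatio (trCLM V H) 0 t = (4 + t * trCLM V H) ^ 2 / 16 := by unfold volRatio; ring
  rw [angleFun_of_zero hc, hv]
  conv_rhs => rw [eq_dev_add L, smul_add, add_comm, smul_smul]
  congr 2
  field_simp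
  ring

/-- The endomorphism `P^⊥`. -/
def perpEndo (H : ModelEndo V) (t : ℝ) : ModelEndo V :=
  ((Module.finrank ℝ V : ℝ)⁻¹ * (volRatio (trCLM V H) (devSq H) t)⁻¹) • (1 : ModelEndo V)
  - (2 * ((trCLM V H / 2 + t * (trCLM V H ^ 2 + devSq H) / 8) /
    volRatio (trCLM V H) (devSq H) t) / devSq H) • devCLM V H

/-- Id and H₀ are orthogonal for the trace form. The prescribed trace fixes the coefficient of Id;
orthogonality to P then fixes that of H₀, which enters with the nonzero factor y/(nv). -/
theorem eq_perpEndo_iff {H : ModelEndo V} {t : ℝ} (hq : 0 < devSq H) {N : ModelEndo V}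
    (hmem : N ∈ Submodule.span ℝ {(1 : ModelEndo V), devCLM V H}) :
    trCLM V N = (volRatio (trCLM V H) (devSq H) t)⁻¹ ∧ trCLM V (velocity H t * N) = 0 ↔
      N = perpEndo H t := by
  have hn : (Module.finrank ℝ V : ℝ) ≠ 0 := fun h ↦ by simp [devSq, h] at hq
  have hv := volRatio_pos (τ := trCLM V H) (t := t) (Or.inl hq)
  obtain ⟨x, y, rfl⟩ := Submodule.mem_span_pair.1 hmem
  have hqn : trCLM V (devCLM V H * devCLM V H) = devSq H / Module.finrank ℝ V := by
    unfold devSq; field_simp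
  have e1 : trCLM V (x • (1 : ModelEndo V) + y • devCLM V H) = x * Module.finrank ℝ V := by
    simp only [map_add, map_smul, trCLM_one, trCLM_dev, smul_eq_mul, mul_zero, add_zero]
  have e2 : trCLM V (velocity H t * (x • (1 : ModelEndo V) + y • devCLM V H)) =
      2 * ((trCLM V H / 2 + t * (trCLM V H ^ 2 + devSq H) / 8) /
        volRatio (trCLM V H) (devSq H) t) * x
      + (volRatio (trCLM V H) (devSq H) t)⁻¹ * y * (devSq H / Module.finrank ℝ V) := by
    rw [velocity]
    generalize (trCLM V H / 2 + t * (trCLM V H ^ 2 + devSq H) / 8) /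
        volRatio (trCLM V H) (devSq H) t = c
    simp only [add_mul, mul_add, smul_mul_smul_comm, one_mul, mul_one, map_add, map_smul, trCLM_one,
      trCLM_dev, smul_eq_mul, mul_zero, add_zero, zero_add, hqn]
    field_simp
  rw [e1, e2, perpEndo]
  set v := volRatio (trCLM V H) (devSq H) t
  set v1 := trCLM V H / 2 + t * (trCLM V H ^ 2 + devSq H) / 8
  constructor
  · rintro ⟨h1, h2⟩
    have hx : x = (Module.finrank ℝ V : ℝ)⁻¹ * v⁻¹ := by rw [← h1]; field_simp
    have hy : y = -(2 * (v1 / v) / devSq H) := by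
      rw [hx] at h2
      field_simp at h2 ⊢
      linear_combination h2
    rw [hx, hy, neg_smul, sub_eq_add_neg]
  · intro h
    have hx : x = (Module.finrank ℝ V : ℝ)⁻¹ * v⁻¹ := by
      have := congrArg (trCLM V) h
      rw [e1] at this
      simp only [map_sub, map_smul, trCLM_one, trCLM_dev, smul_eq_mul, mul_zero, sub_zero] at this
      exact mul_right_cancel₀ hn this
    have hy : y = -(2 * (v1 / v) / devSq H) := by
      have h3 : trCLM V (devCLM V H * (x • (1 : ModelEndo V) + y • devCLM V H)) =
          trCLM V (devCLM V H * (((Module.finrank ℝ V : ℝ)⁻¹ * v⁻¹) • (1 : ModelEndo V)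
            - (2 * (v1 / v) / devSq H) • devCLM V H)) := by rw [h]
      simp only [mul_add, mul_sub, mul_smul_comm, mul_one, map_add, map_sub, map_smul, trCLM_dev,
        smul_eq_mul, mul_zero, zero_add, zero_sub, hqn] at h3
      field_simp at h3 ⊢
      linear_combination h3
    rw [hx, hy]
    constructor
    · field_simp
    · field_simp
      ring

theorem perpEndo_mem_span (H : ModelEndo V) (t : ℝ) :
    perpEndo H t ∈ Submodule.span ℝ {(1 : ModelEndo V), devCLM V H} :=
  Submodule.mem_span_pair.2 ⟨_, _, by rw [perpEndo, sub_eq_add_neg, ← neg_smul]⟩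

theorem trCLM_mul_eq (A B : ModelEndo V) :
    trCLM V (A * B) =
      trCLM V (devCLM V A * devCLM V B) + trCLM V A * trCLM V B / Module.finrank ℝ V := by
  rcases eq_or_ne (Module.finrank ℝ V) 0 with hn | hn
  · have := subsingleton_of_finrank_eq_zero hn
    have hA : A = 0 := Subsingleton.elim _ _
    simp [hA]
  have hn' : (Module.finrank ℝ V : ℝ) ≠ 0 := by exact_mod_cast hn
  conv_lhs => rw [eq_dev_add A, eq_dev_add B]
  simp only [mul_add, add_mul, map_add, smul_mul_assoc, mul_smul_comm, one_mul, mul_one, map_smul,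
    trCLM_dev, trCLM_one, smul_eq_mul]
  field_simp
  ring

/-- The Jacobi field with initial data `k`, `Lhat` at the points where `H₀ ≠ 0`. -/
theorem hasDerivAt_closedForm_of_devSq_pos {g h : ℝ → (V →L[ℝ] W)} {g' h' : V →L[ℝ] W} {s t : ℝ}
    (hg : HasDerivAt g g' s) (hh : HasDerivAt h h' s) (hi : (g s).IsInvertible)
    {H L : ModelEndo V} (hH : H = sharp (g s) (h s)) (hL : L = sharp (g s) (h' - g'.comp H))
    (hq : 0 < devSq H) :
    HasDerivAt (fun r ↦ closedForm t (g r) (h r))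
      ((trCLM V (H * L) / trCLM V (H * H)) • t • (closedForm t (g s) (h s)).comp (velocity H t)
        + ((trCLM V L * trCLM V (H * H) - trCLM V (L * H) * trCLM V H) / trCLM V (H * H)) •
          t • (closedForm t (g s) (h s)).comp (perpEndo H t)
        + angleFun (trCLM V H) (devSq H) t • (closedForm t (g s) (h s)).comp
          (-(trCLM V (devCLM V H * devCLM V L) / trCLM V (devCLM V H * devCLM V H)) • devCLM V H
            + devCLM V L)
        + (closedForm t (g s) (h s)).comp
          (commSeries (angleFun (trCLM V H) (devSq H) t • H) (angleFun (trCLM V H) (devSq H) t • L))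
        + g'.comp (flowEndo H t)) s := by
  have hd : AngleDomain (trCLM V H) (devSq H) t := Or.inl hq
  have hH' := hasDerivAt_sharp hg hh hi
  rw [← hH, ← hL] at hH'
  have hτ := (trCLM V).hasFDerivAt.comp_hasDerivAt s hH'
  have hb := hasDerivAt_angleFun_of_pos hτ (hasDerivAt_devSq hH') (hasDerivAt_const s t)
    (by rwa [← hH])
  refine (hasDerivAt_closedForm_param hg hh hi hH hL hd hb).congr_deriv ?_
  simp only [Function.comp, ← hH]
  rw [add_comm]
  congr 1
  simp only [← ContinuousLinearMap.comp_smul, ← ContinuousLinearMap.comp_add]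
  congr 2
  have hn : (Module.finrank ℝ V : ℝ) ≠ 0 := fun h ↦ by simp [devSq, h] at hq
  have hv := volRatio_pos (τ := trCLM V H) (t := t) (Or.inl hq)
  have hqn : trCLM V (devCLM V H * devCLM V H) = devSq H / Module.finrank ℝ V := by
    unfold devSq; field_simp
  rw [trCLM_mul_eq H L, trCLM_mul_eq L H, trCLM_mul_comm (devCLM V L), trCLM_sq, hqn, velocity,
    perpEndo]
  have hv' := hv.ne'
  have hq' := hq.ne'
  have hw : volRatio (trCLM V H) (devSq H) t =
    (1 + t / 4 * trCLM V H) ^ 2 + devSq H * t ^ 2 / 16 := rfl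
  generalize volRatio (trCLM V H) (devSq H) t = v at *
  generalize angleFun (trCLM V H) (devSq H) t = b at *
  generalize trCLM V (devCLM V H * devCLM V L) = e at *
  generalize devSq H = y at *
  generalize trCLM V H = τ at *
  generalize trCLM V L = l at *
  generalize (Module.finrank ℝ V : ℝ) = d at *
  have hne : y + τ ^ 2 ≠ 0 := by positivity
  have hne2 : y / d + τ ^ 2 / d ≠ 0 := by
    rw [← add_div]
    exact div_ne_zero hne hn
  -- The coefficients of Id, H₀ and L₀ are compared. In b' the summand −by'/(2y) is −b
  -- tr(H₀L₀)/tr(H₀²), the projection term of the formula; the rational summand of b' joins the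
  -- derivative of a to form the two terms along P and its orthogonal.
  match_scalars
  · field_simp
    ring
  · field_simp
    ring
  · ring

end Jacobi

end

/-! ### Pullback of bilinear forms -/

noncomputable section

section PullForm

variable {V : Type*} [NormedAddCommGroup V] [NormedSpace ℝ V]

/-- The pullback of a bilinear form under an endomorphism. -/
def pullForm (φ : ModelEndo V) (α : V →L[ℝ] V →L[ℝ] ℝ) : V →L[ℝ] V →L[ℝ] ℝ :=
  α.bilinearComp φ φ

theorem pullForm_apply (φ : ModelEndo V) (α : V →L[ℝ] V →L[ℝ] ℝ) (v w : V) :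
    pullForm φ α v w = α (φ v) (φ w) := rfl

theorem pullForm_inv_pullForm (u : (ModelEndo V)ˣ) (α : V →L[ℝ] V →L[ℝ] ℝ) :
    pullForm (↑u⁻¹ : ModelEndo V) (pullForm (u : ModelEndo V) α) = α := by
  have h (v : V) : (u : ModelEndo V) ((↑u⁻¹ : ModelEndo V) v) = v := DFunLike.congr_fun u.mul_inv v
  ext v w
  rw [pullForm_apply, pullForm_apply, h, h]

/-- Pulling back both arguments means composing with u on the source and with its transpose on the
target, so naturality under frames applies with ψ the transpose of u. -/
theorem pullForm_eq_frame (u : (ModelEndo V)ˣ) :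
    ∃ ψ : (V →L[ℝ] ℝ) ≃L[ℝ] (V →L[ℝ] ℝ), ∀ α : V →L[ℝ] V →L[ℝ] ℝ,
      pullForm (u : ModelEndo V) α =
        (ψ : (V →L[ℝ] ℝ) →L[ℝ] (V →L[ℝ] ℝ)).comp (α.comp (u : ModelEndo V)) := by
  refine ⟨ContinuousLinearEquiv.equivOfInverse (ContinuousLinearMap.precomp ℝ (u : ModelEndo V))
    (ContinuousLinearMap.precomp ℝ (↑u⁻¹ : ModelEndo V)) (fun f ↦ ?_) (fun f ↦ ?_), fun α ↦ rfl⟩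
  · ext v
    exact congrArg f (DFunLike.congr_fun u.mul_inv v)
  · ext v
    exact congrArg f (DFunLike.congr_fun u.inv_mul v)

theorem ContDiffWithinAt.comp_comp {W P : Type*} [NormedAddCommGroup W] [NormedSpace ℝ W]
    [NormedAddCommGroup P] [NormedSpace ℝ P] {S : Set P} {p : P} {α : P → (V →L[ℝ] W)}
    (hα : ContDiffWithinAt ℝ ∞ α S p) (ψ : W →L[ℝ] W) (φ : ModelEndo V) :
    ContDiffWithinAt ℝ ∞ (fun q ↦ ψ.comp ((α q).comp φ)) S p :=
  contDiffWithinAt_const.clm_comp (hα.clm_comp contDiffWithinAt_const)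

set_option synthInstance.maxHeartbeats 400000 in
theorem ContDiffWithinAt.pullForm {P : Type*} [NormedAddCommGroup P] [NormedSpace ℝ P] {S : Set P}
    {p : P} {α : P → (V →L[ℝ] V →L[ℝ] ℝ)} (hα : ContDiffWithinAt ℝ ∞ α S p) (φ : ModelEndo V) :
    ContDiffWithinAt ℝ ∞ (fun q ↦ pullForm φ (α q)) S p :=
  hα.comp_comp (ContinuousLinearMap.precomp ℝ φ) φ

variable [FiniteDimensional ℝ V]

variable (u : (ModelEndo V)ˣ) {g : V →L[ℝ] V →L[ℝ] ℝ}

theorem isInvertible_pullForm (hg : g.IsInvertible) :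
    (pullForm (u : ModelEndo V) g).IsInvertible := by
  obtain ⟨ψ, hψ⟩ := pullForm_eq_frame u
  rw [hψ]
  exact isInvertible_frame ψ u hg

theorem sharp_pullForm (hg : g.IsInvertible) (h : V →L[ℝ] V →L[ℝ] ℝ) :
    sharp (pullForm (u : ModelEndo V) g) (pullForm (u : ModelEndo V) h) =
      (↑u⁻¹ * sharp g h * ↑u : ModelEndo V) := by
  obtain ⟨ψ, hψ⟩ := pullForm_eq_frame u
  rw [hψ, hψ, sharp_frame ψ u hg]

theorem closedForm_pullForm (hg : g.IsInvertible) (h : V →L[ℝ] V →L[ℝ] ℝ) (t : ℝ) :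
    closedForm t (pullForm (u : ModelEndo V) g) (pullForm (u : ModelEndo V) h) =
      pullForm (u : ModelEndo V) (closedForm t g h) := by
  obtain ⟨ψ, hψ⟩ := pullForm_eq_frame u
  rw [hψ, hψ, hψ, closedForm_frame ψ u hg]

theorem modelChristoffel_pullForm (hg : g.IsInvertible) (h k : V →L[ℝ] V →L[ℝ] ℝ) :
    modelChristoffel (pullForm (u : ModelEndo V) g) (pullForm (u : ModelEndo V) h)
      (pullForm (u : ModelEndo V) k) = pullForm (u : ModelEndo V) (modelChristoffel g h k) := by
  obtain ⟨ψ, hψ⟩ := pullForm_eq_frame u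
  rw [hψ, hψ, hψ, hψ, modelChristoffel_frame ψ u hg]

theorem trCLM_sharp_pullForm (hg : g.IsInvertible) (h : V →L[ℝ] V →L[ℝ] ℝ) :
    trCLM V (sharp (pullForm (u : ModelEndo V) g) (pullForm (u : ModelEndo V) h)) =
      trCLM V (sharp g h) := by
  rw [sharp_pullForm u hg, trCLM_conj]

theorem devSq_sharp_pullForm (hg : g.IsInvertible) (h : V →L[ℝ] V →L[ℝ] ℝ) :
    devSq (sharp (pullForm (u : ModelEndo V) g) (pullForm (u : ModelEndo V) h)) =
      devSq (sharp g h) := by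
  rw [sharp_pullForm u hg, devSq_conj]

end PullForm

/-! ### Smoothness of the closed formula along maps from a manifold -/

section ManifoldSmoothness

variable {V : Type*} [NormedAddCommGroup V] [NormedSpace ℝ V] [FiniteDimensional ℝ V]
  {W : Type*} [NormedAddCommGroup W] [NormedSpace ℝ W]
  {B : Type*} [NormedAddCommGroup B] [NormedSpace ℝ B] {H : Type*} [TopologicalSpace H]
  {I : ModelWithCorners ℝ B H} {N : Type*} [TopologicalSpace N] [ChartedSpace H N] {s : Set N}
  {q₀ : N}

theorem ContMDiffWithinAt.closedForm {τ : N → ℝ} {g h : N → (V →L[ℝ] W)}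
    (hτ : ContMDiffWithinAt I 𝓘(ℝ, ℝ) ∞ τ s q₀)
    (hg : ContMDiffWithinAt I 𝓘(ℝ, V →L[ℝ] W) ∞ g s q₀)
    (hh : ContMDiffWithinAt I 𝓘(ℝ, V →L[ℝ] W) ∞ h s q₀) (hi : (g q₀).IsInvertible)
    (hd : AngleDomain (trCLM V (sharp (g q₀) (h q₀))) (devSq (sharp (g q₀) (h q₀))) (τ q₀)) :
    ContMDiffWithinAt I 𝓘(ℝ, V →L[ℝ] W) ∞ (fun q ↦ closedForm (τ q) (g q) (h q)) s q₀ :=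
  ContMDiffAt.comp_contMDiffWithinAt (I' := 𝓘(ℝ, ℝ × (V →L[ℝ] W) × (V →L[ℝ] W)))
    (g := fun p : ℝ × (V →L[ℝ] W) × (V →L[ℝ] W) ↦ _root_.closedForm p.1 p.2.1 p.2.2)
    (f := fun q ↦ (τ q, g q, h q)) q₀ (contDiffAt_closedForm hi hd).contMDiffAt
    (hτ.prodMk_space (hg.prodMk_space hh))

theorem ContMDiffWithinAt.modelChristoffel {g h k : N → (V →L[ℝ] W)}
    (hg : ContMDiffWithinAt I 𝓘(ℝ, V →L[ℝ] W) ∞ g s q₀)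
    (hh : ContMDiffWithinAt I 𝓘(ℝ, V →L[ℝ] W) ∞ h s q₀)
    (hk : ContMDiffWithinAt I 𝓘(ℝ, V →L[ℝ] W) ∞ k s q₀) (hi : (g q₀).IsInvertible) :
    ContMDiffWithinAt I 𝓘(ℝ, V →L[ℝ] W) ∞ (fun q ↦ modelChristoffel (g q) (h q) (k q)) s q₀ :=
  ContMDiffAt.comp_contMDiffWithinAt (I' := 𝓘(ℝ, (V →L[ℝ] W) × (V →L[ℝ] W) × (V →L[ℝ] W)))
    (g := fun p : (V →L[ℝ] W) × (V →L[ℝ] W) × (V →L[ℝ] W) ↦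
      _root_.modelChristoffel p.1 p.2.1 p.2.2)
    (f := fun q ↦ (g q, h q, k q)) q₀ (contDiffAt_modelChristoffel hi _ _).contMDiffAt
    (hg.prodMk_space (hh.prodMk_space hk))

end ManifoldSmoothness

abbrev ModelForm (n : ℕ) : Type :=
  EuclideanSpace ℝ (Fin n) →L[ℝ] EuclideanSpace ℝ (Fin n) →L[ℝ] ℝ

/-! ### Coordinates of tensor fields in the bundle trivializations -/

section
variable {n : ℕ} {M : Type*} [TopologicalSpace M] [ChartedSpace (EuclideanSpace ℝ (Fin n)) M]
  [IsManifold (𝓡 n) ∞ M]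

/-- The inverse of the tangent bundle trivialization around `p`, on the fibre at `x`. -/
def frameAt (p x : M) : ModelEndo (EuclideanSpace ℝ (Fin n)) :=
  (trivializationAt (EuclideanSpace ℝ (Fin n)) (TangentSpace (𝓡 n) (M := M)) p).symmL ℝ x

/-- Coordinates of a `(0,2)`-tensor at `x` in the trivialization around `p`. -/
def coordForm (p x : M) (α : Form02 n x) : ModelForm n :=
  pullForm (frameAt p x) α

theorem frameAt_apply {p x : M}
    (hx : x ∈ (trivializationAt (EuclideanSpace ℝ (Fin n)) (TangentSpace (𝓡 n) (M := M)) p).baseSet)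
    (v : EuclideanSpace ℝ (Fin n)) : frameAt p x v =
      (trivializationAt (EuclideanSpace ℝ (Fin n)) (TangentSpace (𝓡 n) (M := M)) p).symm x v :=
  Trivialization.symmL_apply _ hx v

theorem isUnit_frameAt {p x : M} (hx : x ∈ (chartAt (EuclideanSpace ℝ (Fin n)) p).source) :
   IsUnit (frameAt (n := n) p x) := by
  have hx' : x ∈ (trivializationAt (EuclideanSpace ℝ (Fin n)) (TangentSpace (𝓡 n) (M := M))
      p).baseSet := by
    simpa using hx
  refine ⟨⟨frameAt p x, (trivializationAt (EuclideanSpace ℝ (Fin n)) (TangentSpace (𝓡 n) (M := M))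
      p).continuousLinearMapAt ℝ x, ?_, ?_⟩, rfl⟩
  · ext1 v
    exact Trivialization.symmL_continuousLinearMapAt _ hx' v
  · ext1 v
    exact Trivialization.continuousLinearMapAt_symmL _ hx' v

/-- The trivialization of the bundle of forms is induced by that of TM and by the trivial line
bundle, so it amounts to pulling back along the frame. -/
theorem inCoordinates_eq_coordForm (p x : M) 
    (hx : x ∈ (trivializationAt (EuclideanSpace ℝ (Fin n)) (TangentSpace (𝓡 n) (M := M)) p).baseSet)
        (α : Form02 n x) :
    (trivializationAt (ModelForm n)
        (fun x : M ↦ TangentSpace (𝓡 n) x →L[ℝ] TangentSpace (𝓡 n) x →L[ℝ] ℝ) p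
      ⟨x, α⟩).2 = coordForm p x α := by
  refine ContinuousLinearMap.ext fun v => ContinuousLinearMap.ext fun w => ?_
  refine (congrArg (fun T : ModelForm n => T v w)
      (hom_trivializationAt_apply (RingHom.id ℝ) p
          (⟨x, α⟩ : TotalSpace (ModelForm n)
              (fun x : M ↦ TangentSpace (𝓡 n) x →L[ℝ] TangentSpace (𝓡 n) x →L[ℝ] ℝ)) |> congrArg
                  Prod.snd)).trans ?_
  refine (inCoordinates_apply_eq₂ hx hx (by trivial)).trans ?_
  refine Eq.trans ?_ (pullForm_apply (frameAt p x) α v w).symm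
  rw [frameAt_apply hx, frameAt_apply hx]
  exact DFunLike.congr_fun (Trivial.linearMapAt_trivialization (𝕜 := ℝ) (B := M) (F := ℝ) x) _

/-- Replaces smoothness of a section of the bundle by smoothness of a map into one vector space,
where the closed formula is defined. -/
theorem contMDiffWithinAt_family_iff {B : Type*} [NormedAddCommGroup B] [NormedSpace ℝ B]
    {H : Type*} [TopologicalSpace H] {I : ModelWithCorners ℝ B H}
    {N : Type*} [TopologicalSpace N] [ChartedSpace H N] {s : Set N} {q₀ : N} {f : N → M} 
    {α : (q : N) → Form02 n (f q)} :
    ContMDiffWithinAt I ((𝓡 n).prod 𝓘(ℝ, ModelForm n)) ∞ (fun q ↦ TotalSpace.mk' (ModelForm n)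
      (E := fun x : M ↦ TangentSpace (𝓡 n) x →L[ℝ] TangentSpace (𝓡 n) x →L[ℝ] ℝ) (f q) (α q)) s q₀ ↔
    ContMDiffWithinAt I (𝓡 n) ∞ f s q₀ ∧
      ContMDiffWithinAt I 𝓘(ℝ, ModelForm n) ∞ (fun q ↦ coordForm (f q₀) (f q) (α q)) s q₀ := by
  rw [contMDiffWithinAt_totalSpace]
  refine and_congr_right fun hf => ?_
  have h1 : ∀ᶠ q in 𝓝[s] q₀, f q ∈ (trivializationAt (EuclideanSpace ℝ (Fin n))
      (TangentSpace (𝓡 n) (M := M)) (f q₀)).baseSet :=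
    hf.continuousWithinAt (FiberBundle.mem_baseSet_trivializationAt' _ |> fun h =>
        (Trivialization.open_baseSet _).mem_nhds h)
  apply Filter.EventuallyEq.contMDiffWithinAt_iff
  · filter_upwards [h1] with q hq
    exact inCoordinates_eq_coordForm _ _ hq _
  · exact inCoordinates_eq_coordForm _ _ (FiberBundle.mem_baseSet_trivializationAt' _) _

/-- A `(0,2)`-tensor at a point, as a form on the model space. -/
def Form02.toModel {x : M} (α : Form02 n x) : ModelForm n := α

theorem mem_baseSet_iff {p x : M} :
    x ∈ (trivializationAt (EuclideanSpace ℝ (Fin n)) (TangentSpace (𝓡 n) (M := M)) p).baseSet ↔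
      x ∈ (chartAt (EuclideanSpace ℝ (Fin n)) p).source := by
  simp

theorem exists_unit_coordForm {p x : M} (hx : x ∈ (chartAt (EuclideanSpace ℝ (Fin n)) p).source) :
    ∃ u : (ModelEndo (EuclideanSpace ℝ (Fin n)))ˣ, ∀ α : Form02 n x,
      coordForm p x α = pullForm (u : ModelEndo (EuclideanSpace ℝ (Fin n))) α := by
  obtain ⟨u, hu⟩ := isUnit_frameAt hx
  exact ⟨u, fun α ↦ by rw [hu]; rfl⟩

-- At a fixed point of M the passage to coordinates is a constant linear isomorphism, undone by
-- pulling back along u⁻¹.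
set_option synthInstance.maxHeartbeats 400000 in
theorem IsJointlySmoothOn.contDiffOn_apply {P : Type*} [NormedAddCommGroup P] [NormedSpace ℝ P]
    {S : Set P} {α : P → Field02 n M} (hα : IsJointlySmoothOn S α) (x : M) :
    ContDiffOn ℝ ∞ (fun p ↦ (α p x).toModel) S := by
  intro p hp
  have h1 := (contMDiffWithinAt_family_iff.1 (hα (p, x) ⟨hp, trivial⟩)).2
  have h2 : ContMDiffWithinAt 𝓘(ℝ, P) 𝓘(ℝ, ModelForm n) ∞ (fun p ↦ coordForm x x (α p x)) S p :=
    ContMDiffWithinAt.comp (t := S ×ˢ univ) p h1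
      (contMDiffWithinAt_id.prodMk contMDiffWithinAt_const) (fun q hq ↦ ⟨hq, trivial⟩)
  obtain ⟨u, hu⟩ := exists_unit_coordForm (n := n) (mem_chart_source _ x)
  have h3 := h2.contDiffWithinAt.pullForm (↑u⁻¹ : ModelEndo (EuclideanSpace ℝ (Fin n)))
  have h4 (q : P) : (α q x).toModel =
      pullForm (↑u⁻¹ : ModelEndo (EuclideanSpace ℝ (Fin n))) (coordForm x x (α q x)) := by
    rw [hu]
    exact (pullForm_inv_pullForm u _).symm
  exact h3.congr (fun q _ ↦ h4 q) (h4 p)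

end

end

/-! ### Mixed second derivatives on the strip [0,a] × (−ε,ε) -/

noncomputable section

section MixedPartial

variable {F : Type*} [NormedAddCommGroup F] [NormedSpace ℝ F] {a ε : ℝ} {A : ℝ × ℝ → F}

theorem uniqueDiffOn_strip (ha : 0 < a) : UniqueDiffOn ℝ (Icc 0 a ×ˢ Ioo (-ε) ε) :=
  (uniqueDiffOn_Icc ha).prod isOpen_Ioo.uniqueDiffOn

theorem hasDerivWithinAt_strip_fst {t s : ℝ}
    (hA : DifferentiableWithinAt ℝ A (Icc 0 a ×ˢ Ioo (-ε) ε) (t, s)) (hs : s ∈ Ioo (-ε) ε) :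
    HasDerivWithinAt (fun r ↦ A (r, s)) (fderivWithin ℝ A (Icc 0 a ×ˢ Ioo (-ε) ε) (t, s) (1, 0))
      (Icc 0 a) t :=
  HasFDerivWithinAt.comp_hasDerivWithinAt (f := fun r ↦ (r, s)) t hA.hasFDerivWithinAt
    ((hasDerivWithinAt_id t _).prodMk (hasDerivWithinAt_const t _ s)) (fun _ hr ↦ ⟨hr, hs⟩)

theorem hasDerivAt_strip_snd {t s : ℝ}
    (hA : DifferentiableWithinAt ℝ A (Icc 0 a ×ˢ Ioo (-ε) ε) (t, s)) (ht : t ∈ Icc 0 a)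
    (hs : s ∈ Ioo (-ε) ε) :
    HasDerivAt (fun r ↦ A (t, r)) (fderivWithin ℝ A (Icc 0 a ×ˢ Ioo (-ε) ε) (t, s) (0, 1)) s :=
  (HasFDerivWithinAt.comp_hasDerivWithinAt (f := fun r ↦ (t, r)) (s := Ioo (-ε) ε) s
    hA.hasFDerivWithinAt ((hasDerivWithinAt_const s _ t).prodMk (hasDerivWithinAt_id s _))
    (fun _ hr ↦ ⟨ht, hr⟩)).hasDerivAt (isOpen_Ioo.mem_nhds hs)

/-- The second derivative is symmetric even at the boundary point (0,0), which lies in the closure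
of the interior of the strip. This identifies J'(0) with the s-derivative of the initial velocities.
-/
theorem exists_mixed_deriv (hA : ContDiffOn ℝ ∞ A (Icc 0 a ×ˢ Ioo (-ε) ε)) (ha : 0 < a)
    (hε : 0 < ε) : ∃ X : F,
    HasDerivWithinAt (fun t ↦ fderivWithin ℝ A (Icc 0 a ×ˢ Ioo (-ε) ε) (t, 0) (0, 1)) X
      (Icc 0 a) 0 ∧
    HasDerivAt (fun s ↦ fderivWithin ℝ A (Icc 0 a ×ˢ Ioo (-ε) ε) (0, s) (1, 0)) X 0 := by
  have h0 : (0 : ℝ) ∈ Icc 0 a := ⟨le_rfl, ha.le⟩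
  have h0' : (0 : ℝ) ∈ Ioo (-ε) ε := ⟨by linarith, hε⟩
  have hm : ((0 : ℝ), (0 : ℝ)) ∈ Icc 0 a ×ˢ Ioo (-ε) ε := ⟨h0, h0'⟩
  have hu := uniqueDiffOn_strip (ε := ε) ha
  have hD : ContDiffOn ℝ ∞ (fderivWithin ℝ A (Icc 0 a ×ˢ Ioo (-ε) ε)) (Icc 0 a ×ˢ Ioo (-ε) ε) :=
    hA.fderivWithin hu (by simp)
  have hD0 := hD.differentiableOn (by simp) _ hm
  have hsymm : IsSymmSndFDerivWithinAt ℝ A (Icc 0 a ×ˢ Ioo (-ε) ε) (0, 0) := by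
    refine (hA _ hm).isSymmSndFDerivWithinAt
      (by
        rw [minSmoothness_of_isRCLikeNormedField]
        exact WithTop.coe_le_coe.2 (le_top : (2 : ℕ∞) ≤ ⊤)) hu ?_ hm
    rw [interior_prod_eq, interior_Icc, isOpen_Ioo.interior_eq, closure_prod_eq,
      closure_Ioo ha.ne]
    exact ⟨h0, subset_closure h0'⟩
  refine ⟨_, (hasDerivWithinAt_strip_fst hD0 h0').clm_apply (hasDerivWithinAt_const _ _ _), ?_⟩
  refine ((hasDerivAt_strip_snd hD0 h0 h0').clm_apply (hasDerivAt_const _ _)).congr_deriv ?_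
  simp only [map_zero, add_zero]
  exact hsymm (0, 1) (1, 0)

end MixedPartial

/-! ### Geodesic variations in a fibre -/

section GeodesicVariation

variable {V : Type*} [NormedAddCommGroup V] [NormedSpace ℝ V] [FiniteDimensional ℝ V]
  {W : Type*} [NormedAddCommGroup W] [NormedSpace ℝ W] {a : ℝ}

/-- A smooth curve of nondegenerate forms solving the geodesic equation is `closedForm`. -/
theorem eq_closedForm_of_geodesic (ha : 0 < a) {γ : ℝ → (V →L[ℝ] W)}
    (hγ : ContDiffOn ℝ ∞ γ (Icc 0 a))
    (hgeo : ∀ t ∈ Icc 0 a, derivWithin (fun τ ↦ derivWithin γ (Icc 0 a) τ) (Icc 0 a) t =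
      modelChristoffel (γ t) (derivWithin γ (Icc 0 a) t) (derivWithin γ (Icc 0 a) t))
    (hi : ∀ t ∈ Icc 0 a, (γ t).IsInvertible)
    (hy : 0 ≤ devSq (sharp (γ 0) (derivWithin γ (Icc 0 a) 0))) {t : ℝ} (ht : t ∈ Icc 0 a) :
    AngleDomain (trCLM V (sharp (γ 0) (derivWithin γ (Icc 0 a) 0)))
      (devSq (sharp (γ 0) (derivWithin γ (Icc 0 a) 0))) t ∧
    γ t = closedForm t (γ 0) (derivWithin γ (Icc 0 a) 0) ∧
    derivWithin γ (Icc 0 a) t =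
      (γ t).comp (velocity (sharp (γ 0) (derivWithin γ (Icc 0 a) 0)) t) := by
  have hu := uniqueDiffOn_Icc ha
  have h1 : ContDiffOn ℝ ∞ (derivWithin γ (Icc 0 a)) (Icc 0 a) := hγ.derivWithin hu (by simp)
  refine geodesic_eq_closedForm ha.le (γ1 := derivWithin γ (Icc 0 a))
    (fun t ht ↦ (hγ.differentiableOn (by simp) t ht).hasDerivWithinAt) (fun t ht ↦ ?_) hi hy ht
  exact hgeo t ht ▸ (h1.differentiableOn (by simp) t ht).hasDerivWithinAt

/-- The Jacobi field of a variation through geodesics is the derivative of `closedForm` along the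
initial data, which have derivatives `J(0)` and `J'(0)`. -/
theorem hasDerivAt_of_geodesicVariation {ε : ℝ} (ha : 0 < a) (hε : 0 < ε)
    {A : ℝ × ℝ → (V →L[ℝ] W)} (hA : ContDiffOn ℝ ∞ A (Icc 0 a ×ˢ Ioo (-ε) ε))
    (hgeo : ∀ s ∈ Ioo (-ε) ε, ∀ t ∈ Icc 0 a,
      derivWithin (fun τ ↦ derivWithin (fun r ↦ A (r, s)) (Icc 0 a) τ) (Icc 0 a) t =
        modelChristoffel (A (t, s)) (derivWithin (fun r ↦ A (r, s)) (Icc 0 a) t)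
          (derivWithin (fun r ↦ A (r, s)) (Icc 0 a) t))
    (hi : ∀ s ∈ Ioo (-ε) ε, ∀ t ∈ Icc 0 a, (A (t, s)).IsInvertible)
    (hy : ∀ s ∈ Ioo (-ε) ε,
      0 ≤ devSq (sharp (A (0, s)) (derivWithin (fun r ↦ A (r, s)) (Icc 0 a) 0)))
    {J : ℝ → (V →L[ℝ] W)} (hJ : ∀ t ∈ Icc 0 a, HasDerivAt (fun s ↦ A (t, s)) (J t) 0) :
    HasDerivAt (fun s ↦ A (0, s)) (J 0) 0 ∧
    HasDerivAt (fun s ↦ derivWithin (fun r ↦ A (r, s)) (Icc 0 a) 0)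
      (derivWithin J (Icc 0 a) 0) 0 ∧
    ∀ t ∈ Icc 0 a, HasDerivAt (fun s ↦ closedForm t (A (0, s))
      (derivWithin (fun r ↦ A (r, s)) (Icc 0 a) 0)) (J t) 0 := by
  have h0 : (0 : ℝ) ∈ Icc 0 a := ⟨le_rfl, ha.le⟩
  have h0' : (0 : ℝ) ∈ Ioo (-ε) ε := ⟨by linarith, hε⟩
  have hnhds : ∀ᶠ s in 𝓝 (0 : ℝ), s ∈ Ioo (-ε) ε := isOpen_Ioo.mem_nhds h0'
  have hu := uniqueDiffOn_Icc ha
  have hd {t s : ℝ} (ht : t ∈ Icc 0 a) (hs : s ∈ Ioo (-ε) ε) :=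
    hA.differentiableOn (by simp) (t, s) ⟨ht, hs⟩
  refine ⟨hJ 0 h0, ?_, fun t ht ↦ ?_⟩
  · obtain ⟨X, hX1, hX2⟩ := exists_mixed_deriv hA ha hε
    have e1 : derivWithin J (Icc 0 a) 0 = X := by
      refine (hX1.congr (fun t ht ↦ ?_) ?_).derivWithin (hu 0 h0)
      · exact (hJ t ht).unique (hasDerivAt_strip_snd (hd ht h0') ht h0')
      · exact (hJ 0 h0).unique (hasDerivAt_strip_snd (hd h0 h0') h0 h0')
    rw [e1]
    refine hX2.congr_of_eventuallyEq ?_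
    filter_upwards [hnhds] with s hs
    exact (hasDerivWithinAt_strip_fst (hd h0 hs) hs).derivWithin (hu 0 h0)
  · refine (hJ t ht).congr_of_eventuallyEq ?_
    filter_upwards [hnhds] with s hs
    refine ((eq_closedForm_of_geodesic ha (γ := fun r ↦ A (r, s)) ?_ (hgeo s hs) (hi s hs)
      (hy s hs) ht).2.1).symm
    exact hA.comp (contDiff_id.prodMk contDiff_const).contDiffOn fun r hr ↦ ⟨hr, hs⟩

end GeodesicVariation

end

/-! ### Tensors at a point of M as forms and endomorphisms of the model space -/

noncomputable section

theorem iterate_negAd {A : Type*} [NormedRing A] [NormedAlgebra ℝ A] (X B : A) (m : ℕ) :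
    (fun Y ↦ Y * X - X * Y)^[m] B = (negAd X ^ m) B := by
  induction m with
  | zero => rfl
  | succ m ih =>
    rw [Function.iterate_succ_apply', pow_succ', ih]
    rfl

section Pointwise

variable {n : ℕ} {M : Type*} [TopologicalSpace M] [ChartedSpace (EuclideanSpace ℝ (Fin n)) M]
  {x : M}

/-- A `(1,1)`-tensor at a point, as an endomorphism of the model space. -/
def Endo.toModel (A : Endo n x) : ModelEndo (EuclideanSpace ℝ (Fin n)) := A

theorem raise_toModel (g h : Form02 n x) : (raise g h).toModel = sharp g.toModel h.toModel := rfl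

theorem finrank_model : (Module.finrank ℝ (EuclideanSpace ℝ (Fin n)) : ℝ) = n := by
  rw [finrank_euclideanSpace_fin]

theorem traceless_toModel (A : Endo n x) :
    (traceless A).toModel = devCLM (EuclideanSpace ℝ (Fin n)) A.toModel := by
  rw [devCLM_apply, finrank_model]
  rfl

theorem christoffelAt_toModel (g h k : Form02 n x) :
    (christoffelAt g h k).toModel = modelChristoffel g.toModel h.toModel k.toModel := rfl

theorem tr_comp (A B : Endo n x) :
    tr (A.comp B) = trCLM (EuclideanSpace ℝ (Fin n)) (A.toModel * B.toModel) := rfl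

theorem devSq_toModel (A : Endo n x) :
    devSq A.toModel = n * tr ((traceless A).comp (traceless A)) := by
  rw [tr_comp, traceless_toModel, devSq, finrank_model]

theorem bFun_eq_angleFun {H : Endo n x} {t : ℝ} (ht : 0 ≤ t)
    (hd : AngleDomain (tr H) (devSq H.toModel) t) :
    bFun H t = angleFun (tr H) (devSq H.toModel) t := by
  have hq := devSq_toModel H
  rw [bFun]
  rcases hd with hd | ⟨hd, hpos⟩
  · have h0 : tr ((traceless H).comp (traceless H)) ≠ 0 := fun h ↦ by
      rw [h, mul_zero] at hq
      exact hd.ne' hq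
    rw [angleFun_of_pos hd, Complex.log_im, ← hq, if_pos h0,
      arctanBranch_eq_arg (Real.sqrt_pos.2 hd) ht]
  -- From n tr(H₀²) = 0 the factor n can be cancelled unless n = 0, where every endomorphism is 0.
  · have h0 : tr ((traceless H).comp (traceless H)) = 0 := by
      rcases Nat.eq_zero_or_pos n with rfl | hn
      · rw [tr_comp]
        have := subsingleton_of_finrank_eq_zero
          (finrank_euclideanSpace_fin (𝕜 := ℝ) (n := 0))
        rw [Subsingleton.elim ((traceless H).toModel * (traceless H).toModel) 0, map_zero]
      · rw [hd] at hq
        have hn' : (n : ℝ) ≠ 0 := by positivity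
        exact (mul_eq_zero.1 hq.symm).resolve_left hn'
    rw [hd, angleFun_of_zero hpos]
    simp only [h0, ne_eq, not_true_eq_false, if_false]
    have h1 : 1 + t / 4 * tr H = (4 + t * tr H) / 4 := by ring
    rw [h1]
    field_simp

theorem exp_aFun (hn : n ≠ 0) {H : Endo n x} {t : ℝ}
    (hv : 0 < volRatio (tr H) (devSq H.toModel) t) :
    Real.exp (-(1 / 2) * n * aFun H t) = (volRatio (tr H) (devSq H.toModel) t)⁻¹ := by
  have h1 : (1 + t / 4 * tr H) ^ 2 + n / 16 * tr ((traceless H).comp (traceless H)) * t ^ 2 =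
      volRatio (tr H) (devSq H.toModel) t := by
    rw [volRatio, devSq_toModel]
    ring
  have hn' : (n : ℝ) ≠ 0 := by exact_mod_cast hn
  have h2 : -(1 / 2) * n * aFun H t = -Real.log (volRatio (tr H) (devSq H.toModel) t) := by
    rw [aFun, h1]
    field_simp
  rw [h2, Real.exp_neg, Real.exp_log hv]

theorem adTerm_toModel (A B : Endo n x) (m : ℕ) :
    (adTerm A B m).toModel = (Nat.factorial (m + 1) : ℝ)⁻¹ • (negAd A.toModel ^ m) B.toModel := by
  have h : (fun X ↦ -adAction A X) = fun Y : Endo n x ↦ Y.comp A - A.comp Y :=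
    funext fun X ↦ neg_sub _ _
  rw [← iterate_negAd, adTerm, h]
  rfl

theorem summable_adTerm (A B : Endo n x) : Summable fun m : ℕ ↦ adTerm A B (m + 1) := by
  have h := (summable_nat_add_iff 1).2 (summable_negAd A.toModel B.toModel)
  exact h.congr fun m ↦ (adTerm_toModel A B (m + 1)).symm

theorem tsum_adTerm (A B : Endo n x) :
    Endo.toModel (∑' m : ℕ, adTerm A B (m + 1)) = commSeries A.toModel B.toModel := by
  exact tsum_congr (fun m ↦ adTerm_toModel A B (m + 1))

theorem isPerp_iff {H P N : Endo n x} {t : ℝ} (hq : 0 < devSq H.toModel)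
    (hP : P.toModel = velocity H.toModel t) :
    IsPerp H P t N ↔ N.toModel = perpEndo H.toModel t := by
  have hn : n ≠ 0 := by
    rintro rfl
    simp [devSq] at hq
  have hv : 0 < volRatio (tr H) (devSq H.toModel) t := volRatio_pos (Or.inl hq)
  have hspan (hmem : N.toModel ∈ Submodule.span ℝ
      {(1 : ModelEndo (EuclideanSpace ℝ (Fin n))), devCLM _ H.toModel}) :
      tr N = Real.exp (-(1 / 2) * n * aFun H t) ∧ tr (P.comp N) = 0 ↔
        N.toModel = perpEndo H.toModel t := by
    rw [exp_aFun hn hv, tr_comp, hP]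
    exact eq_perpEndo_iff hq hmem
  constructor
  · rintro ⟨h1, h2, h3⟩
    rw [← hspan]
    · exact ⟨h2, h3⟩
    · rw [← traceless_toModel]
      exact h1
  · intro h
    have hmem := perpEndo_mem_span H.toModel t
    rw [← h] at hmem
    obtain ⟨h2, h3⟩ := (hspan hmem).2 h
    refine ⟨?_, h2, h3⟩
    rw [← traceless_toModel] at hmem
    exact hmem

end Pointwise

end

/-! ### Geodesics and Jacobi fields evaluated at a point of M -/

noncomputable section

set_option synthInstance.maxHeartbeats 400000

section SymmetricCurve

variable {V : Type*} [NormedAddCommGroup V] [NormedSpace ℝ V]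
  {W : Type*} [NormedAddCommGroup W] [NormedSpace ℝ W]

/-- With e and f the evaluations at w and v, symmetry of the metrics passes to their time
derivative. The default value 0 of a missing derivative satisfies the identity as well. -/
theorem derivWithin_apply_eq {S : Set ℝ} {t : ℝ} {γ : ℝ → (V →L[ℝ] W)} {v w : V} {e f : W →L[ℝ] ℝ}
    (hγ : ∀ t ∈ S, e (γ t v) = f (γ t w)) (ht : t ∈ S) :
    e (derivWithin γ S t v) = f (derivWithin γ S t w) := by
  by_cases hd : DifferentiableWithinAt ℝ γ S t
  · by_cases hu : UniqueDiffWithinAt ℝ S t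
    · have h (v : V) (e : W →L[ℝ] ℝ) :
          HasDerivWithinAt (fun t ↦ e (γ t v)) (e (derivWithin γ S t v)) S t :=
        e.hasFDerivAt.comp_hasDerivWithinAt t
          ((ContinuousLinearMap.apply ℝ W v).hasFDerivAt.comp_hasDerivWithinAt t
            hd.hasDerivWithinAt)
      exact hu.eq_deriv _ (h v e) ((h w f).congr hγ (hγ t ht))
    · rw [derivWithin_zero_of_not_uniqueDiffWithinAt hu]
      simp
  · rw [derivWithin_zero_of_not_differentiableWithinAt hd]
    simp

end SymmetricCurve

section Metric

variable {n : ℕ} {M : Type*} [TopologicalSpace M] [ChartedSpace (EuclideanSpace ℝ (Fin n)) M]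
  [IsManifold (𝓡 n) ∞ M] {a : ℝ}

theorem IsMetric.isInvertible {g : Field02 n M} (hg : IsMetric g) (x : M) :
    (g x).toModel.IsInvertible :=
  isInvertible_of_pos (hg.pos x)

theorem IsMetric.isSelfAdj {g : Field02 n M} (hg : IsMetric g) {x : M} {h : Form02 n x}
    (hh : ∀ v w, h v w = h w v) : IsSelfAdj (g x).toModel (raise (g x) h).toModel :=
  isSelfAdj_sharp (hg.isInvertible x) (hg.symm x) hh

theorem IsMetric.devSq_nonneg {g : Field02 n M} (hg : IsMetric g) {x : M} {h : Form02 n x}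
    (hh : ∀ v w, h v w = h w v) : 0 ≤ devSq (raise (g x) h).toModel :=
  _root_.devSq_nonneg (hg.pos x) (hg.symm x) (hg.isSelfAdj hh)

/-- H₀ is self-adjoint for g, so tr(H₀²) vanishes only with H₀: the alternative H₀ ≠ 0 or H₀ = 0 is
the alternative y > 0 or y = 0. -/
theorem IsMetric.devSq_pos {g : Field02 n M} (hg : IsMetric g) {x : M} {h : Form02 n x}
    (hh : ∀ v w, h v w = h w v) (h0 : traceless (raise (g x) h) ≠ 0) :
    0 < devSq (raise (g x) h).toModel := by
  have h0' : devCLM _ (raise (g x) h).toModel ≠ 0 := by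
    rw [← traceless_toModel]
    exact h0
  have hn : (0 : ℝ) < Module.finrank ℝ (EuclideanSpace ℝ (Fin n)) := by
    rw [Nat.cast_pos, Nat.pos_iff_ne_zero]
    intro hn
    have := subsingleton_of_finrank_eq_zero hn
    exact h0' (Subsingleton.elim _ _)
  exact mul_pos hn (trCLM_sq_pos (hg.pos x) (hg.symm x) (hg.isSelfAdj hh).dev h0')

set_option linter.unusedSectionVars false in
theorem timeDeriv_toModel (V : ℝ → Field02 n M) (t : ℝ) (x : M) :
    (timeDeriv a V t x).toModel = derivWithin (fun τ ↦ (V τ x).toModel) (Icc 0 a) t := rfl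

theorem IsSmoothFamilyOfMetrics.timeDeriv_symm {g : ℝ → Field02 n M}
    (hg : IsSmoothFamilyOfMetrics (Icc 0 a) g) {t : ℝ} (ht : t ∈ Icc 0 a) (x : M)
    (v w : TangentSpace (𝓡 n) x) : timeDeriv a g t x v w = timeDeriv a g t x w v :=
  derivWithin_apply_eq (V := EuclideanSpace ℝ (Fin n)) (W := EuclideanSpace ℝ (Fin n) →L[ℝ] ℝ)
    (γ := fun τ ↦ (g τ x).toModel) (v := v) (w := w)
    (e := ContinuousLinearMap.apply ℝ ℝ (show EuclideanSpace ℝ (Fin n) from w))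
    (f := ContinuousLinearMap.apply ℝ ℝ (show EuclideanSpace ℝ (Fin n) from v))
    (fun t ht ↦ (hg.metric t ht).symm x v w) ht

theorem IsGeodesic.geodesic_toModel {g : ℝ → Field02 n M} (hg : IsGeodesic a g) {t : ℝ}
    (ht : t ∈ Icc 0 a) (x : M) :
    derivWithin (fun τ ↦ derivWithin (fun r ↦ (g r x).toModel) (Icc 0 a) τ) (Icc 0 a) t =
      modelChristoffel (g t x).toModel (derivWithin (fun r ↦ (g r x).toModel) (Icc 0 a) t)
        (derivWithin (fun r ↦ (g r x).toModel) (Icc 0 a) t) :=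
  sub_eq_zero.1 (congrArg Form02.toModel (congrFun (hg.geodesic t ht) x))

theorem IsGeodesic.eq_closedForm (ha : 0 < a) {g : ℝ → Field02 n M} (hg : IsGeodesic a g) {t : ℝ}
    (ht : t ∈ Icc 0 a) (x : M) {H : Endo n x} (hH : H = raise (g 0 x) (timeDeriv a g 0 x)) :
    AngleDomain (tr H) (devSq H.toModel) t ∧
    (g t x).toModel = closedForm t (g 0 x).toModel (timeDeriv a g 0 x).toModel ∧
    (timeDeriv a g t x).toModel = (g t x).toModel.comp (velocity H.toModel t) := by
  have h0 : (0 : ℝ) ∈ Icc 0 a := ⟨le_rfl, ha.le⟩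
  subst hH
  exact eq_closedForm_of_geodesic ha (γ := fun r ↦ (g r x).toModel)
    (hg.smooth.smooth.contDiffOn_apply x) (fun t ht ↦ hg.geodesic_toModel ht x)
    (fun t ht ↦ (hg.smooth.metric t ht).isInvertible x)
    ((hg.smooth.metric 0 h0).devSq_nonneg (hg.smooth.timeDeriv_symm h0 x)) ht

theorem IsGeodesicVariation.hasDerivAt_toModel {ε : ℝ} (ha : 0 < a) (hε : 0 < ε)
    {g J : ℝ → Field02 n M} {α : ℝ × ℝ → Field02 n M} (hα : IsGeodesicVariation a ε g α) {x : M}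
    (hJ : ∀ t ∈ Icc 0 a, HasDerivAt (fun s ↦ (α (t, s) x).toModel) (J t x).toModel 0) :
    HasDerivAt (fun s ↦ (α (0, s) x).toModel) (J 0 x).toModel 0 ∧
    HasDerivAt (fun s ↦ (timeDeriv a (fun r ↦ α (r, s)) 0 x).toModel)
      (timeDeriv a J 0 x).toModel 0 ∧
    ∀ t ∈ Icc 0 a, HasDerivAt (fun s ↦ closedForm t (α (0, s) x).toModel
      (timeDeriv a (fun r ↦ α (r, s)) 0 x).toModel) (J t x).toModel 0 := by
  have h0 : (0 : ℝ) ∈ Icc 0 a := ⟨le_rfl, ha.le⟩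
  exact hasDerivAt_of_geodesicVariation ha hε (A := fun p ↦ (α p x).toModel)
    (hα.smooth.smooth.contDiffOn_apply x)
    (fun s hs t ht ↦ (hα.geodesic s hs).geodesic_toModel ht x)
    (fun s hs t ht ↦ (hα.smooth.metric (t, s) ⟨ht, hs⟩).isInvertible x)
    (fun s hs ↦ (hα.smooth.metric (0, s) ⟨h0, hs⟩).devSq_nonneg
      ((hα.geodesic s hs).smooth.timeDeriv_symm h0 x))
    (J := fun t ↦ (J t x).toModel) hJ

/-- At each point the variation matters only through the derivatives at s = 0 of its initial metric
and initial velocity, and these are J(0) and J'(0). -/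
theorem IsJacobiField.exists_initial (ha : 0 < a) {g J : ℝ → Field02 n M}
    (hJ : IsJacobiField a g J) (x : M) :
    ∃ G Hh : ℝ → ModelForm n, G 0 = (g 0 x).toModel ∧ Hh 0 = (timeDeriv a g 0 x).toModel ∧
      HasDerivAt G (J 0 x).toModel 0 ∧ HasDerivAt Hh (timeDeriv a J 0 x).toModel 0 ∧
      ∀ t ∈ Icc 0 a, HasDerivAt (fun s ↦ closedForm t (G s) (Hh s)) (J t x).toModel 0 := by
  obtain ⟨ε, hε, α, hα, hαJ⟩ := hJ
  have h0 : (0 : ℝ) ∈ Icc 0 a := ⟨le_rfl, ha.le⟩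
  obtain ⟨h1, h2, h3⟩ := hα.hasDerivAt_toModel ha hε fun t ht ↦ hαJ t ht x
  refine ⟨_, _, ?_, ?_, h1, h2, h3⟩
  · rw [hα.base 0 h0]
  · rw [timeDeriv_toModel, timeDeriv_toModel]
    have hb : ∀ t ∈ Icc 0 a, (fun r ↦ (α (r, 0) x).toModel) t = (fun r ↦ (g r x).toModel) t :=
      fun t ht ↦ congrArg (fun f : Field02 n M ↦ (f x).toModel) (hα.base t ht)
    exact derivWithin_congr hb (hb 0 h0)

end Metric

end

/-! ### The formula for Jacobi fields -/

noncomputable section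

set_option synthInstance.maxHeartbeats 400000

/-- The left side is L̂ and the right side is the derivative of g⁻¹h along the variation. They agree
because j' = l + Γ(h,k) and Γ is symmetric. -/
theorem sharp_initial_eq {V W : Type*} [NormedAddCommGroup V] [NormedSpace ℝ V]
    [FiniteDimensional ℝ V] [NormedAddCommGroup W] [NormedSpace ℝ W] {g h k l j' : V →L[ℝ] W}
    (hj : j' - modelChristoffel g h k = l) :
    -(sharp g k * sharp g h) + sharp g l + sharp g (modelChristoffel g k h) =
      sharp g (j' - k.comp (sharp g h)) := by
  rw [sub_eq_iff_eq_add.1 hj, sharp_sub, sharp_add, modelChristoffel_comm g h k, sharp_comp_mul]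
  abel

variable {n : ℕ} {M : Type*} [TopologicalSpace M] [ChartedSpace (EuclideanSpace ℝ (Fin n)) M]
  [IsManifold (𝓡 n) ∞ M] {a : ℝ}

set_option linter.unusedSectionVars false in
theorem lhat_toModel {x : M} (g h k l j' : Form02 n x) (hj : j' - christoffelAt g h k = l) :
    Endo.toModel (-((raise g k).comp (raise g h)) + raise g l + raise g (christoffelAt g k h)) =
      sharp g.toModel (j'.toModel - k.toModel.comp (raise g h).toModel) :=
  sharp_initial_eq (g := g.toModel) (h := h.toModel) (k := k.toModel) (l := l.toModel)
    (j' := j'.toModel) (congrArg Form02.toModel hj)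

theorem IsJacobiField.formula (ha : 0 < a) {g J : ℝ → Field02 n M} {l : Field02 n M}
    (hg : IsGeodesic a g) (hJ : IsJacobiField a g J) (hJl : covDeriv a g J 0 = l)
    {t : ℝ} (ht : t ∈ Icc 0 a) (x : M) :
    let H : Endo n x := raise (g 0 x) (timeDeriv a g 0 x)
    let Lhat : Endo n x := -((raise (g 0 x) (J 0 x)).comp H) + raise (g 0 x) (l x)
      + raise (g 0 x) (christoffelAt (g 0 x) (J 0 x) (timeDeriv a g 0 x))
    (0 < devSq H.toModel → ∀ N : Endo n x, IsPerp H (raise (g t x) (timeDeriv a g t x)) t N →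
        J t x = (tr (H.comp Lhat) / tr (H.comp H)) • t • timeDeriv a g t x
          + ((tr Lhat * tr (H.comp H) - tr (Lhat.comp H) * tr H) / tr (H.comp H)) •
              t • (g t x).comp N
          + bFun H t • (g t x).comp
            (-(tr ((traceless H).comp (traceless Lhat)) / tr ((traceless H).comp (traceless H))) •
              traceless H + traceless Lhat)
          + (g t x).comp (∑' m : ℕ, adTerm (bFun H t • H) (bFun H t • Lhat) (m + 1))
          + (J 0 x).comp (raise (g 0 x) (g t x))) ∧
    (traceless H = 0 →
      J t x = bFun H t • (g t x).comp Lhat + (J 0 x).comp (raise (g 0 x) (g t x))) := by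
  intro H Lhat
  have h0 : (0 : ℝ) ∈ Icc 0 a := ⟨le_rfl, ha.le⟩
  obtain ⟨G, Hh, hG0, hH0, hG, hHh, hc⟩ := hJ.exists_initial ha x
  have hL : Lhat.toModel = sharp (G 0) ((timeDeriv a J 0 x).toModel
      - (J 0 x).toModel.comp H.toModel) := by
    rw [hG0]
    exact lhat_toModel _ _ _ _ _ (congrFun hJl x)
  have hH : H.toModel = sharp (G 0) (Hh 0) := by
    rw [hG0, hH0]
    rfl
  have hi : (G 0).IsInvertible := by
    rw [hG0]
    exact (hg.smooth.metric 0 h0).isInvertible x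
  obtain ⟨hd, hgt, hgt'⟩ := hg.eq_closedForm ha ht x (H := H) rfl
  have hit : (g t x).toModel.IsInvertible := (hg.smooth.metric t ht).isInvertible x
  have hb : angleFun (tr H) (devSq H.toModel) t = bFun H t := (bFun_eq_angleFun ht.1 hd).symm
  have hb' : angleFun (trCLM _ H.toModel) (devSq H.toModel) t = bFun H t := hb
  have hct : closedForm t (G 0) (Hh 0) = (g t x).toModel := by rw [hgt, hG0, hH0]
  -- The flow endomorphism is (g⁰)⁻¹g(t), which gives the last term of the formula its form.
  have hflow : flowEndo H.toModel t = (raise (g 0 x) (g t x)).toModel := by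
    have h1 : (raise (g 0 x) (g t x)).toModel = sharp (G 0) (closedForm t (G 0) (Hh 0)) := by
      rw [hct, hG0]
      rfl
    rw [h1, closedForm, sharp_comp hi, hH]
  constructor
  · intro hq N hN
    have hP : (raise (g t x) (timeDeriv a g t x)).toModel = velocity H.toModel t := by
      rw [raise_toModel, hgt', sharp_comp hit]
    have hN' := (isPerp_iff hq hP).1 hN
    have key := (hc t ht).unique (hasDerivAt_closedForm_of_devSq_pos hG hHh hi hH hL hq)
    rw [hct, ← hgt', ← hN', hb', hflow, ← traceless_toModel, ← traceless_toModel] at key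
    have hS := tsum_adTerm (bFun H t • H) (bFun H t • Lhat)
    change _ = commSeries (bFun H t • H.toModel) (bFun H t • Lhat.toModel) at hS
    rw [← hS] at key
    exact key
  · intro h0
    have h0' : devCLM _ H.toModel = 0 := by
      rw [← traceless_toModel]
      exact h0
    have key := (hc t ht).unique (hasDerivAt_closedForm_of_dev_eq_zero hG hHh hi hH hL hd h0')
    rw [hct, hb', hflow] at key
    exact key

end

/-! ### Smooth tensor fields and tangency of the Christoffel symbol -/

noncomputable section

set_option synthInstance.maxHeartbeats 400000

section ModelForms

theorem modelChristoffel_zero_left {V W : Type*} [NormedAddCommGroup V] [NormedSpace ℝ V]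
    [FiniteDimensional ℝ V] [NormedAddCommGroup W] [NormedSpace ℝ W] (g k : V →L[ℝ] W) :
    modelChristoffel g 0 k = 0 := by
  simp [modelChristoffel, sharp_zero]

variable {V : Type*} [NormedAddCommGroup V] [NormedSpace ℝ V] [FiniteDimensional ℝ V]

theorem modelChristoffel_symm {g h k : V →L[ℝ] V →L[ℝ] ℝ} (hg : g.IsInvertible)
    (gs : ∀ v w, g v w = g w v) (hs : ∀ v w, h v w = h w v) (ks : ∀ v w, k v w = k w v) (v w : V) :
    modelChristoffel g h k v w = modelChristoffel g h k w v := by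
  have e1 (v) : g (sharp g h v) = h v := DFunLike.congr_fun (comp_sharp hg h) v
  have e2 (v) : g (sharp g k v) = k v := DFunLike.congr_fun (comp_sharp hg k) v
  -- The forms hg⁻¹k and kg⁻¹h are transposes of each other, so their sum is symmetric.
  have key (v w : V) : h (sharp g k v) w = k (sharp g h w) v := by
    rw [hs, ← e1, gs, e2, ks]
  have expand (v w : V) : modelChristoffel g h k v w =
      1 / 2 * h (sharp g k v) w + 1 / 2 * k (sharp g h v) w
        + 1 / 4 * trCLM V (sharp g h * sharp g k) * g v w
        - 1 / 4 * trCLM V (sharp g h) * k v w - 1 / 4 * trCLM V (sharp g k) * h v w := rfl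
  rw [expand, expand, key v w, key w v, gs v w, hs v w, ks v w]
  ring

/-- Positivity on the compact unit sphere is an open condition, and homogeneity extends it to all
nonzero vectors. -/
theorem eventually_pos {g : V →L[ℝ] V →L[ℝ] ℝ} (gpos : ∀ v, v ≠ 0 → 0 < g v v) :
    ∀ᶠ β in 𝓝 g, ∀ v, v ≠ 0 → 0 < β v v := by
  have hcont : Continuous fun p : (V →L[ℝ] V →L[ℝ] ℝ) × V ↦ p.1 p.2 p.2 := by
    have h1 : Continuous fun p : (V →L[ℝ] V →L[ℝ] ℝ) × V ↦ p.1 p.2 :=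
      isBoundedBilinearMap_apply.continuous
    exact h1.clm_apply continuous_snd
  have h1 : ∀ᶠ β in 𝓝 g, ∀ v ∈ Metric.sphere (0 : V) 1, 0 < β v v := by
    refine (isCompact_sphere (0 : V) 1).eventually_forall_of_forall_eventually fun v hv ↦ ?_
    refine hcont.continuousAt.eventually (lt_mem_nhds (gpos v ?_))
    rintro rfl
    simp at hv
  filter_upwards [h1] with β hβ v hv
  have hn : 0 < ‖v‖ := norm_pos_iff.2 hv
  have h2 := hβ (‖v‖⁻¹ • v) (by simp [norm_smul, hn.ne'])
  rw [map_smul, map_smul, smul_apply, smul_eq_mul, smul_eq_mul] at h2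
  have h3 := inv_pos.2 hn
  exact pos_of_mul_pos_right (pos_of_mul_pos_right h2 h3.le) h3.le

end ModelForms

section SmoothFields

variable {n : ℕ} {M : Type*} [TopologicalSpace M] [ChartedSpace (EuclideanSpace ℝ (Fin n)) M]
  [IsManifold (𝓡 n) ∞ M] {a : ℝ}

theorem isSmoothField_iff {h : Field02 n M} : IsSmoothField h ↔ ∀ x₀ : M,
    ContMDiffAt (𝓡 n) 𝓘(ℝ, ModelForm n) ∞ (fun x ↦ coordForm x₀ x (h x)) x₀ := by
  refine forall_congr' fun x₀ ↦ ?_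
  rw [← contMDiffWithinAt_univ, ← contMDiffWithinAt_univ, contMDiffWithinAt_family_iff]
  exact and_iff_right contMDiffWithinAt_id

theorem isJointlySmoothOn_iff {P : Type*} [NormedAddCommGroup P] [NormedSpace ℝ P] {S : Set P}
    {α : P → Field02 n M} : IsJointlySmoothOn S α ↔ ∀ p₀ ∈ S, ∀ x₀ : M,
    ContMDiffWithinAt (𝓘(ℝ, P).prod (𝓡 n)) 𝓘(ℝ, ModelForm n) ∞
      (fun q : P × M ↦ coordForm x₀ q.2 (α q.1 q.2)) (S ×ˢ univ) (p₀, x₀) := by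
  constructor
  · intro h p₀ hp₀ x₀
    exact (contMDiffWithinAt_family_iff.1 (h (p₀, x₀) ⟨hp₀, trivial⟩)).2
  · rintro h ⟨p₀, x₀⟩ ⟨hp₀, -⟩
    exact contMDiffWithinAt_family_iff.2 ⟨contMDiffWithinAt_snd, h p₀ hp₀ x₀⟩

theorem coordForm_add_smul {p x : M} (α β : Form02 n x) (c : ℝ) :
    coordForm p x (α + c • β) = coordForm p x α + c • coordForm p x β := rfl

set_option linter.unusedSectionVars false in
theorem eventually_mem_chart (x₀ : M) :
    ∀ᶠ x in 𝓝 x₀, x ∈ (chartAt (EuclideanSpace ℝ (Fin n)) x₀).source :=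
  (chartAt _ x₀).open_source.mem_nhds (mem_chart_source _ x₀)

/-- A form on the model space, as a `(0,2)`-tensor at a point. -/
def formOfModel (x : M) (α : ModelForm n) : Form02 n x := α

theorem coordForm_closedForm {p x : M} (hx : x ∈ (chartAt (EuclideanSpace ℝ (Fin n)) p).source)
    {g : Form02 n x} (hg : g.toModel.IsInvertible) (h : Form02 n x) (t : ℝ) :
    coordForm p x (formOfModel x (closedForm t g.toModel h.toModel)) =
      closedForm t (coordForm p x g) (coordForm p x h) := by
  obtain ⟨u, hu⟩ := exists_unit_coordForm hx
  rw [hu, hu, hu]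
  exact (closedForm_pullForm u hg _ t).symm

theorem coordForm_christoffelAt {p x : M}
    (hx : x ∈ (chartAt (EuclideanSpace ℝ (Fin n)) p).source)
    {g : Form02 n x} (hg : g.toModel.IsInvertible) (h k : Form02 n x) :
    coordForm p x (christoffelAt g h k) =
      modelChristoffel (coordForm p x g) (coordForm p x h) (coordForm p x k) := by
  obtain ⟨u, hu⟩ := exists_unit_coordForm hx
  rw [hu, hu, hu, hu]
  exact (modelChristoffel_pullForm u hg _ _).symm

theorem isInvertible_coordForm {p x : M} (hx : x ∈ (chartAt (EuclideanSpace ℝ (Fin n)) p).source)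
    {g : Form02 n x} (hg : g.toModel.IsInvertible) : (coordForm p x g).IsInvertible := by
  obtain ⟨u, hu⟩ := exists_unit_coordForm hx
  rw [hu]
  exact isInvertible_pullForm u hg

theorem IsSmoothField.christoffel {g h k : Field02 n M} (hg : IsMetric g) (hh : IsSmoothField h)
    (hk : IsSmoothField k) : IsSmoothField (christoffel g h k) := by
  have hgs := isSmoothField_iff.1 hg.smooth
  rw [isSmoothField_iff] at hh hk ⊢
  intro x₀
  have h1 := ContMDiffWithinAt.modelChristoffel (contMDiffWithinAt_univ.2 (hgs x₀))
    (contMDiffWithinAt_univ.2 (hh x₀)) (contMDiffWithinAt_univ.2 (hk x₀))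
    (isInvertible_coordForm (mem_chart_source _ x₀) (hg.isInvertible x₀))
  refine (contMDiffWithinAt_univ.1 h1).congr_of_eventuallyEq ?_
  filter_upwards [eventually_mem_chart (n := n) x₀] with x hx
  exact coordForm_christoffelAt hx (hg.isInvertible x) _ _

theorem IsSmoothField.add {h k : Field02 n M} (hh : IsSmoothField h) (hk : IsSmoothField k) :
    IsSmoothField (h + k) := by
  rw [isSmoothField_iff] at hh hk ⊢
  exact fun x₀ ↦ (hh x₀).add (hk x₀)

theorem isTangent_of_support_subset {h k : Field02 n M} (hk : IsTangent k) (hh : IsSmoothField h)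
    (hs : ∀ x v w, h x v w = h x w v) (h0 : ∀ x, k x = 0 → h x = 0) : IsTangent h :=
  ⟨hh, hs, hk.compact_support.of_isClosed_subset isClosed_closure
    (closure_mono fun x hx hkx ↦ hx (h0 x hkx))⟩

set_option linter.unusedSectionVars false in
theorem toModel_zero {x : M} : (0 : Form02 n x).toModel = 0 := rfl

theorem IsTangent.christoffel {g h k : Field02 n M} (hg : IsMetric g) (hh : IsTangent h)
    (hk : IsTangent k) : IsTangent (christoffel g h k) := by
  refine isTangent_of_support_subset hh (hh.smooth.christoffel hg hk.smooth) (fun x v w ↦ ?_)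
    fun x hx ↦ ?_
  · exact modelChristoffel_symm (hg.isInvertible x) (hg.symm x) (hh.symm x) (hk.symm x) v w
  · have h1 : (h x).toModel = 0 := (congrArg Form02.toModel hx).trans toModel_zero
    have h2 : (christoffelAt (g x) (h x) (k x)).toModel = 0 := by
      rw [christoffelAt_toModel, h1, modelChristoffel_zero_left]
    exact h2

theorem IsTangent.add {h k : Field02 n M} (hh : IsTangent h) (hk : IsTangent k) :
    IsTangent (h + k) := by
  refine ⟨hh.smooth.add hk.smooth, fun x v w ↦ ?_, ?_⟩
  · change h x v w + k x v w = h x w v + k x w v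
    rw [hh.symm, hk.symm]
  · refine (hh.compact_support.union hk.compact_support).of_isClosed_subset isClosed_closure ?_
    rw [← closure_union]
    refine closure_mono fun x hx ↦ ?_
    by_contra hcon
    rw [mem_union, not_or] at hcon
    refine hx ?_
    rw [Pi.add_apply, not_not.1 hcon.1, not_not.1 hcon.2]
    exact ContinuousLinearMap.ext fun v ↦ ContinuousLinearMap.ext fun w ↦ add_zero (0 : ℝ)

theorem IsJointlySmoothOn.isSmoothField {P : Type*} [NormedAddCommGroup P] [NormedSpace ℝ P]
    {S : Set P} {α : P → Field02 n M} (hα : IsJointlySmoothOn S α) {p : P} (hp : p ∈ S) :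
    IsSmoothField (α p) := by
  rw [isJointlySmoothOn_iff] at hα
  rw [isSmoothField_iff]
  intro x₀
  refine contMDiffWithinAt_univ.1 (ContMDiffWithinAt.comp (t := S ×ˢ univ) x₀ (hα p hp x₀)
    (contMDiffWithinAt_const.prodMk contMDiffWithinAt_id) fun x _ ↦ ⟨hp, trivial⟩)

theorem IsJointlySmoothOn.slice {S : Set ℝ} {T : Set ℝ} {α : ℝ × ℝ → Field02 n M}
    (hα : IsJointlySmoothOn (S ×ˢ T) α) {s : ℝ} (hs : s ∈ T) :
    IsJointlySmoothOn S (fun t ↦ α (t, s)) := by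
  rw [isJointlySmoothOn_iff] at hα ⊢
  intro t ht x₀
  have h1 : ContMDiff (𝓘(ℝ, ℝ).prod (𝓡 n)) (𝓘(ℝ, ℝ × ℝ).prod (𝓡 n)) ∞
      (fun q : ℝ × M ↦ ((q.1, s), q.2)) :=
    (contMDiff_fst.prodMk_space contMDiff_const).prodMk contMDiff_snd
  exact ContMDiffWithinAt.comp (t := (S ×ˢ T) ×ˢ univ) (t, x₀) (hα (t, s) ⟨ht, hs⟩ x₀)
    h1.contMDiffAt.contMDiffWithinAt fun (q : ℝ × M) (hq : q ∈ S ×ˢ univ) ↦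
      ⟨⟨hq.1, hs⟩, trivial⟩

end SmoothFields

end

/-! ### Validity of the closed formula for perturbed initial data -/

noncomputable section

set_option synthInstance.maxHeartbeats 400000

section Domain

/-- For y ≥ 0, which holds for symmetric tensors, membership in the domain becomes a disjunction of
strict inequalities, hence stable under perturbation. -/
theorem angleDomain_iff {τ y t : ℝ} (hy : 0 ≤ y) : AngleDomain τ y t ↔ 0 < y ∨ 0 < 4 + t * τ := by
  rcases hy.eq_or_lt with rfl | h
  · simp [AngleDomain]
  · simp [AngleDomain, h]

theorem eventually_angle_pos {V W Z : Type*} [NormedAddCommGroup V] [NormedSpace ℝ V]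
    [FiniteDimensional ℝ V] [NormedAddCommGroup W] [NormedSpace ℝ W] [TopologicalSpace Z] {z₀ : Z}
    {B D : Z → (V →L[ℝ] W)} {T : Z → ℝ} (hB : ContinuousAt B z₀) (hD : ContinuousAt D z₀)
    (hT : ContinuousAt T z₀) (hi : (B z₀).IsInvertible)
    (h0 : 0 < devSq (sharp (B z₀) (D z₀)) ∨ 0 < 4 + T z₀ * trCLM V (sharp (B z₀) (D z₀))) :
    ∀ᶠ z in 𝓝 z₀, 0 < devSq (sharp (B z) (D z)) ∨ 0 < 4 + T z * trCLM V (sharp (B z) (D z)) := by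
  have hs : ContinuousAt (fun z ↦ sharp (B z) (D z)) z₀ :=
    ContinuousAt.comp (x := z₀) (f := fun z ↦ (B z, D z))
      (g := fun p : (V →L[ℝ] W) × (V →L[ℝ] W) ↦ sharp p.1 p.2)
      (contDiffAt_sharp hi (D z₀)).continuousAt (hB.prodMk hD)
  have h1 : ContinuousAt (fun z ↦ devSq (sharp (B z) (D z))) z₀ :=
    contDiff_devSq.continuous.continuousAt.comp hs
  have h2 : ContinuousAt (fun z ↦ 4 + T z * trCLM V (sharp (B z) (D z))) z₀ :=
    continuousAt_const.add (hT.mul ((trCLM V).continuous.continuousAt.comp hs))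
  rcases h0 with h0 | h0
  · exact (h1.eventually (lt_mem_nhds h0)).mono fun z hz ↦ Or.inl hz
  · exact (h2.eventually (lt_mem_nhds h0)).mono fun z hz ↦ Or.inr hz

theorem ContinuousAt.add_smul_form {V W Z : Type*} [NormedAddCommGroup V] [NormedSpace ℝ V]
    [NormedAddCommGroup W] [NormedSpace ℝ W] [TopologicalSpace Z] {z₀ : Z}
    {B D : Z → (V →L[ℝ] W)} {T : Z → ℝ} (hB : ContinuousAt B z₀) (hD : ContinuousAt D z₀)
    (hT : ContinuousAt T z₀) : ContinuousAt (fun z ↦ B z + T z • D z) z₀ :=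
  hB.add (hT.smul hD)

theorem pos_of_pullForm {V : Type*} [NormedAddCommGroup V] [NormedSpace ℝ V]
    (u : (ModelEndo V)ˣ) {g : V →L[ℝ] V →L[ℝ] ℝ}
    (h : ∀ v, v ≠ 0 → 0 < pullForm (u : ModelEndo V) g v v) (v : V) (hv : v ≠ 0) : 0 < g v v := by
  have h1 (w : V) : (u : ModelEndo V) ((↑u⁻¹ : ModelEndo V) w) = w := DFunLike.congr_fun u.mul_inv w
  have h2 := h ((↑u⁻¹ : ModelEndo V) v) fun h0 ↦ hv (by rw [← h1 v, h0, map_zero])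
  rwa [pullForm_apply, h1] at h2

theorem pullForm_pos {V : Type*} [NormedAddCommGroup V] [NormedSpace ℝ V]
    (u : (ModelEndo V)ˣ) {g : V →L[ℝ] V →L[ℝ] ℝ}
    (h : ∀ v, v ≠ 0 → 0 < g v v) (v : V) (hv : v ≠ 0) : 0 < pullForm (u : ModelEndo V) g v v := by
  rw [pullForm_apply]
  refine h _ fun h0 ↦ hv ?_
  have h1 : (↑u⁻¹ : ModelEndo V) ((u : ModelEndo V) v) = v := DFunLike.congr_fun u.inv_mul v
  rw [← h1, h0, map_zero]

end Domain

section Variation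

variable {n : ℕ} {M : Type*} [TopologicalSpace M] [ChartedSpace (EuclideanSpace ℝ (Fin n)) M]
  [IsManifold (𝓡 n) ∞ M] {a : ℝ} {g₀ h k m : Field02 n M}

theorem coordForm_pos_iff {p x : M} (hx : x ∈ (chartAt (EuclideanSpace ℝ (Fin n)) p).source)
    (g : Form02 n x) : (∀ v, v ≠ 0 → 0 < coordForm p x g v v) ↔ ∀ v, v ≠ 0 → 0 < g v v := by
  obtain ⟨u, hu⟩ := exists_unit_coordForm hx
  rw [hu]
  exact ⟨pos_of_pullForm u (g := g.toModel), pullForm_pos u (g := g.toModel)⟩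

theorem devSq_coordForm {p x : M} (hx : x ∈ (chartAt (EuclideanSpace ℝ (Fin n)) p).source)
    {g : Form02 n x} (hg : g.toModel.IsInvertible) (h : Form02 n x) :
    devSq (sharp (coordForm p x g) (coordForm p x h)) = devSq (raise g h).toModel := by
  obtain ⟨u, hu⟩ := exists_unit_coordForm hx
  rw [hu, hu]
  exact devSq_sharp_pullForm u hg h.toModel

theorem trCLM_coordForm {p x : M} (hx : x ∈ (chartAt (EuclideanSpace ℝ (Fin n)) p).source)
    {g : Form02 n x} (hg : g.toModel.IsInvertible) (h : Form02 n x) :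
    trCLM _ (sharp (coordForm p x g) (coordForm p x h)) = tr (raise g h) := by
  obtain ⟨u, hu⟩ := exists_unit_coordForm hx
  rw [hu, hu]
  exact trCLM_sharp_pullForm u hg h.toModel

theorem IsSmoothField.continuousAt_coordForm (hh : IsSmoothField h) (x₀ : M) :
    ContinuousAt (fun x ↦ coordForm x₀ x (h x)) x₀ :=
  (isSmoothField_iff.1 hh x₀).continuousAt

theorem IsSmoothField.continuousAt_coordForm_add_smul (hh : IsSmoothField h)
    (hk : IsSmoothField k) (t : ℝ) (x₀ : M) :
    ContinuousAt (fun z : ℝ × (ℝ × M) ↦ coordForm x₀ z.2.2 (h z.2.2 + z.1 • k z.2.2))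
      (0, (t, x₀)) := by
  have hx : ContinuousAt (fun z : ℝ × (ℝ × M) ↦ z.2.2) (0, (t, x₀)) := by fun_prop
  have hcont (b : Field02 n M) (hb : IsSmoothField b) :
      ContinuousAt (fun z : ℝ × (ℝ × M) ↦ coordForm x₀ z.2.2 (b z.2.2)) (0, (t, x₀)) :=
    ContinuousAt.comp (g := fun x ↦ coordForm x₀ x (b x)) (hb.continuousAt_coordForm x₀) hx
  have h1 := ContinuousAt.add_smul_form (T := fun z : ℝ × (ℝ × M) ↦ z.1) (hcont h hh) (hcont k hk)
    continuousAt_fst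
  have h2 : (fun z : ℝ × (ℝ × M) ↦ coordForm x₀ z.2.2 (h z.2.2 + z.1 • k z.2.2)) = fun z ↦
      coordForm x₀ z.2.2 (h z.2.2) + z.1 • coordForm x₀ z.2.2 (k z.2.2) :=
    funext fun z ↦ coordForm_add_smul _ _ _
  rw [h2]
  exact h1

/-- Both conditions are open and hold at s = 0. Compactness of [0,a] × C, with C the union of the
three supports, gives a common ε; off C nothing depends on s. -/
theorem exists_pos_and_angleDomain (hg₀ : IsMetric g₀) (hh : IsTangent h) (hk : IsTangent k)
    (hm : IsTangent m)
    (hdom : ∀ t ∈ Icc 0 a, ∀ x, AngleDomain (tr (raise (g₀ x) (h x)))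
      (devSq (raise (g₀ x) (h x)).toModel) t) :
    ∃ ε : ℝ, 0 < ε ∧ ∀ s ∈ Ioo (-ε) ε, ∀ t ∈ Icc 0 a, ∀ x,
      (∀ v, v ≠ 0 → 0 < (g₀ x + s • k x) v v) ∧
      AngleDomain (tr (raise (g₀ x + s • k x) (h x + s • m x)))
        (devSq (raise (g₀ x + s • k x) (h x + s • m x)).toModel) t := by
  have hsymm (b c : Field02 n M) (hb : ∀ x v w, b x v w = b x w v)
      (hc : ∀ x v w, c x v w = c x w v) (s : ℝ) (x) (v w) :
      (b x + s • c x) v w = (b x + s • c x) w v := by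
    change b x v w + s * c x v w = b x w v + s * c x w v
    rw [hb, hc]
  have hnn (s : ℝ) (x : M) (hp : ∀ v, v ≠ 0 → 0 < (g₀ x + s • k x) v v) :
      0 ≤ devSq (raise (g₀ x + s • k x) (h x + s • m x)).toModel :=
    devSq_nonneg hp (hsymm g₀ k hg₀.symm hk.symm s x)
      (isSelfAdj_sharp (isInvertible_of_pos hp) (hsymm g₀ k hg₀.symm hk.symm s x)
        (hsymm h m hh.symm hm.symm s x))
  set Q : ℝ → ℝ × M → Prop := fun s p ↦
    (∀ v, v ≠ 0 → 0 < (g₀ p.2 + s • k p.2) v v) ∧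
      (0 < devSq (raise (g₀ p.2 + s • k p.2) (h p.2 + s • m p.2)).toModel ∨
        0 < 4 + p.1 * tr (raise (g₀ p.2 + s • k p.2) (h p.2 + s • m p.2))) with hQ
  have hzero (b c : Field02 n M) (x : M) : b x + (0 : ℝ) • c x = b x := by
    refine ContinuousLinearMap.ext fun v ↦ ContinuousLinearMap.ext fun w ↦ ?_
    change b x v w + 0 * c x v w = b x v w
    ring
  have hQ0 (t : ℝ) (ht : t ∈ Icc 0 a) (x : M) : Q 0 (t, x) := by
    simp only [hQ, hzero]
    exact ⟨hg₀.pos x, (angleDomain_iff (hg₀.devSq_nonneg (hh.symm x))).1 (hdom t ht x)⟩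
  -- Openness is checked in the chart around x₀; positivity, τ and y do not depend on the frame.
  have hev (t : ℝ) (ht : t ∈ Icc 0 a) (x₀ : M) :
      ∀ᶠ z : ℝ × (ℝ × M) in 𝓝 (0, (t, x₀)), Q z.1 z.2 := by
    have hx : ContinuousAt (fun z : ℝ × (ℝ × M) ↦ z.2.2) (0, (t, x₀)) := by fun_prop
    have hB := hg₀.smooth.continuousAt_coordForm_add_smul hk.smooth t x₀
    have hD := hh.smooth.continuousAt_coordForm_add_smul hm.smooth t x₀
    obtain ⟨hp0, ha0⟩ := hQ0 t ht x₀
    have hx₀ := mem_chart_source (EuclideanSpace ℝ (Fin n)) x₀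
    have hi0 : (g₀ x₀ + (0 : ℝ) • k x₀).toModel.IsInvertible := isInvertible_of_pos hp0
    have hpu := (coordForm_pos_iff hx₀ (g₀ x₀ + (0 : ℝ) • k x₀)).2 hp0
    have hau : 0 < devSq (sharp (coordForm x₀ x₀ (g₀ x₀ + (0 : ℝ) • k x₀))
          (coordForm x₀ x₀ (h x₀ + (0 : ℝ) • m x₀))) ∨
        0 < 4 + t * trCLM _ (sharp (coordForm x₀ x₀ (g₀ x₀ + (0 : ℝ) • k x₀))
          (coordForm x₀ x₀ (h x₀ + (0 : ℝ) • m x₀))) := by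
      rw [devSq_coordForm hx₀ hi0, trCLM_coordForm hx₀ hi0]
      exact ha0
    have e1 := hB.eventually (eventually_pos hpu)
    have e2 := eventually_angle_pos (T := fun z : ℝ × (ℝ × M) ↦ z.2.1) hB hD (by fun_prop)
      (isInvertible_of_pos hpu) hau
    filter_upwards [e1, e2, hx.eventually (eventually_mem_chart (n := n) x₀)] with z h1 h2 h3
    have hp := (coordForm_pos_iff h3 _).1 h1
    have hi : (g₀ z.2.2 + z.1 • k z.2.2).toModel.IsInvertible := isInvertible_of_pos hp
    rw [devSq_coordForm h3 hi, trCLM_coordForm h3 hi] at h2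
    exact ⟨hp, h2⟩
  set C : Set M := (closure {x | h x ≠ 0} ∪ closure {x | k x ≠ 0}) ∪ closure {x | m x ≠ 0} with hC
  have hCc : IsCompact C :=
    (hh.compact_support.union hk.compact_support).union hm.compact_support
  have hK : IsCompact (Icc 0 a ×ˢ C) := isCompact_Icc.prod hCc
  have hmain : ∀ᶠ s in 𝓝 (0 : ℝ), ∀ p ∈ Icc 0 a ×ˢ C, Q s p :=
    hK.eventually_forall_of_forall_eventually fun p hp ↦ hev p.1 hp.1 p.2
  obtain ⟨ε, hε, hball⟩ := Metric.eventually_nhds_iff_ball.1 hmain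
  refine ⟨ε, hε, fun s hs t ht x ↦ ?_⟩
  have hs' : s ∈ Metric.ball (0 : ℝ) ε := by
    rw [Metric.mem_ball, dist_zero_right, Real.norm_eq_abs, abs_lt]
    exact hs
  have key : Q s (t, x) := by
    by_cases hx : x ∈ C
    · exact hball s hs' (t, x) ⟨ht, hx⟩
    · simp only [hC, mem_union, not_or] at hx
      have z1 : h x = 0 := by
        by_contra h0
        exact hx.1.1 (subset_closure h0)
      have z2 : k x = 0 := by
        by_contra h0
        exact hx.1.2 (subset_closure h0)
      have z3 : m x = 0 := by
        by_contra h0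
        exact hx.2 (subset_closure h0)
      have := hQ0 t ht x
      have zz (r : ℝ) : r • (0 : Form02 n x) = 0 :=
        ContinuousLinearMap.ext fun v ↦ ContinuousLinearMap.ext fun w ↦ mul_zero r
      simp only [hQ, z1, z2, z3, zz] at this ⊢
      exact this
  exact ⟨key.1, (angleDomain_iff (hnn s x key.1)).2 key.2⟩

end Variation

end

/-! ### The explicit variation through geodesics -/

noncomputable section

set_option synthInstance.maxHeartbeats 400000

section ClosedFormGeodesic

variable {V : Type*} [NormedAddCommGroup V] [NormedSpace ℝ V] [FiniteDimensional ℝ V]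
  {W : Type*} [NormedAddCommGroup W] [NormedSpace ℝ W] {a : ℝ} {g h : V →L[ℝ] W}

theorem derivWithin_closedForm (ha : 0 < a)
    (hd : ∀ t ∈ Icc 0 a, AngleDomain (trCLM V (sharp g h)) (devSq (sharp g h)) t) {t : ℝ}
    (ht : t ∈ Icc 0 a) : derivWithin (fun t ↦ closedForm t g h) (Icc 0 a) t =
      (closedForm t g h).comp (velocity (sharp g h) t) :=
  (hasDerivAt_closedForm (hd t ht)).hasDerivWithinAt.derivWithin (uniqueDiffOn_Icc ha t ht)

theorem derivWithin_derivWithin_closedForm (ha : 0 < a) (hg : g.IsInvertible)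
    (hd : ∀ t ∈ Icc 0 a, AngleDomain (trCLM V (sharp g h)) (devSq (sharp g h)) t) {t : ℝ}
    (ht : t ∈ Icc 0 a) :
    derivWithin (fun τ ↦ derivWithin (fun t ↦ closedForm t g h) (Icc 0 a) τ) (Icc 0 a) t =
      modelChristoffel (closedForm t g h) (derivWithin (fun t ↦ closedForm t g h) (Icc 0 a) t)
        (derivWithin (fun t ↦ closedForm t g h) (Icc 0 a) t) := by
  rw [derivWithin_closedForm ha hd ht]
  refine ((hasDerivAt_closedForm_velocity hg (hd t ht)).hasDerivWithinAt.congr (fun τ hτ ↦ ?_)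
    ?_).derivWithin (uniqueDiffOn_Icc ha t ht)
  · exact derivWithin_closedForm ha hd hτ
  · exact derivWithin_closedForm ha hd ht

set_option linter.unusedSectionVars false in
theorem eq_of_hasDerivAt_of_eventuallyEq_add_smul {f : ℝ → (V →L[ℝ] W)} {f' : V →L[ℝ] W}
    (hf : HasDerivAt f f' 0) (he : ∀ᶠ s in 𝓝 0, f s = g + s • h) : f' = h := by
  have h1 : HasDerivAt (fun s : ℝ ↦ g + s • h) h 0 := by
    simpa using ((hasDerivAt_id (0 : ℝ)).smul_const h).const_add g
  exact hf.unique (h1.congr_of_eventuallyEq he)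

end ClosedFormGeodesic

section Variation

variable {n : ℕ} {M : Type*} [TopologicalSpace M] [ChartedSpace (EuclideanSpace ℝ (Fin n)) M]
  [IsManifold (𝓡 n) ∞ M] {a ε : ℝ} {g₀ h k m : Field02 n M}

/-- The variation through geodesics with initial data `g₀ + s k` and `h + s m`. -/
def geodesicVariation (g₀ h k m : Field02 n M) (p : ℝ × ℝ) : Field02 n M := fun x ↦
  formOfModel x (closedForm p.1 (g₀ x + p.2 • k x).toModel (h x + p.2 • m x).toModel)

set_option linter.unusedSectionVars false in
theorem add_smul_symm {x : M} {b c : Form02 n x} (hb : ∀ v w, b v w = b w v)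
    (hc : ∀ v w, c v w = c w v) (s : ℝ) (v w : TangentSpace (𝓡 n) x) :
    (b + s • c) v w = (b + s • c) w v := by
  change b v w + s * c v w = b w v + s * c w v
  rw [hb, hc]

theorem ContMDiffWithinAt.add_smul_form {V W B H N : Type*} [NormedAddCommGroup V]
    [NormedSpace ℝ V] [NormedAddCommGroup W] [NormedSpace ℝ W] [NormedAddCommGroup B]
    [NormedSpace ℝ B] [TopologicalSpace H] {I : ModelWithCorners ℝ B H} [TopologicalSpace N]
    [ChartedSpace H N] {S : Set N} {q : N} {b c : N → (V →L[ℝ] W)} {τ : N → ℝ}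
    (hb : ContMDiffWithinAt I 𝓘(ℝ, V →L[ℝ] W) ∞ b S q)
    (hc : ContMDiffWithinAt I 𝓘(ℝ, V →L[ℝ] W) ∞ c S q)
    (hτ : ContMDiffWithinAt I 𝓘(ℝ, ℝ) ∞ τ S q) :
    ContMDiffWithinAt I 𝓘(ℝ, V →L[ℝ] W) ∞ (fun z ↦ b z + τ z • c z) S q :=
  hb.add (hτ.smul hc)

theorem IsSmoothField.contMDiffWithinAt_coordForm_add_smul (hh : IsSmoothField h)
    (hk : IsSmoothField k) (S : Set ((ℝ × ℝ) × M)) (p : ℝ × ℝ) (x₀ : M) :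
    ContMDiffWithinAt (𝓘(ℝ, ℝ × ℝ).prod (𝓡 n)) 𝓘(ℝ, ModelForm n) ∞
      (fun q : (ℝ × ℝ) × M ↦ coordForm x₀ q.2 (h q.2 + q.1.2 • k q.2)) S (p, x₀) := by
  have hcont (b : Field02 n M) (hb : IsSmoothField b) :
      ContMDiffWithinAt (𝓘(ℝ, ℝ × ℝ).prod (𝓡 n)) 𝓘(ℝ, ModelForm n) ∞
        (fun q : (ℝ × ℝ) × M ↦ coordForm x₀ q.2 (b q.2)) S (p, x₀) :=
    ContMDiffAt.comp_contMDiffWithinAt (g := fun x ↦ coordForm x₀ x (b x)) (p, x₀)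
      (isSmoothField_iff.1 hb x₀) contMDiffWithinAt_snd
  have hs : ContMDiffWithinAt (𝓘(ℝ, ℝ × ℝ).prod (𝓡 n)) 𝓘(ℝ, ℝ) ∞
      (fun q : (ℝ × ℝ) × M ↦ q.1.2) S (p, x₀) :=
    ContMDiffAt.comp_contMDiffWithinAt (g := fun q : ℝ × ℝ ↦ q.2) (p, x₀)
      contDiff_snd.contMDiff.contMDiffAt contMDiffWithinAt_fst
  have h2 : (fun q : (ℝ × ℝ) × M ↦ coordForm x₀ q.2 (h q.2 + q.1.2 • k q.2)) = fun q ↦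
      coordForm x₀ q.2 (h q.2) + q.1.2 • coordForm x₀ q.2 (k q.2) :=
    funext fun z ↦ coordForm_add_smul _ _ _
  rw [h2]
  exact (hcont h hh).add_smul_form (hcont k hk) hs

theorem isJointlySmoothOn_geodesicVariation (hg₀ : IsMetric g₀) (hh : IsTangent h)
    (hk : IsTangent k) (hm : IsTangent m)
    (hpos : ∀ s ∈ Ioo (-ε) ε, ∀ t ∈ Icc 0 a, ∀ x,
      (∀ v, v ≠ 0 → 0 < (g₀ x + s • k x) v v) ∧
      AngleDomain (tr (raise (g₀ x + s • k x) (h x + s • m x)))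
        (devSq (raise (g₀ x + s • k x) (h x + s • m x)).toModel) t) :
    IsJointlySmoothOn (Icc 0 a ×ˢ Ioo (-ε) ε) (geodesicVariation g₀ h k m) := by
  rw [isJointlySmoothOn_iff]
  rintro ⟨t, s⟩ ⟨ht, hs⟩ x₀
  have hinv (s : ℝ) (hs : s ∈ Ioo (-ε) ε) (x : M) : (g₀ x + s • k x).toModel.IsInvertible :=
    isInvertible_of_pos (hpos s hs t ht x).1
  have hx₀ := mem_chart_source (EuclideanSpace ℝ (Fin n)) x₀
  have hτ : ContMDiffWithinAt (𝓘(ℝ, ℝ × ℝ).prod (𝓡 n)) 𝓘(ℝ, ℝ) ∞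
      (fun q : (ℝ × ℝ) × M ↦ q.1.1) ((Icc 0 a ×ˢ Ioo (-ε) ε) ×ˢ univ) ((t, s), x₀) :=
    ContMDiffAt.comp_contMDiffWithinAt (g := fun q : ℝ × ℝ ↦ q.1) ((t, s), x₀)
      contDiff_fst.contMDiff.contMDiffAt contMDiffWithinAt_fst
  have h1 := ContMDiffWithinAt.closedForm hτ
    (hg₀.smooth.contMDiffWithinAt_coordForm_add_smul hk.smooth _ _ x₀)
    (hh.smooth.contMDiffWithinAt_coordForm_add_smul hm.smooth _ _ x₀)
    (isInvertible_coordForm hx₀ (hinv s hs x₀)) (by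
      rw [devSq_coordForm hx₀ (hinv s hs x₀), trCLM_coordForm hx₀ (hinv s hs x₀)]
      exact (hpos s hs t ht x₀).2)
  have hev : ∀ᶠ q : (ℝ × ℝ) × M in 𝓝[(Icc 0 a ×ˢ Ioo (-ε) ε) ×ˢ univ] ((t, s), x₀),
      coordForm x₀ q.2 (geodesicVariation g₀ h k m q.1 q.2) =
        closedForm q.1.1 (coordForm x₀ q.2 (g₀ q.2 + q.1.2 • k q.2))
          (coordForm x₀ q.2 (h q.2 + q.1.2 • m q.2)) := by
    have h2 : ∀ᶠ q : (ℝ × ℝ) × M in 𝓝[(Icc 0 a ×ˢ Ioo (-ε) ε) ×ˢ univ] ((t, s), x₀),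
        q.2 ∈ (chartAt (EuclideanSpace ℝ (Fin n)) x₀).source :=
      continuousWithinAt_snd.eventually (eventually_mem_chart (n := n) x₀)
    filter_upwards [h2, self_mem_nhdsWithin] with q hq hq'
    exact coordForm_closedForm hq (hinv q.1.2 hq'.1.2 q.2) _ _
  refine h1.congr_of_eventuallyEq hev ?_
  exact coordForm_closedForm hx₀ (hinv s hs x₀) _ _

end Variation

end

/-! ### Existence of Jacobi fields -/

noncomputable section

set_option synthInstance.maxHeartbeats 400000

section Existence

variable {n : ℕ} {M : Type*} [TopologicalSpace M] [ChartedSpace (EuclideanSpace ℝ (Fin n)) M]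
  [IsManifold (𝓡 n) ∞ M] {a ε : ℝ} {g₀ h k m : Field02 n M}

theorem IsSmoothFamilyOfMetrics.slice {S T : Set ℝ} {α : ℝ × ℝ → Field02 n M}
    (hα : IsSmoothFamilyOfMetrics (S ×ˢ T) α) {s : ℝ} (hs : s ∈ T) :
    IsSmoothFamilyOfMetrics S (fun t ↦ α (t, s)) := by
  refine ⟨fun t ht ↦ hα.metric (t, s) ⟨ht, hs⟩, hα.smooth.slice hs, fun t ht ↦ ?_⟩
  obtain ⟨C, hC, hev⟩ := hα.locally_compact_variation (t, s) ⟨ht, hs⟩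
  refine ⟨C, hC, ?_⟩
  have h1 : Tendsto (fun r : ℝ ↦ (r, s)) (𝓝[S] t) (𝓝[S ×ˢ T] (t, s)) := by
    refine tendsto_nhdsWithin_iff.2 ⟨?_, ?_⟩
    · exact (Continuous.prodMk_left s).continuousAt.continuousWithinAt
    · filter_upwards [self_mem_nhdsWithin] with r hr using ⟨hr, hs⟩
  exact h1.eventually hev

/-- Where the three data vanish the geodesics are constant, so the variation moves only inside the
union of the compact supports. -/
theorem geodesicVariation_eq_of_zero {x : M} (hh : h x = 0) (hk : k x = 0) (hm : m x = 0)
    (p : ℝ × ℝ) : geodesicVariation g₀ h k m p x = g₀ x := by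
  have hz (r : ℝ) : (0 + r • 0 : Form02 n x) = 0 :=
    ContinuousLinearMap.ext fun v ↦ ContinuousLinearMap.ext fun w ↦ by
      change 0 + r * 0 = (0 : ℝ)
      ring
  have hz' (r : ℝ) : (g₀ x + r • 0 : Form02 n x) = g₀ x :=
    ContinuousLinearMap.ext fun v ↦ ContinuousLinearMap.ext fun w ↦ by
      change g₀ x v w + r * 0 = g₀ x v w
      ring
  rw [geodesicVariation, hh, hk, hm, hz, hz', toModel_zero, closedForm_of_zero]
  rfl

theorem isSmoothFamilyOfMetrics_geodesicVariation (hg₀ : IsMetric g₀) (hh : IsTangent h)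
    (hk : IsTangent k) (hm : IsTangent m)
    (hpos : ∀ s ∈ Ioo (-ε) ε, ∀ t ∈ Icc 0 a, ∀ x,
      (∀ v, v ≠ 0 → 0 < (g₀ x + s • k x) v v) ∧
      AngleDomain (tr (raise (g₀ x + s • k x) (h x + s • m x)))
        (devSq (raise (g₀ x + s • k x) (h x + s • m x)).toModel) t) :
    IsSmoothFamilyOfMetrics (Icc 0 a ×ˢ Ioo (-ε) ε) (geodesicVariation g₀ h k m) := by
  have hsm := isJointlySmoothOn_geodesicVariation hg₀ hh hk hm hpos
  refine ⟨?_, hsm, ?_⟩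
  · rintro ⟨t, s⟩ ⟨ht, hs⟩
    have hp := fun x ↦ (hpos s hs t ht x).1
    have s1 (x) := add_smul_symm (hg₀.symm x) (hk.symm x) s
    have s2 (x) := add_smul_symm (hh.symm x) (hm.symm x) s
    exact ⟨hsm.isSmoothField ⟨ht, hs⟩,
      fun x ↦ closedForm_symm (g := (g₀ x + s • k x).toModel) (h := (h x + s • m x).toModel)
        (isInvertible_of_pos (hp x)) (s1 x) (s2 x) t,
      fun x ↦ closedForm_pos (g := (g₀ x + s • k x).toModel) (h := (h x + s • m x).toModel)
        (hp x) (s1 x) (s2 x) t⟩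
  · intro p hp
    refine ⟨(closure {x | h x ≠ 0} ∪ closure {x | k x ≠ 0}) ∪ closure {x | m x ≠ 0},
      (hh.compact_support.union hk.compact_support).union hm.compact_support,
      Eventually.of_forall fun q x hx ↦ ?_⟩
    simp only [mem_union, not_or] at hx
    have z1 : h x = 0 := by
      by_contra h0
      exact hx.1.1 (subset_closure h0)
    have z2 : k x = 0 := by
      by_contra h0
      exact hx.1.2 (subset_closure h0)
    have z3 : m x = 0 := by
      by_contra h0
      exact hx.2 (subset_closure h0)
    rw [geodesicVariation_eq_of_zero z1 z2 z3, geodesicVariation_eq_of_zero z1 z2 z3]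

theorem isGeodesicVariation_geodesicVariation (ha : 0 < a) {g : ℝ → Field02 n M}
    (hg : IsGeodesic a g) (hk : IsTangent k) (hm : IsTangent m)
    (hh : IsTangent (timeDeriv a g 0))
    (hpos : ∀ s ∈ Ioo (-ε) ε, ∀ t ∈ Icc 0 a, ∀ x,
      (∀ v, v ≠ 0 → 0 < (g 0 x + s • k x) v v) ∧
      AngleDomain (tr (raise (g 0 x + s • k x) (timeDeriv a g 0 x + s • m x)))
        (devSq (raise (g 0 x + s • k x) (timeDeriv a g 0 x + s • m x)).toModel) t) :
    IsGeodesicVariation a ε g (geodesicVariation (g 0) (timeDeriv a g 0) k m) := by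
  have h0 : (0 : ℝ) ∈ Icc 0 a := ⟨le_rfl, ha.le⟩
  have hsm := isSmoothFamilyOfMetrics_geodesicVariation (hg.smooth.metric 0 h0) hh hk hm hpos
  refine ⟨hsm, fun s hs ↦ ⟨hsm.slice hs, fun t ht ↦ ?_⟩, fun t ht ↦ funext fun x ↦ ?_⟩
  · funext x
    have h1 := derivWithin_derivWithin_closedForm ha (isInvertible_of_pos (hpos s hs t ht x).1)
      (fun t ht ↦ (hpos s hs t ht x).2) ht
    exact sub_eq_zero.2 h1
  · have hz (b c : Field02 n M) : b x + (0 : ℝ) • c x = b x :=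
      ContinuousLinearMap.ext fun v ↦ ContinuousLinearMap.ext fun w ↦ by
        change b x v w + 0 * c x v w = b x v w
        ring
    rw [geodesicVariation, hz, hz]
    -- Uniqueness identifies the member s = 0 of the variation with the given geodesic.
    exact ((hg.eq_closedForm ha ht x rfl).2.1).symm

theorem IsGeodesicVariation.exists_variationField {g : ℝ → Field02 n M} {α : ℝ × ℝ → Field02 n M}
    (hα : IsGeodesicVariation a ε g α) (hε : 0 < ε) : ∃ J : ℝ → Field02 n M,
      ∀ t ∈ Icc 0 a, ∀ x, HasDerivAt (fun s ↦ (α (t, s) x).toModel) (J t x).toModel 0 := by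
  have h0' : (0 : ℝ) ∈ Ioo (-ε) ε := ⟨by linarith, hε⟩
  refine ⟨fun t x ↦ formOfModel x
    (fderivWithin ℝ (fun p ↦ (α p x).toModel) (Icc 0 a ×ˢ Ioo (-ε) ε) (t, 0) (0, 1)),
    fun t ht x ↦ ?_⟩
  exact hasDerivAt_strip_snd (A := fun p ↦ (α p x).toModel)
    ((hα.smooth.smooth.contDiffOn_apply x).differentiableOn (by simp) (t, 0) ⟨ht, h0'⟩) ht h0'

theorem exists_isJacobiField (ha : 0 < a) {g : ℝ → Field02 n M} {l : Field02 n M}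
    (hg : IsGeodesic a g) (hh : IsTangent (timeDeriv a g 0)) (hk : IsTangent k)
    (hl : IsTangent l) :
    ∃ J : ℝ → Field02 n M, IsJacobiField a g J ∧ J 0 = k ∧ covDeriv a g J 0 = l := by
  have h0 : (0 : ℝ) ∈ Icc 0 a := ⟨le_rfl, ha.le⟩
  have hg₀ := hg.smooth.metric 0 h0
  -- The covariant derivative at 0 is J'(0) − Γ(h,k), so J'(0) has to be ℓ + Γ(h,k).
  have hm : IsTangent (l + christoffel (g 0) (timeDeriv a g 0) k) :=
    hl.add (hh.christoffel hg₀ hk)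
  set m := l + christoffel (g 0) (timeDeriv a g 0) k with hmdef
  obtain ⟨ε, hε, hpos⟩ := exists_pos_and_angleDomain hg₀ hh hk hm
    (fun t ht x ↦ (hg.eq_closedForm ha ht x rfl).1)
  have hα := isGeodesicVariation_geodesicVariation ha hg hk hm hh hpos
  have h0' : (0 : ℝ) ∈ Ioo (-ε) ε := ⟨by linarith, hε⟩
  obtain ⟨J, hJ⟩ := hα.exists_variationField hε
  have hJ0 : J 0 = k := by
    funext x
    suffices h : (J 0 x).toModel = (k x).toModel from h
    exact eq_of_hasDerivAt_of_eventuallyEq_add_smul (g := (g 0 x).toModel) (hJ 0 h0 x)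
      (Eventually.of_forall fun s ↦ closedForm_zero _ _)
  refine ⟨J, ⟨ε, hε, _, hα, hJ⟩, hJ0, ?_⟩
  have hJ1 : timeDeriv a J 0 = m := by
    funext x
    suffices h : (timeDeriv a J 0 x).toModel = (m x).toModel from h
    refine eq_of_hasDerivAt_of_eventuallyEq_add_smul (g := (timeDeriv a g 0 x).toModel)
      (hα.hasDerivAt_toModel ha hε fun t ht ↦ hJ t ht x).2.1 ?_
    filter_upwards [isOpen_Ioo.mem_nhds h0'] with s hs
    have h1 := derivWithin_closedForm (g := (g 0 x + s • k x).toModel)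
      (h := (timeDeriv a g 0 x + s • m x).toModel) ha (fun t ht ↦ (hpos s hs t ht x).2) h0
    have h2 := comp_sharp (isInvertible_of_pos (hpos s hs 0 h0 x).1)
      (timeDeriv a g 0 x + s • m x).toModel
    rw [closedForm_zero, velocity_zero] at h1
    exact h1.trans h2
  rw [covDeriv, hJ1, hJ0, hmdef]
  exact add_sub_cancel_right l _

end Existence

end

/-! ### First variation of the trace pairing -/

noncomputable section

set_option synthInstance.maxHeartbeats 400000

section TracePairing

variable {V : Type*} [NormedAddCommGroup V] [NormedSpace ℝ V] [FiniteDimensional ℝ V]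
  {W : Type*} [NormedAddCommGroup W] [NormedSpace ℝ W]

/-- The inner product `tr(g⁻¹ k g⁻¹ l)` of two forms. -/
def tracePairing (g k l : V →L[ℝ] W) : ℝ := trCLM V (sharp g k * sharp g l)

/-- The derivative of `tracePairing g k l` times the volume density in the direction `h`, divided by
the volume density. -/
def tracePairingDeriv (g h k l : V →L[ℝ] W) : ℝ :=
  -trCLM V (sharp g h * sharp g k * sharp g l) - trCLM V (sharp g k * sharp g h * sharp g l)
    + 1 / 2 * trCLM V (sharp g h) * trCLM V (sharp g k * sharp g l)

set_option linter.unusedSectionVars false in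
theorem hasDerivAt_add_smul_const (g h : V →L[ℝ] W) (s : ℝ) :
    HasDerivAt (fun r : ℝ ↦ g + r • h) h s := by
  simpa using ((hasDerivAt_id s).smul_const h).const_add g

theorem hasDerivAt_tracePairing {g h : V →L[ℝ] W} (k l : V →L[ℝ] W) {s : ℝ}
    (hi : (g + s • h).IsInvertible) :
    HasDerivAt (fun r : ℝ ↦ tracePairing (g + r • h) k l)
      (-trCLM V (sharp (g + s • h) h * sharp (g + s • h) k * sharp (g + s • h) l)
        - trCLM V (sharp (g + s • h) k * sharp (g + s • h) h * sharp (g + s • h) l)) s := by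
  have h0 := hasDerivAt_add_smul_const g h s
  have hk := hasDerivAt_sharp h0 (hasDerivAt_const s k) hi
  have hl := hasDerivAt_sharp h0 (hasDerivAt_const s l) hi
  refine ((trCLM V).hasFDerivAt.comp_hasDerivAt s (hk.mul hl)).congr_deriv ?_
  simp only [zero_sub, sharp_neg, sharp_comp_mul, map_add, neg_mul, mul_neg, map_neg, mul_assoc]
  ring

/-- Pointwise metric compatibility. The products in Γ account for the derivatives of the two
inverses, the terms ¼ tr(g⁻¹h) tr(g⁻¹kg⁻¹l) of both summands add up to the derivative of the
density, and the other trace terms cancel in pairs. -/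
theorem tracePairing_modelChristoffel {g : V →L[ℝ] W} (hg : g.IsInvertible) (h k l : V →L[ℝ] W) :
    tracePairing g (-modelChristoffel g h k) l + tracePairing g k (-modelChristoffel g h l) =
      tracePairingDeriv g h k l := by
  simp only [tracePairing, tracePairingDeriv, sharp_neg, sharp_modelChristoffel hg]
  generalize sharp g h = A
  generalize sharp g k = K
  generalize sharp g l = L
  have e1 : trCLM V (K * (L * A)) = trCLM V (A * (K * L)) := by
    rw [← mul_assoc, trCLM_mul_comm]
  have e2 : trCLM V (K * A) = trCLM V (A * K) := trCLM_mul_comm _ _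
  simp only [neg_mul, mul_neg, map_neg, add_mul, sub_mul, mul_add, mul_sub, smul_mul_assoc,
    mul_smul_comm, one_mul, mul_one, map_add, map_sub, map_smul, smul_eq_mul, mul_assoc, e1, e2]
  ring

theorem continuousOn_sharp {Z : Type*} [TopologicalSpace Z] {S : Set Z} {g h : Z → (V →L[ℝ] W)}
    (hg : ContinuousOn g S) (hh : ContinuousOn h S) (hi : ∀ z ∈ S, (g z).IsInvertible) :
    ContinuousOn (fun z ↦ sharp (g z) (h z)) S := fun z hz ↦
  ContinuousAt.comp_continuousWithinAt (x := z) (f := fun z ↦ (g z, h z))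
    (g := fun p : (V →L[ℝ] W) × (V →L[ℝ] W) ↦ sharp p.1 p.2)
    (contDiffAt_sharp (hi z hz) (h z)).continuousAt ((hg z hz).prodMk (hh z hz))

theorem continuousOn_tracePairing {Z : Type*} [TopologicalSpace Z] {S : Set Z}
    {g k l : Z → (V →L[ℝ] W)} (hg : ContinuousOn g S) (hk : ContinuousOn k S)
    (hl : ContinuousOn l S) (hi : ∀ z ∈ S, (g z).IsInvertible) :
    ContinuousOn (fun z ↦ tracePairing (g z) (k z) (l z)) S :=
  (trCLM V).continuous.comp_continuousOn
    ((continuousOn_sharp hg hk hi).mul (continuousOn_sharp hg hl hi))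

theorem continuousOn_tracePairingDeriv {Z : Type*} [TopologicalSpace Z] {S : Set Z}
    {g h k l : Z → (V →L[ℝ] W)} (hg : ContinuousOn g S) (hh : ContinuousOn h S)
    (hk : ContinuousOn k S) (hl : ContinuousOn l S) (hi : ∀ z ∈ S, (g z).IsInvertible) :
    ContinuousOn (fun z ↦ tracePairingDeriv (g z) (h z) (k z) (l z)) S := by
  have sh := continuousOn_sharp hg hh hi
  have sk := continuousOn_sharp hg hk hi
  have sl := continuousOn_sharp hg hl hi
  have c := (trCLM V).continuous
  exact ((c.comp_continuousOn ((sh.mul sk).mul sl)).neg.sub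
    (c.comp_continuousOn ((sk.mul sh).mul sl))).add
    ((continuousOn_const.mul (c.comp_continuousOn sh)).mul (c.comp_continuousOn (sk.mul sl)))

set_option linter.unusedSectionVars false in
theorem continuousOn_add_smul {Z : Type*} [TopologicalSpace Z] {S : Set Z}
    {g h : Z → (V →L[ℝ] W)} {τ : Z → ℝ} (hg : ContinuousOn g S) (hh : ContinuousOn h S)
    (hτ : ContinuousOn τ S) : ContinuousOn (fun z ↦ g z + τ z • h z) S :=
  hg.add (hτ.smul hh)

end TracePairing

/-! ### First variation of the volume density -/

section GramDensity

variable {V : Type*} [NormedAddCommGroup V] [NormedSpace ℝ V] [FiniteDimensional ℝ V]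
  {ι : Type*} [Fintype ι] [DecidableEq ι] (b : Module.Basis ι ℝ V)

/-- The volume density `√det g_{ij}` of a form in a basis. -/
def gramDensity (g : V →L[ℝ] V →L[ℝ] ℝ) : ℝ :=
  √(Matrix.det (Matrix.of fun i j : ι ↦ g (b i) (b j)))

set_option linter.unusedSectionVars false in
theorem det_gram_comp (g : V →L[ℝ] V →L[ℝ] ℝ) (A : ModelEndo V) :
    Matrix.det (Matrix.of fun i j : ι ↦ g.comp A (b i) (b j)) =
      Matrix.det (LinearMap.toMatrix b b A.toLinearMap) *
        Matrix.det (Matrix.of fun i j : ι ↦ g (b i) (b j)) := by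
  rw [← Matrix.det_transpose (LinearMap.toMatrix b b A.toLinearMap), ← Matrix.det_mul]
  congr 1
  ext i j
  rw [Matrix.mul_apply]
  simp only [Matrix.of_apply, Matrix.transpose_apply, LinearMap.toMatrix_apply]
  have h1 : A (b i) = ∑ x, b.repr (A (b i)) x • b x := (b.sum_repr _).symm
  change g (A (b i)) (b j) = _
  conv_lhs => rw [h1]
  rw [map_sum, sum_apply]
  exact Finset.sum_congr rfl fun x _ ↦ by rw [map_smul]; rfl

set_option linter.unusedSectionVars false in
theorem det_gram_ne_zero {g : V →L[ℝ] V →L[ℝ] ℝ} (gpos : ∀ v, v ≠ 0 → 0 < g v v) :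
    Matrix.det (Matrix.of fun i j : ι ↦ g (b i) (b j)) ≠ 0 := by
  intro h
  obtain ⟨v, hv, hv0⟩ := Matrix.exists_mulVec_eq_zero_iff.2 h
  have h4 (u : V) (hu : ∀ i, g (b i) u = 0) : g.flip u (∑ j, v j • b j) = 0 := by
    rw [map_sum]
    refine Finset.sum_eq_zero fun i _ ↦ ?_
    rw [map_smul]
    change v i * g (b i) u = 0
    rw [hu, mul_zero]
  set w := ∑ j, v j • b j with hw
  have h1 (i : ι) : g (b i) w = 0 := by
    have h2 := congrFun hv0 i
    rw [hw, map_sum]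
    simpa [Matrix.mulVec, dotProduct, mul_comm] using h2
  have h2 : g w w = 0 := h4 w h1
  have h3 : w ≠ 0 := by
    intro h0
    refine hv (funext fun i ↦ ?_)
    have := congrArg (fun u ↦ b.repr u i) h0
    simpa [hw, map_sum, Finsupp.single_apply] using this
  exact (gpos w h3).ne' h2

/-- det(1 + xA) is 1 + x tr A plus x² times a polynomial in x. -/
theorem hasDerivAt_det_one_add_smul (A : Matrix ι ι ℝ) (s : ℝ) :
    HasDerivAt (fun r : ℝ ↦ Matrix.det (1 + (r - s) • A)) A.trace s := by
  have h1 : HasDerivAt (fun r : ℝ ↦ r - s) 1 s := (hasDerivAt_id s).sub_const s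
  set p := (Matrix.det (1 + (Polynomial.X : Polynomial ℝ) • A.map Polynomial.C)).divX.divX with hp
  have h2 : HasDerivAt (fun r : ℝ ↦ p.eval (r - s)) (p.derivative.eval (s - s) * 1) s :=
    HasDerivAt.comp (h₂ := fun x ↦ p.eval x) (h := fun r ↦ r - s) s (p.hasDerivAt (s - s)) h1
  have h3 : (fun r : ℝ ↦ Matrix.det (1 + (r - s) • A)) = fun r ↦
      1 + A.trace * (r - s) + p.eval (r - s) * (r - s) ^ 2 :=
    funext fun r ↦ Matrix.det_one_add_smul _ _
  rw [h3]
  refine (((h1.const_mul A.trace).const_add 1).add (h2.mul (h1.pow 2))).congr_deriv ?_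
  simp

/-- With G = g + sh one has g + rh = G(1 + (r − s)G⁻¹h), so the Gram determinant of G splits off and
the derivative of the other factor is tr(G⁻¹h). -/
theorem hasDerivAt_gramDensity {g h : V →L[ℝ] V →L[ℝ] ℝ} {s : ℝ}
    (gpos : ∀ v, v ≠ 0 → 0 < (g + s • h) v v) :
    HasDerivAt (fun r : ℝ ↦ gramDensity b (g + r • h))
      (1 / 2 * trCLM V (sharp (g + s • h) h) * gramDensity b (g + s • h)) s := by
  have hi := isInvertible_of_pos gpos
  set G := g + s • h with hG
  have hne := det_gram_ne_zero b gpos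
  have h1 (r : ℝ) : g + r • h = G.comp (1 + (r - s) • sharp G h) := by
    have h2 : G.comp (1 + (r - s) • sharp G h) = G + (r - s) • G.comp (sharp G h) := by
      rw [ContinuousLinearMap.comp_add, ContinuousLinearMap.comp_smul]
      rfl
    rw [h2, comp_sharp hi, hG]
    module
  have h3 (r : ℝ) : Matrix.det (Matrix.of fun i j : ι ↦ (g + r • h) (b i) (b j)) =
      Matrix.det (1 + (r - s) • LinearMap.toMatrix b b (sharp G h).toLinearMap) *
        Matrix.det (Matrix.of fun i j : ι ↦ G (b i) (b j)) := by
    rw [h1, det_gram_comp]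
    congr 2
    have h4 : (1 + (r - s) • sharp G h : ModelEndo V).toLinearMap =
        LinearMap.id + (r - s) • (sharp G h).toLinearMap := rfl
    rw [h4, map_add, map_smul, LinearMap.toMatrix_id]
  have h5 := (hasDerivAt_det_one_add_smul
    (LinearMap.toMatrix b b (sharp G h).toLinearMap) s).mul_const
    (Matrix.det (Matrix.of fun i j : ι ↦ G (b i) (b j)))
  have h6 := h5.sqrt (by simpa using hne)
  unfold gramDensity
  simp_rw [h3]
  refine h6.congr_deriv ?_
  rw [sub_self, zero_smul, add_zero, Matrix.det_one, one_mul, trCLM_apply,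
    LinearMap.trace_eq_matrix_trace ℝ b]
  generalize Matrix.det (Matrix.of fun i j : ι ↦ G (b i) (b j)) = d at *
  -- Only nonvanishing of the determinant is known here. For a negative value the root is 0 by
  -- convention and both sides vanish.
  rcases lt_or_gt_of_ne hne with hd | hd
  · rw [Real.sqrt_eq_zero_of_nonpos hd.le]
    simp
  · have h7 := Real.sqrt_pos.2 hd
    field_simp
    rw [Real.sq_sqrt hd.le]

set_option linter.unusedSectionVars false in
theorem continuous_gramDensity : Continuous (gramDensity b) := by
  refine Real.continuous_sqrt.comp (Continuous.matrix_det ?_)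
  refine continuous_matrix fun i j ↦ ?_
  exact ((ContinuousLinearMap.apply ℝ ℝ (b j)).continuous).comp
    (ContinuousLinearMap.apply ℝ (V →L[ℝ] ℝ) (b i)).continuous

theorem hasDerivAt_tracePairing_mul_gramDensity {g h : V →L[ℝ] V →L[ℝ] ℝ}
    (k l : V →L[ℝ] V →L[ℝ] ℝ) {s : ℝ} (gpos : ∀ v, v ≠ 0 → 0 < (g + s • h) v v) :
    HasDerivAt (fun r : ℝ ↦ tracePairing (g + r • h) k l * gramDensity b (g + r • h))
      (tracePairingDeriv (g + s • h) h k l * gramDensity b (g + s • h)) s := by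
  refine ((hasDerivAt_tracePairing k l (isInvertible_of_pos gpos)).mul
    (hasDerivAt_gramDensity b gpos)).congr_deriv ?_
  rw [tracePairingDeriv, tracePairing]
  ring

end GramDensity

end

/-! ### Differentiation under the integral, and integrals over M as finite sums -/

noncomputable section

set_option synthInstance.maxHeartbeats 400000

/-- The s-derivative is continuous on the compact set [−δ,δ] × C, and its bound there is an
integrable majorant. -/
theorem hasDerivAt_setIntegral_of_isCompact {E : Type*} [TopologicalSpace E] [T2Space E]
    [SecondCountableTopology E] [MeasurableSpace E] [BorelSpace E] {μ : Measure E}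
    [IsFiniteMeasureOnCompacts μ] {C : Set E} (hC : IsCompact C) {δ : ℝ} (hδ : 0 < δ)
    {F F' : ℝ → E → ℝ} (hd : ∀ s ∈ Icc (-δ) δ, ∀ y ∈ C, HasDerivAt (fun r ↦ F r y) (F' s y) s)
    (hF : ∀ s ∈ Icc (-δ) δ, ContinuousOn (F s) C)
    (hF' : ContinuousOn (fun z : ℝ × E ↦ F' z.1 z.2) (Icc (-δ) δ ×ˢ C)) :
    HasDerivAt (fun s ↦ ∫ y in C, F s y ∂μ) (∫ y in C, F' 0 y ∂μ) 0 := by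
  have h0 : (0 : ℝ) ∈ Icc (-δ) δ := ⟨by linarith, hδ.le⟩
  have hnhds : Icc (-δ) δ ∈ 𝓝 (0 : ℝ) := Icc_mem_nhds (by linarith) hδ
  have hm := hC.measurableSet
  obtain ⟨B, hB⟩ := (isCompact_Icc.prod hC).exists_bound_of_continuousOn hF'
  have hF'0 : ContinuousOn (F' 0) C :=
    ContinuousOn.comp (t := Icc (-δ) δ ×ˢ C) (f := fun y : E ↦ ((0 : ℝ), y)) hF'
      (by fun_prop) fun y hy ↦ ⟨h0, hy⟩
  refine (hasDerivAt_integral_of_dominated_loc_of_deriv_le (bound := fun _ ↦ B) hnhds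
    ?_ ((hF 0 h0).integrableOn_compact hC) (hF'0.aestronglyMeasurable hm) ?_ ?_ ?_).2
  · filter_upwards [hnhds] with s hs using (hF s hs).aestronglyMeasurable hm
  · exact (ae_restrict_iff' hm).2 (Eventually.of_forall fun y hy s hs ↦ hB (s, y) ⟨hs, hy⟩)
  · exact integrableOn_const hC.measure_lt_top.ne
  · exact (ae_restrict_iff' hm).2 (Eventually.of_forall fun y hy s hs ↦ hd s hs y hy)

section IntegralVol

variable {n : ℕ} {M : Type*} [TopologicalSpace M] [T2Space M] [SecondCountableTopology M]
  [ChartedSpace (EuclideanSpace ℝ (Fin n)) M] [IsManifold (𝓡 n) ∞ M]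

variable (n M) in
theorem chartPartition_isSubordinate : (chartPartition n M).IsSubordinate
    (fun x ↦ (chartAt (EuclideanSpace ℝ (Fin n)) x).source) :=
  haveI : LocallyCompactSpace M := Manifold.locallyCompact_of_finiteDimensional (𝓡 n)
  (SmoothPartitionOfUnity.exists_isSubordinate_chartAt_source (𝓡 n) M).choose_spec

variable (n) in
/-- The part of a set in the support of a member of `chartPartition`, in the chart. -/
def chartSupport (K : Set M) (p : M) : Set (EuclideanSpace ℝ (Fin n)) :=
  extChartAt (𝓡 n) p '' (K ∩ tsupport (chartPartition n M p))

theorem inter_tsupport_subset (K : Set M) (p : M) :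
    K ∩ tsupport (chartPartition n M p) ⊆ (extChartAt (𝓡 n) p).source := by
  rw [extChartAt_source]
  exact inter_subset_right.trans (chartPartition_isSubordinate n M p)

theorem chartSupport_subset (K : Set M) (p : M) :
    chartSupport n K p ⊆ (extChartAt (𝓡 n) p).target := by
  rintro _ ⟨x, hx, rfl⟩
  exact (extChartAt (𝓡 n) p).map_source (inter_tsupport_subset K p hx)

theorem isCompact_chartSupport {K : Set M} (hK : IsCompact K) (p : M) :
    IsCompact (chartSupport n K p) :=
  (hK.inter_right (isClosed_tsupport _)).image_of_continuousOn
    ((continuousOn_extChartAt p).mono (inter_tsupport_subset K p))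

theorem symm_mem_source {K : Set M} {p : M} {y : EuclideanSpace ℝ (Fin n)}
    (hy : y ∈ chartSupport n K p) : (extChartAt (𝓡 n) p).symm y ∈
      (chartAt (EuclideanSpace ℝ (Fin n)) p).source := by
  rw [← extChartAt_source (𝓡 n)]
  exact (extChartAt (𝓡 n) p).map_target (chartSupport_subset K p hy)

/-- Only finitely many members of the locally finite partition meet K, and each integrand vanishes
off a compact set in its chart. T depends on K alone, so one finite sum serves all the metrics g +
sh. -/
theorem exists_integralVol_eq_sum {K : Set M} (hK : IsCompact K) : ∃ T : Finset M,
    ∀ (g : Field02 n M) (f : M → ℝ), (∀ x ∉ K, f x = 0) → integralVol g f =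
      ∑ p ∈ T, ∫ y in chartSupport n K p,
        chartPartition n M p ((extChartAt (𝓡 n) p).symm y) * f ((extChartAt (𝓡 n) p).symm y)
          * volDensity g p ((extChartAt (𝓡 n) p).symm y) := by
  have hfin := (chartPartition n M).locallyFinite.finite_nonempty_inter_compact hK
  refine ⟨hfin.toFinset, fun g f hf ↦ ?_⟩
  rw [integralVol, finsum_eq_sum_of_support_subset]
  · refine Finset.sum_congr rfl fun p _ ↦ ?_
    refine setIntegral_eq_of_subset_of_forall_sdiff_eq_zero
      (isOpen_extChartAt_target p).measurableSet (chartSupport_subset K p) fun y hy ↦ ?_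
    by_cases hyK : (extChartAt (𝓡 n) p).symm y ∈ K
    · have h1 : (extChartAt (𝓡 n) p).symm y ∉ tsupport (chartPartition n M p) := fun h ↦
        hy.2 ⟨_, ⟨hyK, h⟩, (extChartAt (𝓡 n) p).right_inv hy.1⟩
      rw [image_eq_zero_of_notMem_tsupport h1, zero_mul, zero_mul]
    · rw [hf _ hyK, mul_zero, zero_mul]
  · intro p hp
    rw [Set.Finite.coe_toFinset]
    by_contra hcon
    refine hp (integral_eq_zero_of_ae (Eventually.of_forall fun y ↦ ?_))
    change _ * _ * _ = (0 : ℝ)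
    by_cases hyK : (extChartAt (𝓡 n) p).symm y ∈ K
    · have h1 : chartPartition n M p ((extChartAt (𝓡 n) p).symm y) = 0 := by
        by_contra h
        exact hcon ⟨_, h, hyK⟩
      rw [h1, zero_mul, zero_mul]
    · rw [hf _ hyK, mul_zero, zero_mul]

set_option linter.unusedSectionVars false in
theorem IsSmoothField.continuousOn_coordForm {h : Field02 n M} (hh : IsSmoothField h) (p : M) :
    ContinuousOn (fun x ↦ coordForm p x (h x)) (chartAt (EuclideanSpace ℝ (Fin n)) p).source := by
  have h1 := (trivializationAt (ModelForm n) (fun x : M ↦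
    TangentSpace (𝓡 n) x →L[ℝ] TangentSpace (𝓡 n) x →L[ℝ] ℝ) p).continuousOn
  have h2 := h1.comp (s := (chartAt (EuclideanSpace ℝ (Fin n)) p).source)
    hh.continuous.continuousOn fun x hx ↦ by
      rw [Trivialization.mem_source]
      exact ⟨mem_baseSet_iff.2 hx, by simpa using hx⟩
  refine (continuous_snd.comp_continuousOn h2).congr fun x hx ↦ ?_
  exact (inCoordinates_eq_coordForm p x (mem_baseSet_iff.2 hx) (h x)).symm

theorem IsSmoothField.continuousOn_coordForm_symm {h : Field02 n M} (hh : IsSmoothField h)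
    (K : Set M) (p : M) : ContinuousOn (fun y ↦ coordForm p ((extChartAt (𝓡 n) p).symm y)
      (h ((extChartAt (𝓡 n) p).symm y))) (chartSupport n K p) :=
  ContinuousOn.comp (g := fun x ↦ coordForm p x (h x)) (hh.continuousOn_coordForm p)
    ((continuousOn_extChartAt_symm p).mono (chartSupport_subset K p)) fun _ hy ↦ symm_mem_source hy

theorem continuousOn_chartPartition_symm (K : Set M) (p : M) :
    ContinuousOn (fun y ↦ chartPartition n M p ((extChartAt (𝓡 n) p).symm y))
      (chartSupport n K p) :=
  (chartPartition n M p).contMDiff.continuous.comp_continuousOn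
    ((continuousOn_extChartAt_symm p).mono (chartSupport_subset K p))

set_option linter.unusedSectionVars false in
theorem tr_eq_tracePairing {p x : M} (hx : x ∈ (chartAt (EuclideanSpace ℝ (Fin n)) p).source)
    {g : Form02 n x} (hg : g.toModel.IsInvertible) (k l : Form02 n x) :
    tr ((raise g k).comp (raise g l)) =
      tracePairing (coordForm p x g) (coordForm p x k) (coordForm p x l) := by
  obtain ⟨u, hu⟩ := exists_unit_coordForm hx
  rw [hu, hu, hu, tracePairing]
  have h1 := sharp_pullForm u hg k.toModel
  have h2 := sharp_pullForm u hg l.toModel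
  change _ = trCLM _ (sharp (pullForm _ g.toModel) (pullForm _ k.toModel) *
    sharp (pullForm _ g.toModel) (pullForm _ l.toModel))
  rw [h1, h2, conj_mul_conj, trCLM_conj]
  rfl

set_option linter.unusedSectionVars false in
theorem volDensity_eq_gramDensity {p x : M}
    (hx : x ∈ (chartAt (EuclideanSpace ℝ (Fin n)) p).source) (g : Field02 n M) :
    volDensity g p x =
      gramDensity (EuclideanSpace.basisFun (Fin n) ℝ).toBasis (coordForm p x (g x)) := by
  rw [volDensity, gramDensity]
  congr 2
  ext i j
  rw [Matrix.of_apply, Matrix.of_apply, OrthonormalBasis.coe_toBasis]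
  refine Eq.trans ?_ (pullForm_apply (frameAt p x) (g x) _ _).symm
  rw [frameAt_apply (mem_baseSet_iff.2 hx), frameAt_apply (mem_baseSet_iff.2 hx)]
  rfl

end IntegralVol

end

/-! ### The Levi-Civita property -/

noncomputable section

set_option synthInstance.maxHeartbeats 400000

section ChartIntegrand

theorem add_zero_smul_form {V W : Type*} [NormedAddCommGroup V] [NormedSpace ℝ V]
    [NormedAddCommGroup W] [NormedSpace ℝ W] (g h : V →L[ℝ] W) : g + (0 : ℝ) • h = g := by
  rw [zero_smul, add_zero]

variable {V : Type*} [NormedAddCommGroup V] [NormedSpace ℝ V] [FiniteDimensional ℝ V]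
  {ι : Type*} [Fintype ι] [DecidableEq ι] (b : Module.Basis ι ℝ V)
  {E : Type*} [TopologicalSpace E] [T2Space E] [SecondCountableTopology E] [MeasurableSpace E]
  [BorelSpace E] {μ : Measure E} [IsFiniteMeasureOnCompacts μ] {C : Set E}

set_option linter.unusedSectionVars false in
theorem continuousOn_tracePairing_mul_gramDensity {ρ : E → ℝ} {g k l : E → (V →L[ℝ] V →L[ℝ] ℝ)}
    (hρ : ContinuousOn ρ C) (hg : ContinuousOn g C) (hk : ContinuousOn k C)
    (hl : ContinuousOn l C) (hpos : ∀ y ∈ C, ∀ v, v ≠ 0 → 0 < g y v v) :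
    ContinuousOn (fun y ↦ ρ y * tracePairing (g y) (k y) (l y) * gramDensity b (g y)) C :=
  (hρ.mul (continuousOn_tracePairing hg hk hl fun y hy ↦ isInvertible_of_pos (hpos y hy))).mul
    ((continuous_gramDensity b).comp_continuousOn hg)

theorem hasDerivAt_setIntegral_tracePairing (hC : IsCompact C) {δ : ℝ} (hδ : 0 < δ) {ρ : E → ℝ}
    {g h k l : E → (V →L[ℝ] V →L[ℝ] ℝ)} (hρ : ContinuousOn ρ C) (hg : ContinuousOn g C)
    (hh : ContinuousOn h C) (hk : ContinuousOn k C) (hl : ContinuousOn l C)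
    (hpos : ∀ s ∈ Icc (-δ) δ, ∀ y ∈ C, ∀ v, v ≠ 0 → 0 < (g y + s • h y) v v) :
    HasDerivAt (fun s : ℝ ↦ ∫ y in C, ρ y * tracePairing (g y + s • h y) (k y) (l y)
        * gramDensity b (g y + s • h y) ∂μ)
      (∫ y in C, ρ y * tracePairingDeriv (g y) (h y) (k y) (l y) * gramDensity b (g y) ∂μ) 0 := by
  have hsnd {f : E → (V →L[ℝ] V →L[ℝ] ℝ)} (hf : ContinuousOn f C) :
      ContinuousOn (fun z : ℝ × E ↦ f z.2) (Icc (-δ) δ ×ˢ C) :=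
    hf.comp continuousOn_snd fun z hz ↦ hz.2
  have hρ' : ContinuousOn (fun z : ℝ × E ↦ ρ z.2) (Icc (-δ) δ ×ˢ C) :=
    hρ.comp continuousOn_snd fun z hz ↦ hz.2
  have hG := continuousOn_add_smul (τ := fun z : ℝ × E ↦ z.1) (hsnd hg) (hsnd hh) continuousOn_fst
  have key := hasDerivAt_setIntegral_of_isCompact (μ := μ) hC hδ
    (F := fun s y ↦ ρ y * tracePairing (g y + s • h y) (k y) (l y)
        * gramDensity b (g y + s • h y))
    (F' := fun s y ↦ ρ y * tracePairingDeriv (g y + s • h y) (h y) (k y) (l y)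
        * gramDensity b (g y + s • h y))
    (fun s hs y hy ↦ ?_) (fun s hs ↦ ?_) ?_
  · refine key.congr_deriv ?_
    congr 1
    funext y
    rw [add_zero_smul_form]
  · have h1 := (hasDerivAt_tracePairing_mul_gramDensity b (k y) (l y) (hpos s hs y hy)).const_mul
      (ρ y)
    simpa only [mul_assoc] using h1
  · exact continuousOn_tracePairing_mul_gramDensity b hρ
      (continuousOn_add_smul hg hh continuousOn_const) hk hl (hpos s hs)
  · exact (hρ'.mul (continuousOn_tracePairingDeriv hG (hsnd hh) (hsnd hk) (hsnd hl)
      fun z hz ↦ isInvertible_of_pos (hpos z.1 hz.1 z.2 hz.2))).mul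
      ((continuous_gramDensity b).comp_continuousOn hG)

end ChartIntegrand

section LeviCivita

variable {n : ℕ} {M : Type*} [TopologicalSpace M] [T2Space M] [SecondCountableTopology M]
  [ChartedSpace (EuclideanSpace ℝ (Fin n)) M] [IsManifold (𝓡 n) ∞ M]

set_option linter.unusedSectionVars false in
theorem tr_raise_eq_zero {x : M} {g k l : Form02 n x} (h : k = 0 ∨ l = 0) :
    tr ((raise g k).comp (raise g l)) = 0 := by
  rw [tr_comp, raise_toModel, raise_toModel]
  rcases h with rfl | rfl
  · rw [toModel_zero, sharp_zero, zero_mul, map_zero]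
  · rw [toModel_zero, sharp_zero, mul_zero, map_zero]

theorem exists_canonicalMetric_eq_sum {K : Set M} (hK : IsCompact K) : ∃ T : Finset M,
    ∀ g k l : Field02 n M, (∀ x v, v ≠ 0 → 0 < g x v v) → (∀ x ∉ K, k x = 0 ∨ l x = 0) →
      canonicalMetric g k l = ∑ p ∈ T, ∫ y in chartSupport n K p,
        chartPartition n M p ((extChartAt (𝓡 n) p).symm y)
          * tracePairing (coordForm p ((extChartAt (𝓡 n) p).symm y) (g _))
            (coordForm p ((extChartAt (𝓡 n) p).symm y) (k _))
            (coordForm p ((extChartAt (𝓡 n) p).symm y) (l _))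
          * gramDensity (EuclideanSpace.basisFun (Fin n) ℝ).toBasis
            (coordForm p ((extChartAt (𝓡 n) p).symm y) (g _)) := by
  obtain ⟨T, hT⟩ := exists_integralVol_eq_sum (n := n) hK
  refine ⟨T, fun g k l hg h0 ↦ ?_⟩
  rw [canonicalMetric, hT g _ fun x hx ↦ tr_raise_eq_zero (h0 x hx)]
  refine Finset.sum_congr rfl fun p _ ↦ setIntegral_congr_fun
    (isCompact_chartSupport hK p).measurableSet fun y hy ↦ ?_
  have hx := symm_mem_source hy
  have hi : (g ((extChartAt (𝓡 n) p).symm y)).toModel.IsInvertible := isInvertible_of_pos (hg _)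
  beta_reduce
  rw [tr_eq_tracePairing hx hi, volDensity_eq_gramDensity hx]

set_option linter.unusedSectionVars false in
theorem exists_forall_pos {g h : Field02 n M} (hg : IsMetric g) (hh : IsTangent h) :
    ∃ δ : ℝ, 0 < δ ∧ ∀ s ∈ Icc (-δ) δ, ∀ x v, v ≠ 0 → 0 < (g + s • h) x v v := by
  -- Only positivity is wanted, so the time interval is {0}, where the angle condition holds because
  -- 0 < 4.
  obtain ⟨ε, hε, hpos⟩ := exists_pos_and_angleDomain (a := 0) hg hh hh hh fun t ht x ↦ by
    obtain rfl : t = 0 := le_antisymm ht.2 ht.1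
    rw [angleDomain_iff (hg.devSq_nonneg (hh.symm x)), zero_mul]
    right
    norm_num
  refine ⟨ε / 2, half_pos hε, fun s hs x ↦ (hpos s ⟨?_, ?_⟩ 0 ⟨le_rfl, le_rfl⟩ x).1⟩
  · linarith [hs.1]
  · linarith [hs.2]

set_option linter.unusedSectionVars false in
theorem christoffel_eq_zero {g h k : Field02 n M} {x : M} (hk : k x = 0) :
    (-christoffel g h k) x = 0 := by
  have h1 : (k x).toModel = 0 := (congrArg Form02.toModel hk).trans toModel_zero
  have h2 : modelChristoffel (g x).toModel (h x).toModel (k x).toModel = 0 := by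
    rw [modelChristoffel_comm, h1, modelChristoffel_zero_left]
  have h3 : -modelChristoffel (g x).toModel (h x).toModel (k x).toModel = 0 := by
    rw [h2, neg_zero]
  exact h3

set_option linter.unusedSectionVars false in
theorem coordForm_neg_christoffel {p x : M}
    (hx : x ∈ (chartAt (EuclideanSpace ℝ (Fin n)) p).source) {g h k : Field02 n M}
    (hg : (g x).toModel.IsInvertible) :
    coordForm p x ((-christoffel g h k) x) =
      -modelChristoffel (coordForm p x (g x)) (coordForm p x (h x)) (coordForm p x (k x)) :=
  congrArg (fun β : ModelForm n ↦ -β) (coordForm_christoffelAt hx hg (h x) (k x))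

set_option linter.unusedSectionVars false in
theorem IsSmoothField.neg {h : Field02 n M} (hh : IsSmoothField h) : IsSmoothField (-h) := by
  rw [isSmoothField_iff] at *
  exact fun x₀ ↦ (hh x₀).neg

set_option linter.unusedSectionVars false in
theorem christoffel_comm (g h k : Field02 n M) : christoffel g h k = christoffel g k h := by
  funext x
  suffices H : (christoffelAt (g x) (h x) (k x)).toModel =
    (christoffelAt (g x) (k x) (h x)).toModel from H
  rw [christoffelAt_toModel, christoffelAt_toModel, modelChristoffel_comm]

/-- Differentiation under the integral in finitely many charts, then the pointwise identity. The
support of k serves all three integrals, as Γ(h,k) vanishes wherever k does. -/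
theorem hasDerivAt_canonicalMetric {g h k l : Field02 n M} (hg : IsMetric g) (hh : IsTangent h)
    (hk : IsTangent k) (hl : IsTangent l) :
    HasDerivAt (fun s : ℝ ↦ canonicalMetric (g + s • h) k l)
      (canonicalMetric g (-christoffel g h k) l + canonicalMetric g k (-christoffel g h l)) 0 := by
  obtain ⟨δ, hδ, hpos⟩ := exists_forall_pos hg hh
  obtain ⟨T, hT⟩ := exists_canonicalMetric_eq_sum (n := n) hk.compact_support
  have hk0 (x : M) (hx : x ∉ closure {x | k x ≠ 0}) : k x = 0 := by
    by_contra h0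
    exact hx (subset_closure h0)
  have hcompact := isCompact_chartSupport (n := n) hk.compact_support
  have hcont {f : Field02 n M} (hf : IsSmoothField f) (p : M) :=
    hf.continuousOn_coordForm_symm (closure {x | k x ≠ 0}) p
  have hcρ (p : M) := continuousOn_chartPartition_symm (n := n) (closure {x | k x ≠ 0}) p
  have hposg (p : M) : ∀ y ∈ chartSupport n (closure {x | k x ≠ 0}) p, ∀ v, v ≠ 0 →
      0 < coordForm p ((extChartAt (𝓡 n) p).symm y) (g ((extChartAt (𝓡 n) p).symm y)) v v :=
    fun y hy ↦ (coordForm_pos_iff (symm_mem_source hy) _).2 (hg.pos _)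
  have hder (p : M) := hasDerivAt_setIntegral_tracePairing (μ := volume)
    (EuclideanSpace.basisFun (Fin n) ℝ).toBasis (hcompact p) hδ (hcρ p) (hcont hg.smooth p)
    (hcont hh.smooth p) (hcont hk.smooth p) (hcont hl.smooth p)
    fun s hs y hy ↦ (coordForm_pos_iff (symm_mem_source hy) _).2 (hpos s hs _)
  have hsum := HasDerivAt.fun_sum fun p (_ : p ∈ T) ↦ hder p
  have hev : ∀ᶠ s in 𝓝 (0 : ℝ), s ∈ Icc (-δ) δ := Icc_mem_nhds (by linarith) hδ
  refine (hsum.congr_of_eventuallyEq ?_).congr_deriv ?_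
  · filter_upwards [hev] with s hs
    exact hT _ k l (hpos s hs) fun x hx ↦ Or.inl (hk0 x hx)
  · rw [hT g _ l hg.pos fun x hx ↦ Or.inl (christoffel_eq_zero (hk0 x hx)),
      hT g k _ hg.pos fun x hx ↦ Or.inl (hk0 x hx), ← Finset.sum_add_distrib]
    refine Finset.sum_congr rfl fun p _ ↦ ?_
    have hΓ {f : Field02 n M} (hf : IsTangent f) : IsSmoothField (-christoffel g h f) :=
      (hh.christoffel hg hf).smooth.neg
    rw [← integral_add]
    · refine setIntegral_congr_fun (hcompact p).measurableSet fun y hy ↦ ?_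
      have hx := symm_mem_source hy
      beta_reduce
      rw [coordForm_neg_christoffel hx (hg.isInvertible _),
        coordForm_neg_christoffel hx (hg.isInvertible _),
        ← tracePairing_modelChristoffel (isInvertible_of_pos (hposg p y hy))]
      ring
    · exact (continuousOn_tracePairing_mul_gramDensity _ (hcρ p) (hcont hg.smooth p)
        (hcont (hΓ hk) p) (hcont hl.smooth p) (hposg p)).integrableOn_compact (hcompact p)
    · exact (continuousOn_tracePairing_mul_gramDensity _ (hcρ p) (hcont hg.smooth p)
        (hcont hk.smooth p) (hcont (hΓ hl) p) (hposg p)).integrableOn_compact (hcompact p)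

theorem isLeviCivita_christoffel : IsLeviCivita (christoffel (n := n) (M := M)) where
  tangent _ _ _ hg hh hk := hh.christoffel hg hk
  torsion_free _ _ _ _ _ _ := christoffel_comm _ _ _
  metric _ _ _ _ hg hh hk hl := hasDerivAt_canonicalMetric hg hh hk hl

end LeviCivita

end

/-! ### The theorem -/

theorem theorem4p7 {n : ℕ} {M : Type*} [TopologicalSpace M] [T2Space M]
    [SecondCountableTopology M] [ChartedSpace (EuclideanSpace ℝ (Fin n)) M]
    [IsManifold (𝓡 n) ∞ M]
    (g₀ h k l : Field02 n M) (hg₀ : IsMetric g₀)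
    (hh : IsTangent h) (hk : IsTangent k) (hl : IsTangent l)
    (a : ℝ) (ha : 0 < a) (g : ℝ → Field02 n M) (hg : IsGeodesic a g)
    (hg_zero : g 0 = g₀) (hg_deriv : timeDeriv a g 0 = h) :
    IsLeviCivita (christoffel (n := n) (M := M)) ∧
    (∃ J : ℝ → Field02 n M, IsJacobiField a g J ∧ J 0 = k ∧ covDeriv a g J 0 = l) ∧
    ∀ J : ℝ → Field02 n M, IsJacobiField a g J → J 0 = k → covDeriv a g J 0 = l →
      ∀ t ∈ Icc 0 a, ∀ x : M,
        let H : Endo n x := raise (g₀ x) (h x)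
        let K : Endo n x := raise (g₀ x) (k x)
        let L : Endo n x := raise (g₀ x) (l x)
        let Lhat : Endo n x :=
          -(K.comp H) + L + raise (g₀ x) (christoffel g₀ k h x)
        let H₀ : Endo n x := traceless H
        let L₀ : Endo n x := traceless Lhat
        let b : ℝ := bFun H t
        let P : Endo n x := raise (g t x) (timeDeriv a g t x)
        (H₀ ≠ 0 →
          (∃! N : Endo n x, IsPerp H P t N) ∧
          Summable (fun m : ℕ ↦ adTerm (b • H) (b • Lhat) (m + 1)) ∧
          ∀ N : Endo n x, IsPerp H P t N →
            J t x =
              (tr (H.comp Lhat) / tr (H.comp H)) • t • timeDeriv a g t x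
              + ((tr Lhat * tr (H.comp H) - tr (Lhat.comp H) * tr H) / tr (H.comp H)) •
                  t • (g t x).comp N
              + b • (g t x).comp (-(tr (H₀.comp L₀) / tr (H₀.comp H₀)) • H₀ + L₀)
              + (g t x).comp (∑' m : ℕ, adTerm (b • H) (b • Lhat) (m + 1))
              + (k x).comp (raise (g₀ x) (g t x))) ∧
        (H₀ = 0 →
          J t x = b • (g t x).comp Lhat + (k x).comp (raise (g₀ x) (g t x))) := by
  subst hg_zero hg_deriv
  refine ⟨isLeviCivita_christoffel, exists_isJacobiField ha hg hh hk hl, ?_⟩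
  rintro J hJ rfl hJl t ht x
  obtain ⟨h1, h2⟩ := hJ.formula ha hg hJl ht x
  refine ⟨fun h0 ↦ ?_, h2⟩
  have h00 : (0 : ℝ) ∈ Icc 0 a := ⟨le_rfl, ha.le⟩
  have hq := (hg.smooth.metric 0 h00).devSq_pos (hh.symm x) h0
  have hP : (raise (g t x) (timeDeriv a g t x)).toModel =
      velocity (raise (g 0 x) (timeDeriv a g 0 x)).toModel t := by
    rw [raise_toModel, (hg.eq_closedForm ha ht x rfl).2.2,
      sharp_comp ((hg.smooth.metric t ht).isInvertible x)]
  exact ⟨⟨perpEndo (raise (g 0 x) (timeDeriv a g 0 x)).toModel t, (isPerp_iff hq hP).2 rfl,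
    fun N hN ↦ (isPerp_iff hq hP).1 hN⟩, summable_adTerm _ _, h1 hq⟩
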